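/- **Setting.** Let $d\ge1$, let $|\cdot|=\|\cdot\|_2$ be the Euclidean norm, and let $a\wedge b=\min\{a,b\}$. For $f:\mathbb Z^d\to\mathbb R$ and $\mu\in\mathbb R^d$ write $f^{(\mu)}(x)=f(x)e^{\mu\cdot x}$ and $\hat f(k)=\sum_x f(x)e^{-ik\cdot x}$. A function is called symmetric if it is invariant under permutations and sign changes of the components of $x$. For $S:\mathbb Z^d\to[0,\infty)$ set $$\Omega_S=\Bigl\{\mu\in\mathbb R^d:\sum_x S^{(\mu)}(x)<\infty\Bigr\},\qquad m_S=\sup\{t\ge0:te_1\in\Omega_S\},\qquad |x|_S=\frac1{m_S}\max_{\mu\in\overline{\Omega_S}}\mu\cdot x .$$ For $M,K,\zeta>0$ let $\mathcal Q_{M,K,\zeta}$ be the set of pairs $(Q,g)$ of functions $\mathbb Z^d\to\mathbb R$ such that $$\|Q\|_1,\ \bigl\||y|^{2+\zeta}Q(y)\bigr\|_1\le M,\qquad \mathrm{Re}[\hat Q(0)-\hat Q(k)]\ge K|k|^2\quad(k\in[-\pi,\pi]^d),$$ $$\|g\|_1,\ \bigl\||y|^{\zeta}g(y)\bigr\|_1,\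 \bigl\||y|^2g(y)\bigr\|_{p_d\wedge2}\le M,$$ where $p_1=2$ and $p_d=\frac{d}{d-2+(\zeta\wedge2)}$ for $d\ge2$, and such that, if $d\ge4$, also $$\bigl\||y|^{d-1}Q(y)\bigr\|_{\frac d3\wedge2},\ \bigl\||y|^{d-1}g(y)\bigr\|_2\le M.$$ For $a\ge0$ if $d>2$, and for $a>0$ if $d\le2$, the massive continuum Green function is $$\mathsf G_a(x)=\int_0^\infty\frac{dt}{(2\pi t)^{d/2}}\,e^{-\frac1{2t}|x|^2}e^{-\frac12ta^2}\qquad(x\in\mathbb R^d\setminus\{0\}).$$ **Theorem.** Let $d\ge1$, $z_c\in\mathbb R$, $\delta>0$ and $M,K,\zeta>0$. For each $z\in[z_c-\delta,z_c)$ let $S_z:\mathbb Z^d\to[0,\infty)$ be symmetric and let $h_z,J_z\in\ell^1(\mathbb Z^d)$ be real-valued and symmetric. Write $\Omega_z=\Omega_{S_z}$, $m_z=m_{S_z}$, $|\cdot|_z=|\cdot|_{S_z}$ and $\sigma_z^2=\sum_x|x|^2J_z(x)$. Suppose that for each $z\in[z_c-\delta,z_c)$: * $\Omega_z$ is open and contains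 $0$, and $\mu_1e_1\notin\Omega_z$ for some $\mu_1>0$ (which may depend on $z$); * $S_z=h_z+J_z*S_z$; * $(J_z^{(\mu)},h_z^{(\mu)})\in\mathcal Q_{M,K,\zeta}$ and $\sum_xh_z^{(\mu)}(x)>0$ for every $\mu\in\overline{\Omega_z}$. Suppose also that $m_z\to0$ as $z\uparrow z_c$. Let $s\in[0,\infty)$, with $s>0$ if $d\le2$. If $z\uparrow z_c$ and $x\in\mathbb Z^d$, $|x|\to\infty$, in such a way that $m_z|x|_z\to s$, then, with $\hat x=x/|x|$, $$S_z(x)=\frac{d}{\sigma_z^2\,|x|^{d-2}}\;\mathsf G_s(\hat x)\,\bigl[\hat h_z(0)+o(1)\bigr].$$ -/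

import Mathlib

open Filter Topology

namespace OZ

/-- The integer lattice of dimension `d`. -/
abbrev Lattice (d : ℕ) : Type := Fin d → ℤ

/-- Euclidean space of dimension `d`; `‖·‖` is the Euclidean norm. -/
abbrev Space (d : ℕ) : Type := EuclideanSpace ℝ (Fin d)

variable {d : ℕ}

/-- A lattice point, viewed as a point of Euclidean space. -/
def toSpace (x : Lattice d) : Space d := WithLp.toLp 2 (fun i => (x i : ℝ))

/-- The direction `x / |x|` of a (nonzero) lattice point. -/
noncomputable def direction (x : Lattice d) : Space d := ‖toSpace x‖⁻¹ • toSpace x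

/-- The first standard basis vector. -/
noncomputable def e₁ (d : ℕ) [NeZero d] : Space d := EuclideanSpace.single (0 : Fin d) 1

/-- Invariance under permutations of the components and under sign changes of a component. -/
def IsSymmetric (f : Lattice d → ℝ) : Prop :=
  (∀ (σ : Equiv.Perm (Fin d)) (x : Lattice d), f (fun i => x (σ i)) = f x) ∧
    ∀ (i : Fin d) (x : Lattice d), f (Function.update x i (-x i)) = f x

/-- The exponential tilt `x ↦ f(x) exp(μ · x)`. -/
noncomputable def tilt (f : Lattice d → ℝ) (μ : Space d) : Lattice d → ℝ :=
  fun x => f x * Real.exp (inner ℝ μ (toSpace x))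

/-- The Fourier transform `∑ₓ f(x) exp(-i k · x)`. -/
noncomputable def latticeFourier (f : Lattice d → ℝ) (k : Space d) : ℂ :=
  ∑' x : Lattice d, (f x : ℂ) * Complex.exp (-(Complex.I * ((inner ℝ k (toSpace x) : ℝ) : ℂ)))

/-- The convolution of two functions on the lattice. -/
noncomputable def conv (f g : Lattice d → ℝ) : Lattice d → ℝ :=
  fun x => ∑' y : Lattice d, f (x - y) * g y

/-- The `ℓᵖ` norm of a function on the lattice, with value `∞` if the function is not in `ℓᵖ`. -/
noncomputable def latticeNorm (p : ENNReal) (f : Lattice d → ℝ) : ENNReal :=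
  MeasureTheory.eLpNorm f p MeasureTheory.Measure.count

/-- The set of tilts at which the tilted susceptibility `∑ₓ S(x) exp(μ · x)` is finite
(used for `S ≥ 0`). -/
def Omega (S : Lattice d → ℝ) : Set (Space d) := {μ | Summable (tilt S μ)}

/-- The mass: the supremum of those `t ≥ 0` for which the susceptibility tilted by
`t e₁` is finite. -/
noncomputable def mass [NeZero d] (S : Lattice d → ℝ) : ℝ :=
  sSup {t : ℝ | 0 ≤ t ∧ t • e₁ d ∈ Omega S}

/-- The norm `|x|_S = (max {μ · x : μ ∈ closure Ω}) / m_S`. -/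
noncomputable def massNorm [NeZero d] (S : Lattice d → ℝ) (x : Space d) : ℝ :=
  sSup ((fun μ : Space d => inner ℝ μ x) '' closure (Omega S)) / mass S

/-- The first standing assumption, on `S` alone. -/
structure AssumptionOmega [NeZero d] (S : Lattice d → ℝ) : Prop where
  nonneg : ∀ x, 0 ≤ S x
  symmetric : IsSymmetric S
  isOpen : IsOpen (Omega S)
  zero_mem : (0 : Space d) ∈ Omega S
  exists_notMem : ∃ t : ℝ, 0 < t ∧ t • e₁ d ∉ Omega S

/-- The exponent `p_d`. -/
noncomputable def pExp (d : ℕ) (ζ : ℝ) : ℝ :=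
  if d = 1 then 2 else (d : ℝ) / ((d : ℝ) - 2 + min ζ 2)

/-- The class of pairs `(Q, g)` of functions that obey the moment bounds with constant `M`
and the infrared bound with constant `K`. The torus is represented by the cube `[-π, π]^d`. -/
structure ClassQ (M K ζ : ℝ) (Q g : Lattice d → ℝ) : Prop where
  Q_norm : latticeNorm 1 Q ≤ ENNReal.ofReal M
  Q_moment : latticeNorm 1 (fun y => ‖toSpace y‖ ^ (2 + ζ) * Q y) ≤ ENNReal.ofReal M
  infrared : ∀ k : Space d, (∀ i, |k i| ≤ Real.pi) →
    K * ‖k‖ ^ 2 ≤ (latticeFourier Q 0 - latticeFourier Q k).re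
  g_norm : latticeNorm 1 g ≤ ENNReal.ofReal M
  g_moment : latticeNorm 1 (fun y => ‖toSpace y‖ ^ ζ * g y) ≤ ENNReal.ofReal M
  g_moment_two : latticeNorm (ENNReal.ofReal (min (pExp d ζ) 2)) (fun y => ‖toSpace y‖ ^ 2 * g y)
    ≤ ENNReal.ofReal M
  Q_moment_high : 4 ≤ d →
    latticeNorm (ENNReal.ofReal (min ((d : ℝ) / 3) 2)) (fun y => ‖toSpace y‖ ^ (d - 1) * Q y)
      ≤ ENNReal.ofReal M
  g_moment_high : 4 ≤ d →
    latticeNorm 2 (fun y => ‖toSpace y‖ ^ (d - 1) * g y) ≤ ENNReal.ofReal M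

/-- The second standing assumption, with constants `M`, `K`, `ζ`: the generalised
Ornstein-Zernike equation `S = h + J * S`, and bounds that are uniform over all tilts in the
closure of `Ω`. The Fourier transform of a real function is real at `0`. -/
structure AssumptionJ (M K ζ : ℝ) (S h J : Lattice d → ℝ) : Prop where
  summable_J : Summable J
  summable_h : Summable h
  symmetric_J : IsSymmetric J
  symmetric_h : IsSymmetric h
  equation : ∀ x, S x = h x + conv J S x
  mem_class : ∀ μ ∈ closure (Omega S), ClassQ M K ζ (tilt J μ) (tilt h μ)
  fourier_pos : ∀ μ ∈ closure (Omega S), 0 < (latticeFourier (tilt h μ) 0).re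

/-- `σ² = ∑ₓ |x|² J(x)`. -/
noncomputable def sigmaSq (J : Lattice d → ℝ) : ℝ :=
  ∑' x : Lattice d, ‖toSpace x‖ ^ 2 * J x

/-- The massive continuum Green function
`G_a(x) = ∫₀^∞ (2πt)^{-d/2} exp(-|x|²/(2t)) exp(-t a²/2) dt`. -/
noncomputable def massiveGreen (a : ℝ) (x : Space d) : ℝ :=
  ∫ t in Set.Ioi (0 : ℝ),
    1 / (2 * Real.pi * t) ^ ((d : ℝ) / 2) * Real.exp (-(1 / (2 * t)) * ‖x‖ ^ 2) *
      Real.exp (-(1 / 2) * t * a ^ 2)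

end OZ

namespace OZ

open MeasureTheory

/-! ### Summability, moments and exponential tilts -/

section Moments

variable {d : ℕ}

/-! In Fourier space the equation reads Ŝ = ĥ/(1 - Ĵ), so S(x) is (2π)^{-d} times the integral of
ĥ(k) e^{ik·x}/(1 - Ĵ(k)) over the cube. At k = ξ/|x| the denominator is 1 - Ĵ(0) + σ²|k|²/(2d) up to
a smaller error. It should therefore behave like σ²(s² + |ξ|²)/(2d|x|²), and 2/(s² + |ξ|²) is the
Fourier transform of G_s. Two points need proof: the size of the gap 1 - Ĵ(0), and the negligibility
of frequencies much larger than 1/|x|.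

The gap. At a point μ where a ray leaves Ω, the tilted J has total mass one (`tsum_tilt_J_edge`):
otherwise the tilted susceptibility ∑h/(1 - ∑J) would stay bounded along the ray and μ would lie in
Ω. Since ∑J^{(μ)} = ∑J + σ²|μ|²/(2d) + O(|μ|^{2+a}) with a = min ζ 1, all such points have the same
norm to leading order. Hence the gap is asymptotic to σ²m²/(2d), and |x|_S to |x|, as m → 0
(`gap_mass_bound`, `massNorm_bound`); in particular m|x| → s.

The cutoff. Split Ŝ by the lattice heat kernel exp(-T ∑(1 - cos k_j)) with T = τ|x|². The
low-frequency part, rescaled, converges by dominated convergence to a heat-smoothed Green function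
(`tendsto_integral_rescaled_sub`, `integral_resolvent`). The high-frequency part is O(√τ |x|^{2-d}),
uniformly in z (`tail_bound`). Letting τ → 0 at the end removes both errors.

The tail. Integrating by parts d - 1 times gains |x|^{-(d-1)}, and it remains to bound the L¹ norm
of the corresponding derivative of (1 - heat)Ŝ by O(√T). Derivatives of order n are measured in
L^{d/n} on dyadic annuli |k| ~ r. These exponents fit Hölder's inequality, and in this scale a
function homogeneous of degree -2 has all its derivatives of size r^{-2}. The moment hypotheses,
through interpolation and a weak Hausdorff-Young inequality, give size r² for the derivatives of Ĵ
of orders 1 to d - 1 and size 1 for those of ĥ (`annNorm_J_le`, `annNorm_h_le`). Differentiating Ŝ =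
ĥ + ĴŜ and dividing by |1 - Ĵ| ≥ Kr² gives size r^{-2} for Ŝ by induction (`annNorm_S_le`). The
cutoff contributes Tr²/(1 + Tr²), a last Hölder factor contributes r, and the dyadic sum of Tr/(1 +
Tr²) is O(√T).

Smoothness itself is free: Ω contains a ball around 0, so S, J and h have exponential moments. Only
the constants have to come from the class of pairs. -/

theorem lattice_rpow_bound {p M : ℝ} (hp : 0 < p) (hM : 0 ≤ M) {f : Lattice d → ℝ}
    (hf : latticeNorm (ENNReal.ofReal p) f ≤ ENNReal.ofReal M) :
    Summable (fun y => |f y| ^ p) ∧ ∑' y, |f y| ^ p ≤ M ^ p := by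
  have hp0 : ENNReal.ofReal p ≠ 0 := by simpa using hp
  rw [latticeNorm, eLpNorm_eq_lintegral_rpow_enorm_toReal hp0 ENNReal.ofReal_ne_top,
    ENNReal.toReal_ofReal hp.le, lintegral_count, one_div,
    ENNReal.rpow_inv_le_iff hp, ENNReal.ofReal_rpow_of_nonneg hM hp.le] at hf
  have key : ∀ y, ‖f y‖ₑ ^ p = ENNReal.ofReal (|f y| ^ p) := fun y => by
    rw [← ENNReal.ofReal_rpow_of_nonneg (abs_nonneg _) hp.le, Real.enorm_eq_ofReal_abs]
  simp_rw [key] at hf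
  have hs : Summable (fun y => |f y| ^ p) := by
    have := ENNReal.summable_toReal (ne_top_of_le_ne_top ENNReal.ofReal_ne_top hf)
    refine this.congr fun y => ENNReal.toReal_ofReal (by positivity)
  refine ⟨hs, ?_⟩
  rw [← ENNReal.ofReal_tsum_of_nonneg (fun y => by positivity) hs] at hf
  exact (ENNReal.ofReal_le_ofReal_iff (by positivity)).1 hf

theorem lattice_one_bound {M : ℝ} (hM : 0 ≤ M) {f : Lattice d → ℝ}
    (hf : latticeNorm 1 f ≤ ENNReal.ofReal M) :
    Summable (fun y => |f y|) ∧ ∑' y, |f y| ≤ M := by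
  have := lattice_rpow_bound (p := 1) one_pos hM (f := f) (by simpa using hf)
  simpa using this

/-- The inclusion of `ℓᵖ` in `ℓ²` for `p ≤ 2`. -/
theorem lattice_sq_bound {p M : ℝ} (hp : 0 < p) (hp2 : p ≤ 2) (hM : 0 ≤ M) {f : Lattice d → ℝ}
    (hf : latticeNorm (ENNReal.ofReal p) f ≤ ENNReal.ofReal M) :
    Summable (fun y => f y ^ 2) ∧ ∑' y, f y ^ 2 ≤ M ^ 2 := by
  obtain ⟨hs, hb⟩ := lattice_rpow_bound hp hM hf
  have hpt : ∀ y, |f y| ≤ M := fun y => by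
    have h1 : |f y| ^ p ≤ M ^ p := (hs.le_tsum y fun _ _ => by positivity).trans hb
    exact (Real.rpow_le_rpow_iff (abs_nonneg _) hM hp).1 h1
  have hle : ∀ y, f y ^ 2 ≤ M ^ (2 - p) * |f y| ^ p := fun y => by
    rcases eq_or_ne (f y) 0 with h0 | h0
    · rw [h0]; simp [hp.ne']
    · have hpos : 0 < |f y| := abs_pos.2 h0
      have : f y ^ 2 = |f y| ^ (2 - p) * |f y| ^ p := by
        rw [← Real.rpow_add hpos]; simp
      rw [this]
      have := Real.rpow_le_rpow hpos.le (hpt y) (show 0 ≤ 2 - p by linarith)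
      gcongr
  have hs2 : Summable (fun y => f y ^ 2) :=
    Summable.of_nonneg_of_le (fun y => by positivity) hle (hs.mul_left _)
  refine ⟨hs2, (hs2.tsum_le_tsum hle (hs.mul_left _)).trans ?_⟩
  rw [tsum_mul_left]
  rcases hM.eq_or_lt with h0 | h0
  · have : ∑' y, |f y| ^ p = 0 := by
      have : ∀ y, |f y| ^ p = 0 := fun y => by
        have := hpt y
        rw [← h0] at this
        rw [le_antisymm this (abs_nonneg _), Real.zero_rpow hp.ne']
      simp [this]
    rw [this]; simp; positivity
  · calc M ^ (2 - p) * ∑' y, |f y| ^ p ≤ M ^ (2 - p) * M ^ p := by gcongr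
      _ = M ^ 2 := by rw [← Real.rpow_add h0]; simp

theorem one_le_norm_toSpace {y : Lattice d} (hy : y ≠ 0) : 1 ≤ ‖toSpace y‖ := by
  obtain ⟨i, hi⟩ : ∃ i, y i ≠ 0 := by
    by_contra! h
    exact hy (funext h)
  have h1 : ‖(toSpace y) i‖ ≤ ‖toSpace y‖ := PiLp.norm_apply_le _ i
  refine le_trans ?_ h1
  have : (1 : ℝ) ≤ |((y i : ℤ) : ℝ)| := by
    exact_mod_cast Int.one_le_abs hi
  simpa [toSpace] using this

@[simp] theorem toSpace_zero : toSpace (0 : Lattice d) = 0 := by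
  ext i; simp [toSpace]

@[simp] theorem toSpace_apply (y : Lattice d) (i : Fin d) : toSpace y i = (y i : ℝ) := rfl

theorem abs_coord_le (y : Lattice d) (i : Fin d) : |(y i : ℝ)| ≤ ‖toSpace y‖ := by
  have h1 : ‖(toSpace y) i‖ ≤ ‖toSpace y‖ := PiLp.norm_apply_le _ i
  simpa using h1

theorem norm_toSpace_pow_mono {y : Lattice d} {a b : ℝ} (ha : 0 < a) (hab : a ≤ b) :
    ‖toSpace y‖ ^ a ≤ ‖toSpace y‖ ^ b := by
  rcases eq_or_ne y 0 with rfl | hy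
  · simp [ha.ne', (ha.trans_le hab).ne']
  · exact Real.rpow_le_rpow_of_exponent_le (one_le_norm_toSpace hy) hab

@[simp] theorem tilt_zero (f : Lattice d → ℝ) : tilt f 0 = f := by
  ext x; simp [tilt]

theorem inner_toSpace (k : Space d) (y : Lattice d) :
    inner ℝ k (toSpace y) = ∑ i, k i * (y i : ℝ) := by
  simp [PiLp.inner_apply, mul_comm]

/-- All polynomial moments are finite. -/
def HasMoments (f : Lattice d → ℝ) : Prop := ∀ n : ℕ, Summable fun y => ‖toSpace y‖ ^ n * |f y|

theorem norm_toSpace_le_sum (y : Lattice d) : ‖toSpace y‖ ≤ ∑ i, |(y i : ℝ)| := by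
  have : toSpace y = ∑ i, EuclideanSpace.single i (y i : ℝ) := by
    ext j
    simp [Finset.sum_apply, Pi.single_apply]
  rw [this]
  refine (norm_sum_le _ _).trans (le_of_eq ?_)
  simp

/-- Tilts by ±η along the axes control e^{η|y_i|}, and the largest coordinate controls the norm. The
resulting bounds depend on η, hence on z; they serve to justify derivatives and sums, never to
supply constants. -/
theorem hasMoments_of_tilt {f : Lattice d → ℝ} {η : ℝ} (hη : 0 < η)
    (h0 : Summable fun y => |f y|)
    (hf : ∀ μ : Space d, ‖μ‖ ≤ η → Summable fun y => |tilt f μ y|) : HasMoments f := by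
  intro n
  have hb : ∀ i : Fin d, Summable fun y : Lattice d => |f y| * Real.exp (η * |(y i : ℝ)|) := by
    intro i
    have e1 := hf (EuclideanSpace.single i η) (by simp [abs_of_pos hη])
    have e2 := hf (EuclideanSpace.single i (-η)) (by simp [abs_of_pos hη])
    refine Summable.of_nonneg_of_le (fun y => by positivity) (fun y => ?_) (e1.add e2)
    simp only [tilt, abs_mul, Real.abs_exp, EuclideanSpace.inner_single_left]
    simp only [toSpace_apply, conj_trivial]
    rw [← mul_add]
    gcongr
    rcases abs_cases (y i : ℝ) with ⟨h, _⟩ | ⟨h, _⟩ <;> rw [h]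
    · linarith [Real.exp_pos (-η * (y i : ℝ))]
    · have : η * -(y i : ℝ) = -η * y i := by ring
      rw [this]; linarith [Real.exp_pos (η * (y i : ℝ))]
  have hsum : Summable fun y : Lattice d =>
      (d : ℝ) ^ n * ((n.factorial : ℝ) / η ^ n) *
        (|f y| + ∑ i, |f y| * Real.exp (η * |(y i : ℝ)|)) :=
    ((h0.add (summable_sum fun i _ => hb i))).mul_left _
  refine Summable.of_nonneg_of_le (fun y => by positivity) (fun y => ?_) hsum
  rcases Nat.eq_zero_or_pos d with rfl | hd
  · have hy : toSpace y = 0 := Subsingleton.elim _ _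
    rcases n with _ | n <;> simp [hy]
  have : Nonempty (Fin d) := ⟨⟨0, hd⟩⟩
  obtain ⟨i, hi⟩ := Finite.exists_max (fun i => |(y i : ℝ)|)
  have h1 : ‖toSpace y‖ ≤ d * |(y i : ℝ)| := by
    refine (norm_toSpace_le_sum y).trans ((Finset.sum_le_sum fun j _ => hi j).trans ?_)
    simp
  have h2 : (η * |(y i : ℝ)|) ^ n / n.factorial ≤ Real.exp (η * |(y i : ℝ)|) :=
    Real.pow_div_factorial_le_exp _ (by positivity) n
  have h3 : |(y i : ℝ)| ^ n ≤ (n.factorial : ℝ) / η ^ n * Real.exp (η * |(y i : ℝ)|) := by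
    rw [mul_pow, div_le_iff₀ (by positivity)] at h2
    rw [div_mul_eq_mul_div, le_div_iff₀ (by positivity)]
    linarith
  have h4 : |f y| * Real.exp (η * |(y i : ℝ)|) ≤ ∑ i, |f y| * Real.exp (η * |(y i : ℝ)|) :=
    Finset.single_le_sum (f := fun i => |f y| * Real.exp (η * |(y i : ℝ)|))
      (fun _ _ => by positivity) (Finset.mem_univ i)
  calc ‖toSpace y‖ ^ n * |f y| ≤ (d * |(y i : ℝ)|) ^ n * |f y| := by gcongr
    _ = (d : ℝ) ^ n * |(y i : ℝ)| ^ n * |f y| := by rw [mul_pow]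
    _ ≤ (d : ℝ) ^ n * ((n.factorial : ℝ) / η ^ n * Real.exp (η * |(y i : ℝ)|)) * |f y| := by
        gcongr
    _ = (d : ℝ) ^ n * ((n.factorial : ℝ) / η ^ n) * (|f y| * Real.exp (η * |(y i : ℝ)|)) := by
        ring
    _ ≤ _ := by gcongr; linarith [abs_nonneg (f y)]

variable [NeZero d]

theorem AssumptionOmega.exists_ball {S : Lattice d → ℝ} (hΩ : AssumptionOmega S) :
    ∃ η > 0, ∀ μ : Space d, ‖μ‖ ≤ η → μ ∈ Omega S := by
  obtain ⟨ε, hε, hb⟩ := Metric.isOpen_iff.1 hΩ.isOpen 0 hΩ.zero_mem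
  refine ⟨ε / 2, by positivity, fun μ hμ => hb ?_⟩
  simp only [Metric.mem_ball, dist_zero_right]; linarith

theorem AssumptionOmega.hasMoments {S : Lattice d → ℝ} (hΩ : AssumptionOmega S) :
    HasMoments S := by
  obtain ⟨η, hη, hb⟩ := hΩ.exists_ball
  have : ∀ μ ∈ Omega S, Summable fun y => |tilt S μ y| := fun μ hμ => hμ.abs
  exact hasMoments_of_tilt hη (by simpa using this 0 hΩ.zero_mem) fun μ hμ => this μ (hb μ hμ)

theorem AssumptionJ.hasMoments_J {M K ζ : ℝ} (hM : 0 ≤ M) {S h J : Lattice d → ℝ}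
    (hΩ : AssumptionOmega S) (hJ : AssumptionJ M K ζ S h J) : HasMoments J := by
  obtain ⟨η, hη, hb⟩ := hΩ.exists_ball
  exact hasMoments_of_tilt hη hJ.summable_J.abs fun μ hμ =>
    (lattice_one_bound hM (hJ.mem_class μ (subset_closure (hb μ hμ))).Q_norm).1

theorem AssumptionJ.hasMoments_h {M K ζ : ℝ} (hM : 0 ≤ M) {S h J : Lattice d → ℝ}
    (hΩ : AssumptionOmega S) (hJ : AssumptionJ M K ζ S h J) : HasMoments h := by
  obtain ⟨η, hη, hb⟩ := hΩ.exists_ball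
  exact hasMoments_of_tilt hη hJ.summable_h.abs fun μ hμ =>
    (lattice_one_bound hM (hJ.mem_class μ (subset_closure (hb μ hμ))).g_norm).1

theorem AssumptionJ.mem_class_zero {M K ζ : ℝ} {S h J : Lattice d → ℝ}
    (hΩ : AssumptionOmega S) (hJ : AssumptionJ M K ζ S h J) : ClassQ M K ζ J h := by
  simpa using hJ.mem_class 0 (subset_closure hΩ.zero_mem)

end Moments

/-! ### Fourier transform, convolution and lattice symmetries -/

section FourierAlgebra

variable {d : ℕ}

/-- The character `x ↦ exp(-i k · x)`. -/
noncomputable def chr (k : Space d) (x : Lattice d) : ℂ :=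
  Complex.exp (-(Complex.I * ((inner ℝ k (toSpace x) : ℝ) : ℂ)))

theorem latticeFourier_eq (f : Lattice d → ℝ) (k : Space d) :
    latticeFourier f k = ∑' x, (f x : ℂ) * chr k x := rfl

theorem toSpace_add (x y : Lattice d) : toSpace (x + y) = toSpace x + toSpace y := by
  ext i; simp

theorem toSpace_neg (x : Lattice d) : toSpace (-x) = -toSpace x := by
  ext i; simp

theorem toSpace_sub (x y : Lattice d) : toSpace (x - y) = toSpace x - toSpace y := by
  ext i; simp

theorem chr_add (k : Space d) (x y : Lattice d) : chr k (x + y) = chr k x * chr k y := by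
  rw [chr, chr, chr, ← Complex.exp_add, toSpace_add, inner_add_right]
  congr 1; push_cast; ring

@[simp] theorem norm_chr (k : Space d) (x : Lattice d) : ‖chr k x‖ = 1 := by
  rw [chr, Complex.norm_exp]; simp

@[simp] theorem chr_zero_left (x : Lattice d) : chr 0 x = 1 := by simp [chr]

theorem summable_mul_chr {f : Lattice d → ℝ} (hf : Summable f) (k : Space d) :
    Summable fun x => (f x : ℂ) * chr k x := by
  refine Summable.of_norm ?_
  simpa using hf.abs

theorem norm_latticeFourier_le {f : Lattice d → ℝ} (hf : Summable f) (k : Space d) :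
    ‖latticeFourier f k‖ ≤ ∑' x, |f x| := by
  rw [latticeFourier_eq]
  refine (norm_tsum_le_tsum_norm ?_).trans (le_of_eq ?_)
  · simpa using hf.abs
  · simp

theorem latticeFourier_zero (f : Lattice d → ℝ) :
    latticeFourier f 0 = ((∑' x, f x : ℝ) : ℂ) := by
  rw [latticeFourier_eq, Complex.ofReal_tsum]; simp

/-- The change of variables `(x, y) ↦ (x - y, y)`. -/
def shearEquiv (d : ℕ) : Lattice d × Lattice d ≃ Lattice d × Lattice d where
  toFun p := (p.1 - p.2, p.2)
  invFun p := (p.1 + p.2, p.2)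
  left_inv p := by simp
  right_inv p := by simp

theorem summable_conv_prod {f g : Lattice d → ℝ} (hf : Summable f) (hg : Summable g) :
    Summable fun p : Lattice d × Lattice d => f (p.1 - p.2) * g p.2 := by
  have h := summable_mul_of_summable_norm hf.norm hg.norm
  exact (shearEquiv d).summable_iff.2 h

theorem summable_conv {f g : Lattice d → ℝ} (hf : Summable f) (hg : Summable g) :
    Summable (conv f g) := (summable_conv_prod hf hg).prod

theorem latticeFourier_conv {f g : Lattice d → ℝ} (hf : Summable f) (hg : Summable g)
    (k : Space d) :
    latticeFourier (conv f g) k = latticeFourier f k * latticeFourier g k := by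
  have hF : Summable fun x => ‖(f x : ℂ) * chr k x‖ := (summable_mul_chr hf k).norm
  have hG : Summable fun x => ‖(g x : ℂ) * chr k x‖ := (summable_mul_chr hg k).norm
  have hs := summable_mul_of_summable_norm hF hG
  have hs' : Summable ((fun p : Lattice d × Lattice d =>
      ((f p.1 : ℂ) * chr k p.1) * ((g p.2 : ℂ) * chr k p.2)) ∘ shearEquiv d) :=
    (shearEquiv d).summable_iff.2 hs
  rw [latticeFourier_eq f, latticeFourier_eq g, tsum_mul_tsum_of_summable_norm hF hG,
    ← (shearEquiv d).tsum_eq, latticeFourier_eq]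
  change _ = ∑' p, ((fun p : Lattice d × Lattice d =>
      ((f p.1 : ℂ) * chr k p.1) * ((g p.2 : ℂ) * chr k p.2)) ∘ shearEquiv d) p
  rw [hs'.tsum_prod]
  refine tsum_congr fun x => ?_
  rw [conv, Complex.ofReal_tsum, ← tsum_mul_right]
  refine tsum_congr fun y => ?_
  simp only [shearEquiv, Equiv.coe_fn_mk, Function.comp]
  have : chr k x = chr k (x - y) * chr k y := by rw [← chr_add]; simp
  rw [this]; push_cast; ring

theorem tilt_conv (f g : Lattice d → ℝ) (μ : Space d) :
    tilt (conv f g) μ = conv (tilt f μ) (tilt g μ) := by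
  ext x
  rw [tilt, conv, conv, ← tsum_mul_right]
  refine tsum_congr fun y => ?_
  have : Real.exp (inner ℝ μ (toSpace x)) =
      Real.exp (inner ℝ μ (toSpace (x - y))) * Real.exp (inner ℝ μ (toSpace y)) := by
    rw [← Real.exp_add, ← inner_add_right, toSpace_sub]; simp
  simp only [tilt]; rw [this]; ring

theorem tilt_add (f g : Lattice d → ℝ) (μ : Space d) : tilt (f + g) μ = tilt f μ + tilt g μ := by
  ext x; simp [tilt, add_mul]

theorem latticeFourier_add {f g : Lattice d → ℝ} (hf : Summable f) (hg : Summable g)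
    (k : Space d) : latticeFourier (f + g) k = latticeFourier f k + latticeFourier g k := by
  rw [latticeFourier_eq, latticeFourier_eq, latticeFourier_eq,
    ← (summable_mul_chr hf k).tsum_add (summable_mul_chr hg k)]
  refine tsum_congr fun x => ?_
  simp [add_mul]

theorem IsSymmetric.flip {f : Lattice d → ℝ} (hf : IsSymmetric f) (s : Finset (Fin d))
    (x : Lattice d) : f (fun i => if i ∈ s then -x i else x i) = f x := by
  induction s using Finset.induction_on with
  | empty => simp
  | insert i s hi ih =>
    rw [← ih, ← hf.2 i (fun i => if i ∈ s then -x i else x i)]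
    congr 1
    ext j
    by_cases hj : j = i
    · subst hj; simp [hi]
    · simp [hj]

theorem IsSymmetric.neg {f : Lattice d → ℝ} (hf : IsSymmetric f) (x : Lattice d) :
    f (-x) = f x := by
  rw [← hf.flip Finset.univ x]; congr 1; ext i; simp

theorem tsum_comp_neg (f : Lattice d → ℝ) : ∑' y, f (-y) = ∑' y, f y :=
  (Equiv.neg (Lattice d)).tsum_eq f

/-- The reflection of one coordinate. -/
def reflEquiv (i : Fin d) : Lattice d ≃ Lattice d where
  toFun x := Function.update x i (-x i)
  invFun x := Function.update x i (-x i)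
  left_inv x := by simp
  right_inv x := by simp

/-- The exchange of two coordinates. -/
def swapEquiv (i j : Fin d) : Lattice d ≃ Lattice d where
  toFun x := fun l => x (Equiv.swap i j l)
  invFun x := fun l => x (Equiv.swap i j l)
  left_inv x := by ext l; simp
  right_inv x := by ext l; simp

theorem HasMoments.summable {f : Lattice d → ℝ} (hf : HasMoments f) : Summable f := by
  have := hf 0
  simp only [pow_zero, one_mul] at this
  exact this.of_abs

theorem HasMoments.summable_of_le {f : Lattice d → ℝ} (hf : HasMoments f) {g : Lattice d → ℝ}
    (n : ℕ) (hg : ∀ y, |g y| ≤ ‖toSpace y‖ ^ n) : Summable fun y => f y * g y := by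
  refine Summable.of_norm_bounded (hf n) fun y => ?_
  rw [Real.norm_eq_abs, abs_mul, mul_comm]
  exact mul_le_mul_of_nonneg_right (hg y) (abs_nonneg _)

theorem summable_mul_coord {f : Lattice d → ℝ} (hf : HasMoments f) (i j : Fin d) :
    Summable fun y => f y * ((y i : ℝ) * (y j : ℝ)) := by
  refine hf.summable_of_le 2 fun y => ?_
  rw [abs_mul, sq]
  exact mul_le_mul (abs_coord_le y i) (abs_coord_le y j) (abs_nonneg _) (norm_nonneg _)

theorem tsum_mul_coord_of_ne {f : Lattice d → ℝ} (hs : IsSymmetric f) {i j : Fin d}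
    (hij : i ≠ j) : ∑' y, f y * ((y i : ℝ) * (y j : ℝ)) = 0 := by
  have h := (reflEquiv i).tsum_eq fun y => f y * ((y i : ℝ) * (y j : ℝ))
  have : ∀ y, f (reflEquiv i y) * ((reflEquiv i y i : ℝ) * (reflEquiv i y j : ℝ)) =
      -(f y * ((y i : ℝ) * (y j : ℝ))) := fun y => by
    simp only [reflEquiv, Equiv.coe_fn_mk]
    rw [hs.2 i y, Function.update_self, Function.update_of_ne hij.symm]
    push_cast; ring
  simp_rw [this, tsum_neg] at h
  linarith

theorem tsum_mul_coord_self {f : Lattice d → ℝ} (hs : IsSymmetric f) (i j : Fin d) :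
    ∑' y, f y * ((y i : ℝ) * (y i : ℝ)) = ∑' y, f y * ((y j : ℝ) * (y j : ℝ)) := by
  rw [← (swapEquiv i j).tsum_eq fun y => f y * ((y i : ℝ) * (y i : ℝ))]
  refine tsum_congr fun y => ?_
  simp only [swapEquiv, Equiv.coe_fn_mk]
  rw [hs.1 (Equiv.swap i j) y]
  simp

theorem norm_sq_toSpace (y : Lattice d) : ‖toSpace y‖ ^ 2 = ∑ i, (y i : ℝ) * (y i : ℝ) := by
  rw [EuclideanSpace.norm_sq_eq]; simp [sq]

theorem norm_sq_space (μ : Space d) : ‖μ‖ ^ 2 = ∑ i, μ i * μ i := by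
  rw [EuclideanSpace.norm_sq_eq]; simp [sq]

theorem sigmaSq_eq {f : Lattice d → ℝ} (hf : HasMoments f) (hs : IsSymmetric f) (i : Fin d) :
    sigmaSq f = d * ∑' y, f y * ((y i : ℝ) * (y i : ℝ)) := by
  have : ∀ y, ‖toSpace y‖ ^ 2 * f y = ∑ j, f y * ((y j : ℝ) * (y j : ℝ)) := fun y => by
    rw [norm_sq_toSpace, mul_comm, Finset.mul_sum]
  rw [sigmaSq]
  simp_rw [this]
  rw [Summable.tsum_finsetSum fun j _ => summable_mul_coord hf j j]
  rw [Finset.sum_congr rfl fun j _ => tsum_mul_coord_self hs j i]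
  simp

/-- Reflections kill the mixed second moments and coordinate swaps equate the diagonal ones, so the
second-moment matrix is a multiple of the identity. -/
theorem tsum_mul_inner_sq {f : Lattice d → ℝ} (hf : HasMoments f) (hs : IsSymmetric f)
    (hd : 0 < d) (μ : Space d) :
    ∑' y, f y * (inner ℝ μ (toSpace y)) ^ 2 = ‖μ‖ ^ 2 * sigmaSq f / d := by
  have e : ∀ y, f y * (inner ℝ μ (toSpace y)) ^ 2 =
      ∑ i, ∑ j, (μ i * μ j) * (f y * ((y i : ℝ) * (y j : ℝ))) := fun y => by
    rw [inner_toSpace, sq, Finset.sum_mul_sum, Finset.mul_sum]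
    refine Finset.sum_congr rfl fun i _ => ?_
    rw [Finset.mul_sum]
    exact Finset.sum_congr rfl fun j _ => by ring
  simp_rw [e]
  rw [Summable.tsum_finsetSum fun i _ => summable_sum fun j _ =>
    (summable_mul_coord hf i j).mul_left _]
  have hdR : (d : ℝ) ≠ 0 := by positivity
  have : ∀ i : Fin d, ∑' y, ∑ j, (μ i * μ j) * (f y * ((y i : ℝ) * (y j : ℝ))) =
      (μ i * μ i) * (sigmaSq f / d) := fun i => by
    rw [Summable.tsum_finsetSum fun j _ => (summable_mul_coord hf i j).mul_left _]
    rw [Finset.sum_eq_single i]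
    · rw [tsum_mul_left, sigmaSq_eq hf hs i]; field_simp
    · intro j _ hj
      rw [tsum_mul_left, tsum_mul_coord_of_ne hs hj.symm, mul_zero]
    · simp
  rw [Finset.sum_congr rfl fun i _ => this i, ← Finset.sum_mul, norm_sq_space]
  ring

end FourierAlgebra

/-! ### Second-order Taylor bounds with a fractional remainder -/

section Taylor

/-- For |θ| ≤ 1 the remainder is quartic; for |θ| ≥ 1 every term on the left is at most |θ|^{2+a}
cosh θ. The factor cosh θ is kept because the tilted moment of order 2 + ζ can absorb it. -/
theorem abs_cosh_taylor {a : ℝ} (ha : 0 ≤ a) (ha1 : a ≤ 1) (θ : ℝ) :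
    |Real.cosh θ - 1 - θ ^ 2 / 2| ≤ 3 * |θ| ^ (2 + a) * Real.cosh θ := by
  have hc := Real.one_le_cosh θ
  rcases le_total |θ| 1 with h | h
  · have h1 := Real.exp_bound h (n := 4) (by norm_num)
    have h2 := Real.exp_bound (x := -θ) (by simpa using h) (n := 4) (by norm_num)
    simp only [Finset.sum_range_succ, Finset.sum_range_zero, abs_neg, Nat.factorial] at h1 h2
    norm_num at h1 h2
    have h3 : |θ| ^ 4 ≤ |θ| ^ (2 + a) := by
      rcases (abs_nonneg θ).eq_or_lt with h0 | h0
      · rw [← h0, Real.zero_rpow (by linarith)]; norm_num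
      · rw [← Real.rpow_natCast]
        exact Real.rpow_le_rpow_of_exponent_ge h0 h (by norm_num; linarith)
    have h4 : |Real.cosh θ - 1 - θ ^ 2 / 2| ≤ |θ| ^ 4 := by
      rw [Real.cosh_eq]
      rw [abs_le] at *
      have : 0 ≤ |θ| ^ 4 := by positivity
      constructor <;> nlinarith
    have h5 : 0 ≤ |θ| ^ (2 + a) := by positivity
    nlinarith
  · have h2 : θ ^ 2 ≤ |θ| ^ (2 + a) := by
      rw [← sq_abs, ← Real.rpow_natCast]
      exact Real.rpow_le_rpow_of_exponent_le h (by norm_num; linarith)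
    have h3 : 1 ≤ θ ^ 2 := by rw [← sq_abs]; exact one_le_pow₀ h
    have h1 : 1 ≤ |θ| ^ (2 + a) := h3.trans h2
    rw [abs_le]
    constructor <;> nlinarith

theorem abs_cos_taylor {a : ℝ} (ha : 0 ≤ a) (ha1 : a ≤ 1) (θ : ℝ) :
    |1 - Real.cos θ - θ ^ 2 / 2| ≤ 3 * |θ| ^ (2 + a) := by
  rcases le_total |θ| 1 with h | h
  · have h1 := Real.cos_bound h
    have h3 : |θ| ^ 4 ≤ |θ| ^ (2 + a) := by
      rcases (abs_nonneg θ).eq_or_lt with h0 | h0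
      · rw [← h0, Real.zero_rpow (by linarith)]; norm_num
      · rw [← Real.rpow_natCast]
        exact Real.rpow_le_rpow_of_exponent_ge h0 h (by norm_num; linarith)
    have : 0 ≤ |θ| ^ 4 := by positivity
    rw [abs_le] at *
    constructor <;> nlinarith
  · have h2 : θ ^ 2 ≤ |θ| ^ (2 + a) := by
      rw [← sq_abs, ← Real.rpow_natCast]
      exact Real.rpow_le_rpow_of_exponent_le h (by norm_num; linarith)
    have h3 : 1 ≤ θ ^ 2 := by rw [← sq_abs]; exact one_le_pow₀ h
    have := Real.cos_le_one θ
    have := Real.neg_one_le_cos θ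
    rw [abs_le]
    constructor <;> nlinarith

end Taylor

/-! ### Expansion of Ĵ at the origin and of the tilted total mass of J -/

section Expansion

variable {d : ℕ} {J : Lattice d → ℝ} {M ζ a : ℝ}

theorem abs_inner_rpow_le (ha : 0 ≤ a) (haζ : a ≤ ζ) (μ : Space d) (y : Lattice d) :
    |inner ℝ μ (toSpace y)| ^ (2 + a) ≤ ‖μ‖ ^ (2 + a) * ‖toSpace y‖ ^ (2 + ζ) := by
  calc |inner ℝ μ (toSpace y)| ^ (2 + a) ≤ (‖μ‖ * ‖toSpace y‖) ^ (2 + a) :=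
        Real.rpow_le_rpow (abs_nonneg _) (abs_real_inner_le_norm _ _) (by linarith)
    _ = ‖μ‖ ^ (2 + a) * ‖toSpace y‖ ^ (2 + a) :=
        Real.mul_rpow (norm_nonneg _) (norm_nonneg _)
    _ ≤ _ := by
        gcongr ?_ * ?_
        exact norm_toSpace_pow_mono (by linarith) (by linarith)

theorem summable_mul_inner_sq (hf : HasMoments J) (μ : Space d) :
    Summable fun y => J y * (inner ℝ μ (toSpace y)) ^ 2 := by
  have : Summable fun y => ‖μ‖ ^ 2 * (‖toSpace y‖ ^ 2 * |J y|) := (hf 2).mul_left _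
  refine Summable.of_norm_bounded this fun y => ?_
  rw [Real.norm_eq_abs, abs_mul, abs_pow, mul_comm]
  calc |inner ℝ μ (toSpace y)| ^ 2 * |J y| ≤ (‖μ‖ * ‖toSpace y‖) ^ 2 * |J y| := by
        gcongr; exact abs_real_inner_le_norm _ _
    _ = _ := by ring

/-- The expansion of the Fourier transform at the origin. -/
theorem fourier_expansion (hf : HasMoments J) (hs : IsSymmetric J) (hd : 0 < d) (hM : 0 ≤ M)
    (ha : 0 ≤ a) (ha1 : a ≤ 1) (haζ : a ≤ ζ)
    (hQ : latticeNorm 1 (fun y => ‖toSpace y‖ ^ (2 + ζ) * J y) ≤ ENNReal.ofReal M)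
    (k : Space d) :
    |(latticeFourier J 0 - latticeFourier J k).re - ‖k‖ ^ 2 * sigmaSq J / (2 * d)| ≤
      3 * M * ‖k‖ ^ (2 + a) := by
  obtain ⟨hs1, hb1⟩ := lattice_one_bound hM hQ
  have e0 : Summable fun y => J y * (1 - Real.cos (inner ℝ k (toSpace y))) := by
    refine Summable.of_norm_bounded (hf.summable.abs.mul_left 2) fun y => ?_
    rw [Real.norm_eq_abs, abs_mul, mul_comm]
    gcongr
    rw [abs_le]
    constructor <;>
      linarith [Real.cos_le_one (inner ℝ k (toSpace y)),
        Real.neg_one_le_cos (inner ℝ k (toSpace y))]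
  have e1 : (latticeFourier J 0 - latticeFourier J k).re =
      ∑' y, J y * (1 - Real.cos (inner ℝ k (toSpace y))) := by
    rw [latticeFourier_eq, latticeFourier_eq,
      ← (summable_mul_chr hf.summable 0).tsum_sub (summable_mul_chr hf.summable k),
      Complex.re_tsum ((summable_mul_chr hf.summable 0).sub (summable_mul_chr hf.summable k))]
    refine tsum_congr fun y => ?_
    simp only [chr, Complex.sub_re, Complex.re_ofReal_mul, Complex.exp_re]
    simp; ring
  have e2 := tsum_mul_inner_sq hf hs hd k
  have e3 : ‖k‖ ^ 2 * sigmaSq J / (2 * d) = ∑' y, J y * (inner ℝ k (toSpace y)) ^ 2 / 2 := by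
    rw [tsum_div_const, e2]; field_simp
  rw [e1, e3, ← e0.tsum_sub ((summable_mul_inner_sq hf k).div_const 2), ← Real.norm_eq_abs]
  refine (tsum_of_norm_bounded (hs1.hasSum.mul_left (3 * ‖k‖ ^ (2 + a))) fun y => ?_).trans ?_
  · rw [Real.norm_eq_abs, abs_mul, abs_of_nonneg (show 0 ≤ ‖toSpace y‖ ^ (2 + ζ) by positivity)]
    have h1 := abs_cos_taylor ha ha1 (inner ℝ k (toSpace y))
    have h2 := abs_inner_rpow_le ha haζ k y
    have : J y * (1 - Real.cos (inner ℝ k (toSpace y))) - J y * inner ℝ k (toSpace y) ^ 2 / 2 =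
      J y * (1 - Real.cos (inner ℝ k (toSpace y)) - inner ℝ k (toSpace y) ^ 2 / 2) := by ring
    rw [this, abs_mul]
    calc |J y| * _ ≤ |J y| * (3 * (‖k‖ ^ (2 + a) * ‖toSpace y‖ ^ (2 + ζ))) := by
          gcongr; linarith
      _ = _ := by ring
  · have : 0 ≤ ‖k‖ ^ (2 + a) := by positivity
    nlinarith

/-- The expansion of the tilted susceptibility of `J` at small tilts. -/
theorem tilt_expansion (hf : HasMoments J) (hs : IsSymmetric J) (hd : 0 < d) (hM : 0 ≤ M)
    (ha : 0 ≤ a) (ha1 : a ≤ 1) (haζ : a ≤ ζ) (μ : Space d)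
    (hJ : latticeNorm 1 (tilt J μ) ≤ ENNReal.ofReal M)
    (hQ : latticeNorm 1 (fun y => ‖toSpace y‖ ^ (2 + ζ) * tilt J μ y) ≤ ENNReal.ofReal M) :
    |∑' y, tilt J μ y - ∑' y, J y - ‖μ‖ ^ 2 * sigmaSq J / (2 * d)| ≤
      3 * M * ‖μ‖ ^ (2 + a) := by
  obtain ⟨hs0, -⟩ := lattice_one_bound hM hJ
  obtain ⟨hs1, hb1⟩ := lattice_one_bound hM hQ
  have hneg : ∀ y, tilt J μ (-y) = J y * Real.exp (-inner ℝ μ (toSpace y)) := fun y => by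
    simp only [tilt]; rw [hs.neg, toSpace_neg, inner_neg_right]
  have hch : ∀ y, J y * Real.cosh (inner ℝ μ (toSpace y)) =
      (tilt J μ y + tilt J μ (-y)) / 2 := fun y => by
    rw [hneg, tilt, Real.cosh_eq]; ring
  have hst : Summable (tilt J μ) := hs0.of_abs
  have hstn : Summable fun y => tilt J μ (-y) := (Equiv.neg (Lattice d)).summable_iff.2 hst
  have e0 : Summable fun y => J y * Real.cosh (inner ℝ μ (toSpace y)) := by
    simp_rw [hch]; exact (hst.add hstn).div_const 2
  have e1 : ∑' y, tilt J μ y = ∑' y, J y * Real.cosh (inner ℝ μ (toSpace y)) := by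
    simp_rw [hch]
    rw [tsum_div_const, hst.tsum_add hstn, tsum_comp_neg (tilt J μ)]
    ring
  -- Averaging the tilted moment over y and -y turns e^{μ·y} into cosh(μ·y), which is the weight
  -- left by the Taylor remainder. Thus the moment bound at the single tilt μ suffices.
  obtain ⟨F, hFd⟩ : ∃ F : Lattice d → ℝ, F = fun y => |‖toSpace y‖ ^ (2 + ζ) * tilt J μ y| :=
    ⟨_, rfl⟩
  rw [← hFd] at hs1 hb1
  have hFn : Summable fun y => F (-y) := (Equiv.neg (Lattice d)).summable_iff.2 hs1
  have hF2 : Summable fun y => (F y + F (-y)) / 2 := (hs1.add hFn).div_const 2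
  have hF2s : ∑' y, (F y + F (-y)) / 2 ≤ M := by
    rw [tsum_div_const, hs1.tsum_add hFn, tsum_comp_neg F]
    linarith
  have hF : ∀ y, (F y + F (-y)) / 2 =
      ‖toSpace y‖ ^ (2 + ζ) * (|J y| * Real.cosh (inner ℝ μ (toSpace y))) := fun y => by
    simp only [hFd]
    rw [hneg, toSpace_neg, norm_neg, abs_mul, abs_mul, tilt, abs_mul, abs_mul,
      Real.abs_exp, Real.abs_exp, abs_of_nonneg (show 0 ≤ ‖toSpace y‖ ^ (2 + ζ) by positivity),
      Real.cosh_eq]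
    ring
  have e2 := tsum_mul_inner_sq hf hs hd μ
  have e3 : ‖μ‖ ^ 2 * sigmaSq J / (2 * d) = ∑' y, J y * (inner ℝ μ (toSpace y)) ^ 2 / 2 := by
    rw [tsum_div_const, e2]; field_simp
  rw [e1, e3, ← e0.tsum_sub hf.summable,
    ← (e0.sub hf.summable).tsum_sub ((summable_mul_inner_sq hf μ).div_const 2),
    ← Real.norm_eq_abs]
  refine (tsum_of_norm_bounded (hF2.hasSum.mul_left (3 * ‖μ‖ ^ (2 + a))) fun y => ?_).trans ?_
  · rw [hF, Real.norm_eq_abs]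
    have h1 := abs_cosh_taylor ha ha1 (inner ℝ μ (toSpace y))
    have h2 := abs_inner_rpow_le ha haζ μ y
    have h3 := Real.cosh_pos (inner ℝ μ (toSpace y))
    have : J y * Real.cosh (inner ℝ μ (toSpace y)) - J y - J y * inner ℝ μ (toSpace y) ^ 2 / 2 =
      J y * (Real.cosh (inner ℝ μ (toSpace y)) - 1 - inner ℝ μ (toSpace y) ^ 2 / 2) := by ring
    rw [this, abs_mul]
    calc |J y| * _ ≤ |J y| * (3 * (‖μ‖ ^ (2 + a) * ‖toSpace y‖ ^ (2 + ζ)) *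
          Real.cosh (inner ℝ μ (toSpace y))) := by
          gcongr; exact h1.trans (by gcongr)
      _ = _ := by ring
  · have : 0 ≤ ‖μ‖ ^ (2 + a) := by positivity
    nlinarith

end Expansion

/-! ### The domain Ω, its boundary, the mass and the gap -/

section Geometry

variable {d : ℕ}

theorem norm_space_le_sum (μ : Space d) : ‖μ‖ ≤ ∑ i, |μ i| := by
  have : μ = ∑ i, EuclideanSpace.single i (μ i) := by
    ext j
    simp [Finset.sum_apply, Pi.single_apply]
  conv_lhs => rw [this]
  refine (norm_sum_le _ _).trans (le_of_eq ?_)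
  simp

/-- Pointwise, e^{tμ·x} ≤ 1 + e^{μ·x} for 0 ≤ t ≤ 1. -/
theorem smul_mem_Omega {S : Lattice d → ℝ} (hS : ∀ x, 0 ≤ S x) (h0 : (0 : Space d) ∈ Omega S)
    {μ : Space d} (hμ : μ ∈ Omega S) {t : ℝ} (ht0 : 0 ≤ t) (ht1 : t ≤ 1) : t • μ ∈ Omega S := by
  have hadd : Summable fun x => tilt S 0 x + tilt S μ x := Summable.add h0 hμ
  refine Summable.of_nonneg_of_le (fun x => ?_) (fun x => ?_) hadd
  · exact mul_nonneg (hS x) (Real.exp_pos _).le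
  · simp only [tilt]
    rw [← mul_add]
    refine mul_le_mul_of_nonneg_left ?_ (hS x)
    rw [real_inner_smul_left, inner_zero_left, Real.exp_zero]
    rcases le_total 0 (inner ℝ μ (toSpace x)) with h | h
    · have : Real.exp (t * inner ℝ μ (toSpace x)) ≤ Real.exp (inner ℝ μ (toSpace x)) :=
        Real.exp_le_exp.2 (by nlinarith)
      linarith
    · have : Real.exp (t * inner ℝ μ (toSpace x)) ≤ 1 :=
        Real.exp_le_one_iff.2 (by nlinarith)
      linarith [Real.exp_pos (inner ℝ μ (toSpace x))]

/-- The tilt with the coordinates outside `s` set to zero. -/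
def keep (s : Finset (Fin d)) (μ : Space d) : Space d :=
  WithLp.toLp 2 fun i => if i ∈ s then μ i else 0

/-- With b = μ_i x_i and c the rest of the exponent, e^c ≤ e^{c+b} + e^{c-b}; reflecting coordinate
i, under which S is invariant, exchanges the two terms on the right. -/
theorem keep_erase_mem {S : Lattice d → ℝ} (hS : ∀ x, 0 ≤ S x) (hs : IsSymmetric S)
    {μ : Space d} (s : Finset (Fin d)) (i : Fin d) (hμ : keep s μ ∈ Omega S) :
    keep (s.erase i) μ ∈ Omega S := by
  by_cases hi : i ∈ s
  swap
  · rwa [Finset.erase_eq_of_notMem hi]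
  have hrefl : Summable fun x => tilt S (keep s μ) (reflEquiv i x) :=
    (reflEquiv i).summable_iff.2 hμ
  have hμ' : Summable fun x => tilt S (keep s μ) x := hμ
  refine Summable.of_nonneg_of_le (fun x => ?_) (fun x => ?_) (hμ'.add hrefl)
  · exact mul_nonneg (hS x) (Real.exp_pos _).le
  · have e1 : inner ℝ (keep s μ) (toSpace x) =
        inner ℝ (keep (s.erase i) μ) (toSpace x) + μ i * x i := by
      rw [inner_toSpace, inner_toSpace, ← Finset.add_sum_erase _ _ (Finset.mem_univ i),
        ← Finset.add_sum_erase _ (fun j => (keep (s.erase i) μ) j * (x j : ℝ))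
          (Finset.mem_univ i)]
      have : ∀ j ∈ Finset.univ.erase i, (keep s μ) j * (x j : ℝ) =
          (keep (s.erase i) μ) j * (x j : ℝ) := fun j hj => by
        simp [keep, Finset.ne_of_mem_erase hj]
      rw [Finset.sum_congr rfl this]
      simp [keep, hi]; ring
    have e2 : inner ℝ (keep s μ) (toSpace (reflEquiv i x)) =
        inner ℝ (keep (s.erase i) μ) (toSpace x) - μ i * x i := by
      rw [inner_toSpace, inner_toSpace, ← Finset.add_sum_erase _ _ (Finset.mem_univ i),
        ← Finset.add_sum_erase _ (fun j => (keep (s.erase i) μ) j * (x j : ℝ))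
          (Finset.mem_univ i)]
      have : ∀ j ∈ Finset.univ.erase i, (keep s μ) j * ((reflEquiv i x) j : ℝ) =
          (keep (s.erase i) μ) j * (x j : ℝ) := fun j hj => by
        simp [keep, reflEquiv, Finset.ne_of_mem_erase hj]
      rw [Finset.sum_congr rfl this]
      simp [keep, reflEquiv, hi]; ring
    have e3 : S (reflEquiv i x) = S x := hs.2 i x
    simp only [tilt]
    rw [e1, e2, e3, ← mul_add]
    refine mul_le_mul_of_nonneg_left ?_ (hS x)
    rcases le_total 0 (μ i * x i) with h | h
    · exact (Real.exp_le_exp.2 (by linarith)).trans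
        (le_add_of_nonneg_right (Real.exp_pos _).le)
    · exact (Real.exp_le_exp.2 (by linarith)).trans
        (le_add_of_nonneg_left (Real.exp_pos _).le)

theorem keep_singleton_mem {S : Lattice d → ℝ} (hS : ∀ x, 0 ≤ S x) (hs : IsSymmetric S)
    {μ : Space d} (i : Fin d) (hμ : μ ∈ Omega S) : keep {i} μ ∈ Omega S := by
  have key : ∀ s : Finset (Fin d), keep (Finset.univ \ s) μ ∈ Omega S := by
    intro s
    induction s using Finset.induction_on with
    | empty =>
      have : keep (Finset.univ \ ∅) μ = μ := by ext j; simp [keep]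
      rwa [this]
    | insert j s _ ih =>
      have : Finset.univ \ insert j s = (Finset.univ \ s).erase j := by
        ext l; simp
      rw [this]
      exact keep_erase_mem hS hs _ _ ih
  have h := key (Finset.univ \ {i})
  have e : Finset.univ \ (Finset.univ \ {i}) = ({i} : Finset (Fin d)) := by simp
  rwa [e] at h

variable [NeZero d]

theorem dim_pos (d : ℕ) [NeZero d] : 0 < d := Nat.pos_of_ne_zero (NeZero.ne d)

/-- Erase the other coordinates, swap coordinate i with the first one, and reflect if μ_i < 0.
Consequently Ω lies in the cube of half-side `mass S`, which is how it is known to be bounded in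
every direction. -/
theorem abs_coord_smul_mem {S : Lattice d → ℝ} (hS : ∀ x, 0 ≤ S x) (hs : IsSymmetric S)
    {μ : Space d} (i : Fin d) (hμ : μ ∈ Omega S) : |μ i| • e₁ d ∈ Omega S := by
  have h1 : Summable (tilt S (keep {i} μ)) := keep_singleton_mem hS hs i hμ
  have inn : ∀ x : Lattice d, inner ℝ (keep {i} μ) (toSpace x) = μ i * x i := fun x => by
    rw [inner_toSpace, Finset.sum_eq_single i]
    · simp [keep]
    · intro j _ hj; simp [keep, hj]
    · simp
  have inn2 : ∀ (t : ℝ) (x : Lattice d), inner ℝ (t • e₁ d) (toSpace x) = t * x 0 := fun t x => by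
    rw [real_inner_smul_left, e₁, EuclideanSpace.inner_single_left]; simp
  have h2 : (μ i) • e₁ d ∈ Omega S := by
    have h3 : Summable ((tilt S (keep {i} μ)) ∘ swapEquiv i 0) :=
      (swapEquiv i (0 : Fin d)).summable_iff.2 h1
    refine h3.congr fun x => ?_
    simp only [Function.comp, tilt]
    rw [inn, inn2]
    simp only [swapEquiv, Equiv.coe_fn_mk]
    rw [hs.1 (Equiv.swap i 0) x, Equiv.swap_apply_left]
  rcases abs_cases (μ i) with ⟨h, _⟩ | ⟨h, _⟩ <;> rw [h]
  · exact h2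
  · have h3 : Summable ((tilt S (μ i • e₁ d)) ∘ Equiv.neg (Lattice d)) :=
      (Equiv.neg (Lattice d)).summable_iff.2 h2
    refine h3.congr fun x => ?_
    simp only [Function.comp, tilt, Equiv.neg_apply]
    rw [hs.neg, inn2, inn2]
    simp

namespace AssumptionOmega

variable {S : Lattice d → ℝ}

theorem massSet_bddAbove (hΩ : AssumptionOmega S) :
    BddAbove {t : ℝ | 0 ≤ t ∧ t • e₁ d ∈ Omega S} := by
  obtain ⟨t₀, ht₀, hn⟩ := hΩ.exists_notMem
  refine ⟨t₀, fun t ht => ?_⟩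
  by_contra! hlt
  refine hn ?_
  have := smul_mem_Omega hΩ.nonneg hΩ.zero_mem ht.2 (t := t₀ / t) (by have := ht.1; positivity)
    (by rw [div_le_one (by linarith)]; exact hlt.le)
  rwa [smul_smul, div_mul_cancel₀ _ (by linarith)] at this

theorem abs_coord_le_mass (hΩ : AssumptionOmega S) {μ : Space d} (hμ : μ ∈ Omega S) (i : Fin d) :
    |μ i| ≤ mass S :=
  le_csSup hΩ.massSet_bddAbove ⟨abs_nonneg _, abs_coord_smul_mem hΩ.nonneg hΩ.symmetric i hμ⟩

theorem norm_le_mass (hΩ : AssumptionOmega S) {μ : Space d} (hμ : μ ∈ Omega S) :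
    ‖μ‖ ≤ d * mass S := by
  refine (norm_space_le_sum μ).trans
    ((Finset.sum_le_sum fun i _ => hΩ.abs_coord_le_mass hμ i).trans ?_)
  simp

theorem norm_le_mass_closure (hΩ : AssumptionOmega S) {μ : Space d} (hμ : μ ∈ closure (Omega S)) :
    ‖μ‖ ≤ d * mass S :=
  closure_minimal (fun _ h => hΩ.norm_le_mass h) (isClosed_le continuous_norm continuous_const) hμ

/-- A point at which a ray from the origin leaves `Ω`. -/
def IsEdge (S : Lattice d → ℝ) (μ : Space d) : Prop :=
  μ ∉ Omega S ∧ ∀ t : ℝ, 0 ≤ t → t < 1 → t • μ ∈ Omega S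

theorem IsEdge.mem_closure {μ : Space d} (h : IsEdge S μ) : μ ∈ closure (Omega S) := by
  have ht : Tendsto (fun t : ℝ => t • μ) (𝓝[<] 1) (𝓝 μ) := by
    have : Tendsto (fun t : ℝ => t • μ) (𝓝 1) (𝓝 ((1 : ℝ) • μ)) :=
      (continuous_id.smul continuous_const).tendsto 1
    rw [one_smul] at this
    exact this.mono_left nhdsWithin_le_nhds
  refine mem_closure_of_tendsto ht ?_
  filter_upwards [Ioo_mem_nhdsLT (show (0 : ℝ) < 1 by norm_num)] with t ht
  exact h.2 t ht.1.le ht.2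

/-- The exit parameter is a supremum: it is finite because Ω is bounded, and openness of Ω keeps the
endpoint itself outside Ω. -/
theorem exists_edge (hΩ : AssumptionOmega S) {v : Space d} (hv : v ≠ 0) :
    ∃ t : ℝ, 0 < t ∧ IsEdge S (t • v) ∧ ∀ u : ℝ, 0 ≤ u → u • v ∈ Omega S → u ≤ t := by
  set A : Set ℝ := {u | 0 ≤ u ∧ u • v ∈ Omega S}
  have hv' : 0 < ‖v‖ := norm_pos_iff.2 hv
  have hbdd : BddAbove A := by
    refine ⟨d * mass S / ‖v‖, fun u hu => ?_⟩
    have := hΩ.norm_le_mass hu.2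
    rw [norm_smul, Real.norm_of_nonneg hu.1] at this
    rwa [le_div_iff₀ hv']
  obtain ⟨η, hη, hb⟩ := hΩ.exists_ball
  have hmem : η / ‖v‖ ∈ A := ⟨by positivity, hb _ (by
    rw [norm_smul, Real.norm_of_nonneg (by positivity)]; field_simp; rfl)⟩
  have hpos : 0 < sSup A := lt_of_lt_of_le (by positivity) (le_csSup hbdd hmem)
  refine ⟨sSup A, hpos, ⟨fun hmem' => ?_, fun t ht0 ht1 => ?_⟩, fun u hu0 hu =>
    le_csSup hbdd ⟨hu0, hu⟩⟩
  · have ho : IsOpen {u : ℝ | u • v ∈ Omega S} :=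
      hΩ.isOpen.preimage (continuous_id.smul continuous_const)
    obtain ⟨ε, hε, hball⟩ := Metric.isOpen_iff.1 ho _ hmem'
    have : sSup A + ε / 2 ∈ A := ⟨by positivity, hball (by
      simp [abs_of_pos hε]; linarith)⟩
    linarith [le_csSup hbdd this]
  · rcases ht0.eq_or_lt with rfl | ht0
    · simpa using hΩ.zero_mem
    obtain ⟨u, hu, hlt⟩ := exists_lt_of_lt_csSup ⟨_, hmem⟩
      (show t * sSup A < sSup A by nlinarith)
    have hup : 0 < u := lt_trans (by positivity) hlt
    have := smul_mem_Omega hΩ.nonneg hΩ.zero_mem hu.2 (t := t * sSup A / u) (by positivity)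
      (by rw [div_le_one hup]; exact hlt.le)
    rwa [smul_smul, div_mul_cancel₀ _ hup.ne', ← smul_smul] at this

theorem mass_edge (hΩ : AssumptionOmega S) : 0 < mass S ∧ IsEdge S (mass S • e₁ d) := by
  have hne : e₁ d ≠ 0 := by
    intro h
    have := congrArg norm h
    simp [e₁] at this
  obtain ⟨t, ht, hedge, hmax⟩ := hΩ.exists_edge hne
  have : mass S = t := by
    refine le_antisymm (csSup_le ⟨0, le_rfl, by simpa using hΩ.zero_mem⟩ fun u hu =>
      hmax u hu.1 hu.2) ?_
    refine le_of_forall_lt fun u hu => ?_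
    rcases le_or_gt 0 u with h0 | h0
    · have h1 : ((u + t) / 2) ∈ {t : ℝ | 0 ≤ t ∧ t • e₁ d ∈ Omega S} := by
        refine ⟨by linarith, ?_⟩
        have := hedge.2 ((u + t) / 2 / t) (by positivity)
          (by rw [div_lt_one ht]; linarith)
        rwa [smul_smul, div_mul_cancel₀ _ ht.ne'] at this
      exact lt_of_lt_of_le (by linarith) (le_csSup hΩ.massSet_bddAbove h1)
    · exact lt_of_lt_of_le h0
        (le_csSup hΩ.massSet_bddAbove ⟨le_rfl, by simpa using hΩ.zero_mem⟩)
  rw [this]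
  exact ⟨ht, hedge⟩

theorem norm_e₁ : ‖e₁ d‖ = 1 := by simp [e₁]

end AssumptionOmega

namespace AssumptionJ

open AssumptionOmega

variable {S h J : Lattice d → ℝ} {M K ζ : ℝ}

theorem summable_tilt_J (hM : 0 ≤ M) (hJ : AssumptionJ M K ζ S h J) {μ : Space d}
    (hμ : μ ∈ closure (Omega S)) : Summable (tilt J μ) :=
  (lattice_one_bound hM (hJ.mem_class μ hμ).Q_norm).1.of_abs

theorem summable_tilt_h (hM : 0 ≤ M) (hJ : AssumptionJ M K ζ S h J) {μ : Space d}
    (hμ : μ ∈ closure (Omega S)) : Summable (tilt h μ) :=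
  (lattice_one_bound hM (hJ.mem_class μ hμ).g_norm).1.of_abs

theorem fourier_equation_tilt (hM : 0 ≤ M) (hJ : AssumptionJ M K ζ S h J) {μ : Space d}
    (hμ : μ ∈ Omega S) (k : Space d) :
    latticeFourier (tilt S μ) k = latticeFourier (tilt h μ) k +
      latticeFourier (tilt J μ) k * latticeFourier (tilt S μ) k := by
  have hS : Summable (tilt S μ) := hμ
  have hJ' := hJ.summable_tilt_J hM (subset_closure hμ)
  have hh := hJ.summable_tilt_h hM (subset_closure hμ)
  have e : tilt S μ = tilt h μ + conv (tilt J μ) (tilt S μ) := by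
    rw [← tilt_conv, ← tilt_add]
    congr 1
    ext x; exact hJ.equation x
  rw [← latticeFourier_conv hJ' hS, ← latticeFourier_add hh (summable_conv hJ' hS), ← e]

theorem tsum_equation_tilt (hM : 0 ≤ M) (hJ : AssumptionJ M K ζ S h J) {μ : Space d}
    (hμ : μ ∈ Omega S) :
    (1 - ∑' x, tilt J μ x) * ∑' x, tilt S μ x = ∑' x, tilt h μ x := by
  have := hJ.fourier_equation_tilt hM hμ 0
  simp only [latticeFourier_zero] at this
  have h2 : ∑' x, tilt S μ x = ∑' x, tilt h μ x + (∑' x, tilt J μ x) * ∑' x, tilt S μ x := by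
    exact_mod_cast this
  linarith

/-- In (1 - ∑J^{(μ)}) ∑S^{(μ)} = ∑h^{(μ)} the right side is positive and the second factor on the
left is nonnegative. -/
theorem tsum_tilt_J_lt_one (hM : 0 ≤ M) (hΩ : AssumptionOmega S) (hJ : AssumptionJ M K ζ S h J)
    {μ : Space d} (hμ : μ ∈ Omega S) : ∑' x, tilt J μ x < 1 := by
  have h1 := hJ.tsum_equation_tilt hM hμ
  have h2 := hJ.fourier_pos μ (subset_closure hμ)
  rw [latticeFourier_zero, Complex.ofReal_re, ← h1] at h2
  have h3 : 0 ≤ ∑' x, tilt S μ x :=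
    tsum_nonneg fun x => mul_nonneg (hΩ.nonneg x) (Real.exp_pos _).le
  by_contra! hle
  nlinarith

theorem tendsto_tsum_tilt_ray {f : Lattice d → ℝ} {μ : Space d} (hf0 : Summable f)
    (hf : Summable (tilt f μ)) :
    Tendsto (fun t : ℝ => ∑' x, tilt f (t • μ) x) (𝓝[<] 1) (𝓝 (∑' x, tilt f μ x)) := by
  refine tendsto_tsum_of_dominated_convergence (bound := fun x => |f x| + |tilt f μ x|)
    (hf0.abs.add hf.abs) (fun x => ?_) ?_
  · have : Continuous fun t : ℝ => tilt f (t • μ) x := by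
      unfold tilt; fun_prop
    have h := (this.tendsto 1).mono_left (nhdsWithin_le_nhds (s := Set.Iio 1))
    rwa [one_smul] at h
  · filter_upwards [Ioo_mem_nhdsLT (show (0 : ℝ) < 1 by norm_num)] with t ht x
    simp only [tilt, Real.norm_eq_abs, abs_mul, Real.abs_exp]
    have : |f x| + |f x| * Real.exp (inner ℝ μ (toSpace x)) =
      |f x| * (1 + Real.exp (inner ℝ μ (toSpace x))) := by ring
    rw [this]
    refine mul_le_mul_of_nonneg_left ?_ (abs_nonneg _)
    rw [real_inner_smul_left]
    rcases le_total 0 (inner ℝ μ (toSpace x)) with h | h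
    · have : Real.exp (t * inner ℝ μ (toSpace x)) ≤ Real.exp (inner ℝ μ (toSpace x)) :=
        Real.exp_le_exp.2 (by nlinarith [ht.2])
      linarith
    · have : Real.exp (t * inner ℝ μ (toSpace x)) ≤ 1 :=
        Real.exp_le_one_iff.2 (by nlinarith [ht.1])
      linarith [Real.exp_pos (inner ℝ μ (toSpace x))]

/-- On the boundary of `Ω` the tilted `J` has total mass one. -/
theorem tsum_tilt_J_edge (hM : 0 ≤ M) (hΩ : AssumptionOmega S) (hJ : AssumptionJ M K ζ S h J)
    {μ : Space d} (hμ : IsEdge S μ) : ∑' x, tilt J μ x = 1 := by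
  have hlim := tendsto_tsum_tilt_ray hJ.summable_J (hJ.summable_tilt_J hM hμ.mem_closure)
  have hev : ∀ᶠ t : ℝ in 𝓝[<] 1, t • μ ∈ Omega S := by
    filter_upwards [Ioo_mem_nhdsLT (show (0 : ℝ) < 1 by norm_num)] with t ht
    exact hμ.2 t ht.1.le ht.2
  have hle : ∑' x, tilt J μ x ≤ 1 :=
    le_of_tendsto hlim (hev.mono fun t ht => (hJ.tsum_tilt_J_lt_one hM hΩ ht).le)
  by_contra hne
  have hlt : ∑' x, tilt J μ x < 1 := lt_of_le_of_ne hle hne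
  -- If the limit mass were below one, the tilted susceptibility would be at most M/(1 - c) near the
  -- end of the ray. Finite partial sums are continuous in t, so they obey the same bound at μ
  -- itself, which forces μ ∈ Ω.
  obtain ⟨c, hc1, hc2⟩ := exists_between hlt
  have hev2 : ∀ᶠ t : ℝ in 𝓝[<] 1, ∑' x, tilt J (t • μ) x < c := hlim.eventually_lt_const hc1
  refine hμ.1 ?_
  refine summable_of_sum_le (c := M / (1 - c))
    (fun x => mul_nonneg (hΩ.nonneg x) (Real.exp_pos _).le) fun u => ?_
  have hcont : Continuous fun t : ℝ => ∑ x ∈ u, tilt S (t • μ) x := by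
    unfold tilt; fun_prop
  have hl := (hcont.tendsto 1).mono_left (nhdsWithin_le_nhds (s := Set.Iio 1))
  rw [one_smul] at hl
  refine le_of_tendsto hl ?_
  filter_upwards [hev, hev2] with t ht1 ht2
  have hS : Summable (tilt S (t • μ)) := ht1
  have hnn : ∀ x, 0 ≤ tilt S (t • μ) x :=
    fun x => mul_nonneg (hΩ.nonneg x) (Real.exp_pos _).le
  refine (hS.sum_le_tsum u fun x _ => hnn x).trans ?_
  obtain ⟨hs1, hb1⟩ := lattice_one_bound hM (hJ.mem_class _ (subset_closure ht1)).g_norm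
  have e := hJ.tsum_equation_tilt hM ht1
  have h4 : ∑' x, tilt h (t • μ) x ≤ M :=
    (Summable.tsum_le_tsum (fun x => le_abs_self _) hs1.of_abs hs1).trans hb1
  have h5 : 0 ≤ ∑' x, tilt S (t • μ) x := tsum_nonneg hnn
  rw [le_div_iff₀ (by linarith)]
  nlinarith

/-- The gap `1 - ∑ J` of the untilted kernel. -/
noncomputable def gap (J : Lattice d → ℝ) : ℝ := 1 - ∑' x, J x

theorem gap_pos (hM : 0 ≤ M) (hΩ : AssumptionOmega S) (hJ : AssumptionJ M K ζ S h J) :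
    0 < gap J := by
  have := hJ.tsum_tilt_J_lt_one hM hΩ hΩ.zero_mem
  rw [tilt_zero] at this
  rw [gap]; linarith

/-- At an edge the tilted mass of J equals one, so its expansion around the untilted mass becomes an
expansion of the gap in terms of the norm of the edge point alone. -/
theorem gap_expansion (hM : 0 ≤ M) (hΩ : AssumptionOmega S) (hJ : AssumptionJ M K ζ S h J)
    {a : ℝ} (ha : 0 ≤ a) (ha1 : a ≤ 1) (haζ : a ≤ ζ) {μ : Space d} (hμ : IsEdge S μ) :
    |gap J - ‖μ‖ ^ 2 * sigmaSq J / (2 * d)| ≤ 3 * M * ‖μ‖ ^ (2 + a) := by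
  have hc := hJ.mem_class μ hμ.mem_closure
  have := tilt_expansion (hJ.hasMoments_J hM hΩ) hJ.symmetric_J (dim_pos d) hM ha ha1 haζ μ
    hc.Q_norm hc.Q_moment
  rwa [hJ.tsum_tilt_J_edge hM hΩ hμ] at this

/-- Compare the infrared bound with the expansion of Ĵ at k = t e₁, divide by t² and let t → 0. -/
theorem sigmaSq_lower (hM : 0 ≤ M) (hζ : 0 < ζ) (hΩ : AssumptionOmega S)
    (hJ : AssumptionJ M K ζ S h J) : K ≤ sigmaSq J / (2 * d) := by
  have hc := hJ.mem_class_zero hΩ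
  set a := min ζ 1 with haDef
  have ha : 0 < a := by positivity
  have hlim : Tendsto (fun t : ℝ => sigmaSq J / (2 * d) + 3 * M * t ^ a) (𝓝[>] 0)
      (𝓝 (sigmaSq J / (2 * d))) := by
    have : Tendsto (fun t : ℝ => sigmaSq J / (2 * d) + 3 * M * t ^ a) (𝓝 0)
        (𝓝 (sigmaSq J / (2 * d) + 3 * M * 0 ^ a)) := by
      refine tendsto_const_nhds.add (Tendsto.const_mul _ ?_)
      exact (Real.continuous_rpow_const ha.le).tendsto 0
    rw [Real.zero_rpow ha.ne', mul_zero, add_zero] at this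
    exact this.mono_left nhdsWithin_le_nhds
  refine ge_of_tendsto hlim ?_
  filter_upwards [Ioo_mem_nhdsGT Real.pi_pos] with t ht
  have ht0 := ht.1
  have h1 := hc.infrared (t • e₁ d) fun i => by
    by_cases hi : i = 0
    · subst hi; simp [e₁, abs_of_pos ht0, ht.2.le]
    · simp [e₁, hi, Real.pi_pos.le]
  have h2 := fourier_expansion (hJ.hasMoments_J hM hΩ) hJ.symmetric_J (dim_pos d) hM ha.le
    (min_le_right _ _) (min_le_left ζ 1) hc.Q_moment (t • e₁ d)
  rw [norm_smul, norm_e₁, Real.norm_of_nonneg ht0.le, mul_one] at h1 h2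
  have h3 := (abs_le.1 h2).2
  rw [Real.rpow_add ht0] at h3
  norm_num at h3
  have h4 : t ^ 2 * K ≤ t ^ 2 * (sigmaSq J / (2 * d) + 3 * M * t ^ a) := by
    have : t ^ 2 * sigmaSq J / (2 * d) = t ^ 2 * (sigmaSq J / (2 * d)) := by ring
    rw [this] at h3
    simp only [Complex.sub_re] at h1
    nlinarith
  exact le_of_mul_le_mul_left h4 (by positivity)

theorem sigmaSq_upper (hM : 0 ≤ M) (hζ : 0 < ζ) (hΩ : AssumptionOmega S)
    (hJ : AssumptionJ M K ζ S h J) : sigmaSq J ≤ M := by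
  obtain ⟨hs, hb⟩ := lattice_one_bound hM (hJ.mem_class_zero hΩ).Q_moment
  refine le_trans ?_ hb
  have hm := hJ.hasMoments_J hM hΩ 2
  have : ∀ y : Lattice d, ‖toSpace y‖ ^ 2 * J y ≤ |‖toSpace y‖ ^ (2 + ζ) * J y| := fun y => by
    rw [abs_mul, abs_of_nonneg (show 0 ≤ ‖toSpace y‖ ^ (2 + ζ) by positivity)]
    have := norm_toSpace_pow_mono (y := y) (a := 2) (b := 2 + ζ) two_pos (by linarith)
    rw [Real.rpow_two] at this
    exact (mul_le_mul_of_nonneg_left (le_abs_self _) (by positivity)).trans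
      (mul_le_mul_of_nonneg_right this (abs_nonneg _))
  refine Summable.tsum_le_tsum this ?_ hs
  refine Summable.of_norm_bounded hm fun y => ?_
  rw [Real.norm_eq_abs, abs_mul, abs_of_nonneg (by positivity)]

/-- Both μ and `mass S • e₁ d` are edges and see the same gap, so subtracting their expansions
bounds |‖μ‖² - m²|; dividing by ‖μ‖ + m ≥ m gives the claim. The d³ comes from ‖μ‖ ≤ d m and 2 + a ≤
3. -/
theorem edge_norm_bound (hM : 0 ≤ M) (hK : 0 < K) (hζ : 0 < ζ) (hΩ : AssumptionOmega S)
    (hJ : AssumptionJ M K ζ S h J) {μ : Space d} (hμ : IsEdge S μ) :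
    |‖μ‖ - mass S| ≤ 3 * M * ((d : ℝ) ^ 3 + 1) / K * mass S ^ (1 + min ζ 1) := by
  obtain ⟨hm, hme⟩ := hΩ.mass_edge
  set a := min ζ 1 with haDef
  have ha : 0 < a := by positivity
  have ha1 : a ≤ 1 := min_le_right _ _
  have hd1 : (1 : ℝ) ≤ d := by exact_mod_cast dim_pos d
  have h1 := hJ.gap_expansion hM hΩ ha.le ha1 (min_le_left _ _) hμ
  have h2 := hJ.gap_expansion hM hΩ ha.le ha1 (min_le_left _ _) hme
  have hσ := hJ.sigmaSq_lower hM hζ hΩ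
  rw [norm_smul, norm_e₁, mul_one, Real.norm_of_nonneg hm.le] at h2
  have h3 : ‖μ‖ ^ (2 + a) ≤ (d : ℝ) ^ 3 * mass S ^ (2 + a) := by
    calc ‖μ‖ ^ (2 + a) ≤ (d * mass S) ^ (2 + a) :=
          Real.rpow_le_rpow (norm_nonneg _) (hΩ.norm_le_mass_closure hμ.mem_closure) (by linarith)
      _ = (d : ℝ) ^ (2 + a) * mass S ^ (2 + a) := Real.mul_rpow (by positivity) hm.le
      _ ≤ (d : ℝ) ^ (3 : ℝ) * mass S ^ (2 + a) := by
          gcongr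
          linarith
      _ = _ := by norm_cast
  have h4 : |‖μ‖ ^ 2 - mass S ^ 2| * K ≤ 3 * M * ((d : ℝ) ^ 3 + 1) * mass S ^ (2 + a) := by
    calc |‖μ‖ ^ 2 - mass S ^ 2| * K ≤ |‖μ‖ ^ 2 - mass S ^ 2| * (sigmaSq J / (2 * d)) := by gcongr
      _ = |(‖μ‖ ^ 2 - mass S ^ 2) * (sigmaSq J / (2 * d))| := by
          rw [abs_mul, abs_of_pos (lt_of_lt_of_le hK hσ)]
      _ = |(gap J - mass S ^ 2 * sigmaSq J / (2 * d)) -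
            (gap J - ‖μ‖ ^ 2 * sigmaSq J / (2 * d))| := by
          congr 1; ring
      _ ≤ _ := (abs_sub _ _).trans (add_le_add h2 h1)
      _ ≤ 3 * M * mass S ^ (2 + a) + 3 * M * ((d : ℝ) ^ 3 * mass S ^ (2 + a)) := by gcongr
      _ = _ := by ring
  have h5 : |‖μ‖ - mass S| * mass S ≤ |‖μ‖ ^ 2 - mass S ^ 2| := by
    have : ‖μ‖ ^ 2 - mass S ^ 2 = (‖μ‖ - mass S) * (‖μ‖ + mass S) := by ring
    rw [this, abs_mul, abs_of_pos (show 0 < ‖μ‖ + mass S by positivity)]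
    gcongr
    linarith [norm_nonneg μ]
  have h6 : mass S ^ (2 + a) = mass S ^ (1 + a) * mass S := by
    rw [← Real.rpow_add_one hm.ne']; congr 1; ring
  rw [div_mul_eq_mul_div, le_div_iff₀ hK]
  rw [h6] at h4
  refine le_of_mul_le_mul_right ?_ hm
  calc |‖μ‖ - mass S| * K * mass S = (|‖μ‖ - mass S| * mass S) * K := by ring
    _ ≤ |‖μ‖ ^ 2 - mass S ^ 2| * K := by gcongr
    _ ≤ _ := by linarith

theorem gap_mass_bound (hM : 0 ≤ M) (hK : 0 < K) (hζ : 0 < ζ) (hΩ : AssumptionOmega S)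
    (hJ : AssumptionJ M K ζ S h J) :
    |2 * d * gap J / sigmaSq J - mass S ^ 2| ≤ 3 * M / K * mass S ^ (2 + min ζ 1) := by
  obtain ⟨hm, hme⟩ := hΩ.mass_edge
  have h2 := hJ.gap_expansion hM hΩ (a := min ζ 1) (by positivity) (min_le_right _ _)
    (min_le_left _ _) hme
  have hσ := hJ.sigmaSq_lower hM hζ hΩ
  have hd1 : (0 : ℝ) < d := by exact_mod_cast dim_pos d
  rw [norm_smul, norm_e₁, mul_one, Real.norm_of_nonneg hm.le] at h2
  have hq : 0 < sigmaSq J / (2 * d) := lt_of_lt_of_le hK hσ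
  have hs : 0 < sigmaSq J := by
    have := mul_pos hq (show (0 : ℝ) < 2 * d by positivity)
    rwa [div_mul_cancel₀ _ (by positivity)] at this
  have e : 2 * d * gap J / sigmaSq J - mass S ^ 2 =
      (gap J - mass S ^ 2 * sigmaSq J / (2 * d)) / (sigmaSq J / (2 * d)) := by
    field_simp
  rw [e, abs_div, abs_of_pos hq, div_le_iff₀ hq]
  calc _ ≤ 3 * M * mass S ^ (2 + min ζ 1) := h2
    _ = 3 * M / K * mass S ^ (2 + min ζ 1) * K := by field_simp
    _ ≤ _ := by gcongr

/-- Ω is nearly a Euclidean ball of radius m: pushing any of its points out to the edge bounds the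
norm from above, while the edge point on the ray through v already gives almost m‖v‖. -/
theorem massNorm_bound (hM : 0 ≤ M) (hK : 0 < K) (hζ : 0 < ζ) (hΩ : AssumptionOmega S)
    (hJ : AssumptionJ M K ζ S h J) (v : Space d) :
    |mass S * massNorm S v - mass S * ‖v‖| ≤
      3 * M * ((d : ℝ) ^ 3 + 1) / K * mass S ^ (1 + min ζ 1) * ‖v‖ := by
  obtain ⟨hm, -⟩ := hΩ.mass_edge
  set C := 3 * M * ((d : ℝ) ^ 3 + 1) / K * mass S ^ (1 + min ζ 1) with hC
  have hC0 : 0 ≤ C := by positivity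
  rw [massNorm, mul_div_cancel₀ _ hm.ne']
  have hup : ∀ μ ∈ Omega S, ‖μ‖ ≤ mass S + C := by
    intro μ hμ
    rcases eq_or_ne μ 0 with rfl | h0
    · simpa using by positivity
    obtain ⟨t, ht, hedge, hmax⟩ := hΩ.exists_edge h0
    have h1 : 1 ≤ t := hmax 1 zero_le_one (by simpa using hμ)
    have h2 := (abs_le.1 (hJ.edge_norm_bound hM hK hζ hΩ hedge)).2
    rw [norm_smul, Real.norm_of_nonneg ht.le] at h2
    nlinarith [norm_nonneg μ]
  have hup' : ∀ μ ∈ closure (Omega S), ‖μ‖ ≤ mass S + C := fun μ hμ =>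
    closure_minimal hup (isClosed_le continuous_norm continuous_const) hμ
  have hub : ∀ r ∈ (fun μ : Space d => inner ℝ μ v) '' closure (Omega S),
      r ≤ (mass S + C) * ‖v‖ := by
    rintro _ ⟨μ, hμ, rfl⟩
    exact (real_inner_le_norm _ _).trans (by gcongr; exact hup' μ hμ)
  have hne : ((fun μ : Space d => inner ℝ μ v) '' closure (Omega S)).Nonempty :=
    ⟨_, 0, subset_closure hΩ.zero_mem, rfl⟩
  rw [abs_le]
  constructor
  · rcases eq_or_ne v 0 with rfl | h0
    · have : (0 : ℝ) ≤ sSup ((fun μ : Space d => inner ℝ μ (0 : Space d)) '' closure (Omega S)) :=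
        le_csSup ⟨_, hub⟩ ⟨0, subset_closure hΩ.zero_mem, by simp⟩
      simpa using this
    obtain ⟨t, ht, hedge, -⟩ := hΩ.exists_edge h0
    have h2 := (abs_le.1 (hJ.edge_norm_bound hM hK hζ hΩ hedge)).1
    rw [norm_smul, Real.norm_of_nonneg ht.le] at h2
    have h3 : inner ℝ (t • v) v ≤ sSup ((fun μ : Space d => inner ℝ μ v) '' closure (Omega S)) :=
      le_csSup ⟨_, hub⟩ ⟨t • v, hedge.mem_closure, rfl⟩
    rw [real_inner_smul_left, real_inner_self_eq_norm_sq] at h3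
    nlinarith [norm_nonneg v]
  · have := csSup_le hne hub
    linarith

end AssumptionJ

end Geometry

/-! ### Fourier inversion and Parseval on the cube -/

section Torus

variable {d : ℕ}

/-- The fundamental domain `[-π, π]^d`. -/
def cube (d : ℕ) : Set (Space d) := {k | ∀ i, |k i| ≤ Real.pi}

theorem cube_preimage : (WithLp.toLp 2 : (Fin d → ℝ) → Space d) ⁻¹' cube d =
    Set.univ.pi fun _ => Set.Icc (-Real.pi) Real.pi := by
  ext x
  simp only [Set.mem_preimage, cube, Set.mem_ofPred_eq, Set.mem_pi, Set.mem_univ, true_imp_iff,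
    Set.mem_Icc, abs_le]

theorem measurableEmbedding_toLp :
    MeasurableEmbedding (WithLp.toLp 2 : (Fin d → ℝ) → Space d) :=
  (MeasurableEquiv.toLp 2 (Fin d → ℝ)).measurableEmbedding

theorem setIntegral_cube (F : Space d → ℂ) :
    ∫ k in cube d, F k =
      ∫ x in Set.univ.pi fun _ : Fin d => Set.Icc (-Real.pi) Real.pi, F (WithLp.toLp 2 x) := by
  rw [← cube_preimage, (PiLp.volume_preserving_toLp (Fin d)).setIntegral_preimage_emb
    measurableEmbedding_toLp]

theorem isCompact_cube : IsCompact (cube d) := by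
  have : cube d = (WithLp.toLp 2 : (Fin d → ℝ) → Space d) ''
      Set.univ.pi fun _ => Set.Icc (-Real.pi) Real.pi := by
    rw [← cube_preimage, Set.image_preimage_eq]
    exact (WithLp.equiv 2 (Fin d → ℝ)).symm.surjective
  rw [this]
  exact (isCompact_univ_pi fun _ => isCompact_Icc).image (PiLp.continuous_toLp 2 _)

theorem measurableSet_cube : MeasurableSet (cube d) := isCompact_cube.isClosed.measurableSet

theorem volume_cube_lt_top : volume (cube d) < ⊤ := isCompact_cube.measure_lt_top

instance : IsFiniteMeasure ((volume : Measure (Space d)).restrict (cube d)) :=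
  ⟨by simpa using volume_cube_lt_top⟩

theorem continuous_chr (x : Lattice d) : Continuous fun k : Space d => chr k x := by
  unfold chr; fun_prop

theorem integral_exp_int (n : ℤ) :
    ∫ t in Set.Icc (-Real.pi) Real.pi, Complex.exp (-(Complex.I * (t * n : ℝ))) =
      if n = 0 then 2 * (Real.pi : ℂ) else 0 := by
  rw [integral_Icc_eq_integral_Ioc,
    ← intervalIntegral.integral_of_le (by linarith [Real.pi_pos])]
  split_ifs with h
  · subst h; simp; ring
  · have hn : (-(Complex.I * n) : ℂ) ≠ 0 := by simp [h]
    have e : ∀ t : ℝ, Complex.exp (-(Complex.I * (t * n : ℝ))) =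
        Complex.exp (-(Complex.I * n) * t) := fun t => by congr 1; push_cast; ring
    simp_rw [e]
    rw [integral_exp_mul_complex hn]
    have : Complex.exp (-(Complex.I * n) * (Real.pi : ℝ)) =
        Complex.exp (-(Complex.I * n) * ((-Real.pi : ℝ) : ℂ)) := by
      rw [Complex.exp_eq_exp_iff_exists_int]
      exact ⟨-n, by push_cast; ring⟩
    rw [this, sub_self, zero_div]

theorem integral_chr (x : Lattice d) :
    ∫ k in cube d, chr k x = if x = 0 then (2 * (Real.pi : ℂ)) ^ d else 0 := by
  rw [setIntegral_cube, volume_pi, Measure.restrict_pi_pi]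
  have e : ∀ k : Fin d → ℝ, chr (WithLp.toLp 2 k) x =
      ∏ i, Complex.exp (-(Complex.I * (k i * x i : ℝ))) := fun k => by
    rw [chr, inner_toSpace, ← Complex.exp_sum]
    congr 1
    push_cast
    rw [Finset.mul_sum, Finset.sum_neg_distrib]
  simp_rw [e]
  rw [integral_fintype_prod_eq_prod (𝕜 := ℂ)
    (f := fun (i : Fin d) (t : ℝ) => Complex.exp (-(Complex.I * (t * x i : ℝ))))]
  simp_rw [integral_exp_int]
  split_ifs with h
  · subst h; simp
  · obtain ⟨i, hi⟩ : ∃ i, x i ≠ 0 := by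
      by_contra! h'
      exact h (funext h')
    exact Finset.prod_eq_zero (Finset.mem_univ i) (by simp [hi])

theorem continuous_latticeFourier {f : Lattice d → ℝ} (hf : Summable f) :
    Continuous (latticeFourier f) := by
  refine continuous_tsum (u := fun x => |f x|) (fun x => ?_) hf.abs fun x k => ?_
  · exact continuous_const.mul (continuous_chr x)
  · exact le_of_eq (by rw [← chr, norm_mul, norm_chr, mul_one]; simp)

theorem integral_tsum_chr {ι : Type*} [Countable ι] {f : ι → ℂ} (hf : Summable fun i => ‖f i‖)
    (G : Space d → ℂ) (hG : Continuous G) (y : ι → Lattice d) :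
    ∫ k in cube d, (∑' i, f i * chr k (y i)) * G k =
      ∑' i, f i * ∫ k in cube d, chr k (y i) * G k := by
  have hint : ∀ i, Integrable (fun k => f i * (chr k (y i) * G k)) (volume.restrict (cube d)) :=
    fun i => (((continuous_chr (y i)).mul hG).const_mul (f i) |>.continuousOn.integrableOn_compact
      isCompact_cube)
  have hsum : Summable fun i => ∫ k in cube d, ‖f i * (chr k (y i) * G k)‖ := by
    have : ∀ i, ∫ k in cube d, ‖f i * (chr k (y i) * G k)‖ =
        ‖f i‖ * ∫ k in cube d, ‖G k‖ := fun i => by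
      rw [← integral_const_mul]
      congr 1; ext k; simp
    simp_rw [this]
    exact hf.mul_right _
  have h := (hasSum_integral_of_summable_integral_norm hint hsum).tsum_eq
  simp_rw [integral_const_mul] at h
  rw [h]
  congr 1
  ext k
  rw [← tsum_mul_right]
  exact tsum_congr fun i => by ring

theorem fourier_inversion {f : Lattice d → ℝ} (hf : Summable f) (x : Lattice d) :
    ∫ k in cube d, latticeFourier f k * chr k (-x) = (2 * (Real.pi : ℂ)) ^ d * f x := by
  have h := integral_tsum_chr (f := fun y => (f y : ℂ)) (by simpa using hf.abs)
    (fun k => chr k (-x)) (continuous_chr _) id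
  simp only [id] at h
  simp_rw [latticeFourier_eq, h, ← chr_add, integral_chr]
  rw [tsum_eq_single x]
  · simp [mul_comm]
  · intro y hy
    have : y + -x ≠ 0 := fun h' => hy (add_neg_eq_zero.1 h')
    simp [this]

theorem conj_chr (k : Space d) (x : Lattice d) : (starRingEnd ℂ) (chr k x) = chr k (-x) := by
  rw [chr, chr, ← Complex.exp_conj, toSpace_neg, inner_neg_right]
  congr 1
  simp

theorem conj_latticeFourier (f : Lattice d → ℝ) (k : Space d) :
    (starRingEnd ℂ) (latticeFourier f k) = ∑' y, (f y : ℂ) * chr k (-y) := by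
  rw [latticeFourier_eq, Complex.conj_tsum]
  refine tsum_congr fun y => ?_
  rw [map_mul, conj_chr, Complex.conj_ofReal]

theorem parseval {f : Lattice d → ℝ} (hf : Summable f) :
    ∫ k in cube d, ‖latticeFourier f k‖ ^ 2 = (2 * Real.pi) ^ d * ∑' y, f y ^ 2 := by
  have h := integral_tsum_chr (f := fun y => (f y : ℂ)) (by simpa using hf.abs)
    (latticeFourier f) (continuous_latticeFourier hf) (fun y => -y)
  have e : ∀ y, ∫ k in cube d, chr k (-y) * latticeFourier f k =
      (2 * (Real.pi : ℂ)) ^ d * f y := fun y => by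
    rw [← fourier_inversion hf y]
    congr 1; ext k; ring
  simp_rw [e, ← conj_latticeFourier] at h
  have h2 : ((∫ k in cube d, ‖latticeFourier f k‖ ^ 2 : ℝ) : ℂ) =
      (((2 * Real.pi) ^ d * ∑' y, f y ^ 2 : ℝ) : ℂ) := by
    rw [← integral_complex_ofReal]
    push_cast
    rw [← tsum_mul_left, ← integral_congr_ae (Eventually.of_forall fun k =>
      (Complex.conj_mul' (latticeFourier f k)))]
    rw [h]
    exact tsum_congr fun y => by ring
  exact_mod_cast h2

end Torus

/-! ### Iterated directional derivatives and integration by parts -/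

section Towers

variable {d : ℕ}

/-- The `i`-th unit vector. -/
noncomputable def unitVec (i : Fin d) : Space d := EuclideanSpace.single i 1

/-- A sequence of continuous functions, `2π`-periodic in direction `i`, in which each
function is the partial derivative of its predecessor in direction `i`. -/
structure IsTower (i : Fin d) (U : ℕ → Space d → ℂ) : Prop where
  cont : ∀ n, Continuous (U n)
  periodic : ∀ n k, U n (k + (2 * Real.pi) • unitVec i) = U n k
  deriv : ∀ n k, HasDerivAt (fun t : ℝ => U n (k + t • unitVec i)) (U (n + 1) k) 0

theorem IsTower.deriv_at {i : Fin d} {U : ℕ → Space d → ℂ} (hU : IsTower i U) (n : ℕ)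
    (k : Space d) (t : ℝ) :
    HasDerivAt (fun t : ℝ => U n (k + t • unitVec i)) (U (n + 1) (k + t • unitVec i)) t := by
  have h := hU.deriv n (k + t • unitVec i)
  have h2 : HasDerivAt (fun s : ℝ => s - t) 1 t := (hasDerivAt_id t).sub_const t
  have h3 := HasDerivAt.scomp (g₁ := fun s : ℝ => U n (k + t • unitVec i + s • unitVec i))
    (h := fun s : ℝ => s - t) (x := t) (h' := 1) (by simpa using h) h2
  simp only [one_smul] at h3
  refine h3.congr_of_eventuallyEq (Eventually.of_forall fun s => ?_)
  simp only [Function.comp]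
  rw [add_assoc, ← add_smul]; congr 3; ring

theorem inner_unitVec (i : Fin d) (y : Lattice d) : inner ℝ (unitVec i) (toSpace y) = y i := by
  rw [unitVec, EuclideanSpace.inner_single_left]; simp

theorem chr_add_left (k l : Space d) (x : Lattice d) : chr (k + l) x = chr k x * chr l x := by
  rw [chr, chr, chr, ← Complex.exp_add, inner_add_left]
  congr 1; push_cast; ring

theorem chr_smul_unitVec (t : ℝ) (i : Fin d) (y : Lattice d) :
    chr (t • unitVec i) y = Complex.exp (-(Complex.I * (t * y i))) := by
  rw [chr, real_inner_smul_left, inner_unitVec]; push_cast; rfl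

theorem chr_periodic (k : Space d) (i : Fin d) (y : Lattice d) :
    chr (k + (2 * Real.pi) • unitVec i) y = chr k y := by
  rw [chr_add_left, chr_smul_unitVec]
  have : Complex.exp (-(Complex.I * (((2 * Real.pi : ℝ) : ℂ) * y i))) = 1 := by
    rw [Complex.exp_eq_one_iff]
    exact ⟨-(y i), by push_cast; ring⟩
  rw [this, mul_one]

theorem hasDerivAt_chr (k : Space d) (i : Fin d) (y : Lattice d) (t : ℝ) :
    HasDerivAt (fun t : ℝ => chr (k + t • unitVec i) y)
      (-(Complex.I * y i) * chr (k + t • unitVec i) y) t := by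
  simp_rw [chr_add_left, chr_smul_unitVec]
  have h1 : HasDerivAt (fun t : ℝ => -(Complex.I * ((t : ℂ) * y i))) (-(Complex.I * y i)) t := by
    have := ((Complex.ofRealCLM.hasDerivAt (x := t)).mul_const (y i : ℂ)).const_mul Complex.I
    simpa using this.fun_neg
  exact (h1.cexp.const_mul (chr k y)).congr_deriv (by ring)

/-- The `n`-th derivative in direction `i` of the Fourier transform. -/
noncomputable def fourierTower (i : Fin d) (f : Lattice d → ℝ) (n : ℕ) (k : Space d) : ℂ :=
  (-Complex.I) ^ n * latticeFourier (fun y => (y i : ℝ) ^ n * f y) k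

theorem HasMoments.summable_coord {f : Lattice d → ℝ} (hf : HasMoments f) (i : Fin d) (n : ℕ) :
    Summable fun y : Lattice d => (y i : ℝ) ^ n * f y := by
  refine Summable.of_norm_bounded (hf n) fun y => ?_
  rw [Real.norm_eq_abs, abs_mul, abs_pow]
  gcongr
  exact abs_coord_le y i

theorem isTower_fourier {f : Lattice d → ℝ} (hf : HasMoments f) (i : Fin d) :
    IsTower i (fourierTower i f) where
  cont n := continuous_const.mul (continuous_latticeFourier (hf.summable_coord i n))
  periodic n k := by
    simp only [fourierTower, latticeFourier_eq, chr_periodic]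
  deriv n k := by
    have hsum := hf.summable_coord i n
    have key := hasDerivAt_tsum (u := fun y : Lattice d => |(y i : ℝ) ^ (n + 1) * f y|)
      (g := fun y (t : ℝ) => (((y i : ℝ) ^ n * f y : ℝ) : ℂ) * chr (k + t • unitVec i) y)
      (g' := fun y (t : ℝ) => (((y i : ℝ) ^ n * f y : ℝ) : ℂ) *
        (-(Complex.I * y i) * chr (k + t • unitVec i) y))
      (y₀ := 0) (hf.summable_coord i (n + 1)).abs
      (fun y t => (hasDerivAt_chr k i y t).const_mul _)
      (fun y t => le_of_eq (by
        rw [norm_mul, norm_mul (-(Complex.I * (y i : ℂ))), norm_chr, Complex.norm_real, norm_neg,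
          norm_mul Complex.I, Complex.norm_I,
          Real.norm_eq_abs, abs_mul, abs_mul, pow_succ, abs_mul]
        have : ‖((y i : ℤ) : ℂ)‖ = |(y i : ℝ)| := by
          rw [← Complex.ofReal_intCast, Complex.norm_real, Real.norm_eq_abs]
        rw [this]; ring))
      (summable_mul_chr hsum _) 0
    have := key.const_mul ((-Complex.I) ^ n)
    refine this.congr_deriv ?_
    simp only [fourierTower, latticeFourier_eq]
    rw [← tsum_mul_left, ← tsum_mul_left]
    refine tsum_congr fun y => ?_
    simp only [zero_smul, add_zero]
    push_cast; ring

/-- The derivatives of a product, by the Leibniz rule. -/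
noncomputable def mulTower (U V : ℕ → Space d → ℂ) (n : ℕ) (k : Space d) : ℂ :=
  ∑ p ∈ Finset.HasAntidiagonal.antidiagonal n, (n.choose p.1 : ℂ) * (U p.1 k * V p.2 k)

theorem mulTower_zero (U V : ℕ → Space d → ℂ) (k : Space d) : mulTower U V 0 k = U 0 k * V 0 k := by
  simp [mulTower]

theorem IsTower.mul {i : Fin d} {U V : ℕ → Space d → ℂ} (hU : IsTower i U) (hV : IsTower i V) :
    IsTower i (mulTower U V) where
  cont n := by
    unfold mulTower
    exact continuous_finsetSum _ fun p _ =>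
      continuous_const.mul ((hU.cont _).mul (hV.cont _))
  periodic n k := by simp only [mulTower, hU.periodic, hV.periodic]
  deriv n k := by
    have h : HasDerivAt (fun t : ℝ => mulTower U V n (k + t • unitVec i))
        (∑ p ∈ Finset.HasAntidiagonal.antidiagonal n, (n.choose p.1 : ℂ) *
          (U (p.1 + 1) k * V p.2 k + U p.1 k * V (p.2 + 1) k)) 0 := by
      unfold mulTower
      refine HasDerivAt.fun_sum fun p _ => ?_
      have := ((hU.deriv p.1 k).mul (hV.deriv p.2 k)).const_mul (n.choose p.1 : ℂ)
      simpa using this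
    refine h.congr_deriv ?_
    rw [mulTower, Finset.sum_antidiagonal_choose_succ_mul (fun a b => U a k * V b k) n,
      ← Finset.sum_add_distrib]
    refine Finset.sum_congr rfl fun p hp => ?_
    have : n.choose p.2 = n.choose p.1 := by
      rw [Finset.HasAntidiagonal.mem_antidiagonal] at hp
      exact Nat.choose_symm_of_eq_add (by omega)
    rw [this]; ring

/-- Derivatives are unique, so a tower is determined by its zeroth entry. An identity between
functions thereby passes to all orders, with `mulTower` providing the Leibniz rule. -/
theorem IsTower.congr_zero {i : Fin d} {U V : ℕ → Space d → ℂ} (hU : IsTower i U)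
    (hV : IsTower i V) (h : ∀ k, U 0 k = V 0 k) (n : ℕ) (k : Space d) : U n k = V n k := by
  induction n generalizing k with
  | zero => exact h k
  | succ n ih =>
    have h1 := hU.deriv n k
    simp_rw [ih] at h1
    exact h1.unique (hV.deriv n k)

theorem toLp_insertNth {n : ℕ} (i : Fin (n + 1)) (t : ℝ) (y : Fin n → ℝ) :
    (WithLp.toLp 2 (i.insertNth t y) : Space (n + 1)) =
      WithLp.toLp 2 (i.insertNth 0 y) + t • unitVec i := by
  ext j
  rcases eq_or_ne j i with rfl | hj
  · simp [unitVec]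
  · obtain ⟨l, rfl⟩ := Fin.exists_succAbove_eq hj
    simp [unitVec]

/-- Fubini isolates coordinate i, and the inner integral is the increment of U over one full period.
-/
theorem integral_deriv_eq_zero {i : Fin d} {U U' : Space d → ℂ} (hU' : Continuous U')
    (hper : ∀ k, U (k + (2 * Real.pi) • unitVec i) = U k)
    (hd : ∀ k (t : ℝ), HasDerivAt (fun t : ℝ => U (k + t • unitVec i))
      (U' (k + t • unitVec i)) t) :
    ∫ k in cube d, U' k = 0 := by
  obtain ⟨n, rfl⟩ : ∃ n, d = n + 1 := ⟨d - 1, by have := i.pos; omega⟩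
  rw [setIntegral_cube]
  have hmp := (volume_preserving_piFinSuccAbove (fun _ : Fin (n + 1) => ℝ) i).symm
  have hpre : (MeasurableEquiv.piFinSuccAbove (fun _ : Fin (n + 1) => ℝ) i).symm ⁻¹'
      (Set.univ.pi fun _ => Set.Icc (-Real.pi) Real.pi) =
      Set.Icc (-Real.pi) Real.pi ×ˢ (Set.univ.pi fun _ : Fin n => Set.Icc (-Real.pi) Real.pi) := by
    ext ⟨t, y⟩
    simp only [Set.mem_preimage, Set.mem_pi, Set.mem_univ, true_imp_iff, Set.mem_prod,
      MeasurableEquiv.piFinSuccAbove_symm_apply]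
    rw [Fin.forall_iff_succAbove i]
    simp [Fin.insertNthEquiv]
  rw [← hmp.setIntegral_preimage_emb
    (MeasurableEquiv.piFinSuccAbove (fun _ : Fin (n + 1) => ℝ) i).symm.measurableEmbedding, hpre,
    Measure.volume_eq_prod, ← Measure.prod_restrict, integral_prod_symm]
  · refine integral_eq_zero_of_ae (Eventually.of_forall fun y => ?_)
    have e : ∀ t : ℝ, (WithLp.toLp 2
        ((MeasurableEquiv.piFinSuccAbove (fun _ : Fin (n + 1) => ℝ) i).symm (t, y)) :
          Space (n + 1)) = WithLp.toLp 2 (i.insertNth 0 y) + t • unitVec i :=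
      fun t => toLp_insertNth i t y
    simp_rw [e]
    rw [integral_Icc_eq_integral_Ioc,
      ← intervalIntegral.integral_of_le (by linarith [Real.pi_pos]),
      intervalIntegral.integral_eq_sub_of_hasDerivAt (fun t _ => hd _ t)]
    · have h := hper (WithLp.toLp 2 (i.insertNth 0 y) + (-Real.pi) • unitVec i)
      rw [add_assoc, ← add_smul] at h
      have e2 : -Real.pi + 2 * Real.pi = Real.pi := by ring
      rw [e2] at h
      rw [h]; simp
    · exact Continuous.intervalIntegrable (by fun_prop) _ _
  · rw [Measure.prod_restrict]
    refine ContinuousOn.integrableOn_compact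
      (isCompact_Icc.prod (isCompact_univ_pi fun _ => isCompact_Icc)) (Continuous.continuousOn ?_)
    have e : ∀ p : ℝ × (Fin n → ℝ), (WithLp.toLp 2
        ((MeasurableEquiv.piFinSuccAbove (fun _ : Fin (n + 1) => ℝ) i).symm p) :
          Space (n + 1)) = WithLp.toLp 2 (i.insertNth p.1 p.2) := fun p => rfl
    simp_rw [e]
    refine hU'.comp ((PiLp.continuous_toLp 2 _).comp ?_)
    exact Continuous.finInsertNth i continuous_fst continuous_snd

/-- Repeated integration by parts. -/
theorem IsTower.integral_mul_chr {i : Fin d} {U : ℕ → Space d → ℂ} (hU : IsTower i U)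
    (x : Lattice d) (n : ℕ) :
    ∫ k in cube d, U n k * chr k (-x) =
      (-(Complex.I * x i)) ^ n * ∫ k in cube d, U 0 k * chr k (-x) := by
  induction n with
  | zero => simp
  | succ n ih =>
    have h0 := integral_deriv_eq_zero (i := i) (U := fun k => U n k * chr k (-x))
      (U' := fun k => U (n + 1) k * chr k (-x) + U n k * ((Complex.I * x i) * chr k (-x)))
      (((hU.cont _).mul (continuous_chr _)).add
        ((hU.cont _).mul (continuous_const.mul (continuous_chr _))))
      (fun k => by simp only [hU.periodic, chr_periodic])
      (fun k t => by
        have := (hU.deriv_at n k t).mul (hasDerivAt_chr k i (-x) t)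
        refine this.congr_deriv ?_
        simp)
    have hi : ∀ m, Integrable (fun k => U m k * chr k (-x)) (volume.restrict (cube d)) := fun m =>
      ((hU.cont m).mul (continuous_chr _)).continuousOn.integrableOn_compact isCompact_cube
    have e : ∀ k, U n k * ((Complex.I * x i) * chr k (-x)) =
        (Complex.I * x i) * (U n k * chr k (-x)) := fun k => by ring
    simp_rw [e] at h0
    rw [integral_add (hi _) ((hi _).const_mul _), integral_const_mul, ih] at h0
    rw [pow_succ]
    linear_combination h0

end Towers

/-! ### A weak-type Hausdorff-Young inequality and its integrated form -/

section HausdorffYoung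

variable {d : ℕ}

/-- A weak type form of the Hausdorff-Young inequality; `p` and `q` are conjugate. -/
theorem weak_hausdorff_young {p q W : ℝ} (hq : 2 ≤ q) (hp : p = q / (q - 1)) (hW : 0 < W)
    {f : Lattice d → ℝ} (hf : Summable f) (hfp : Summable fun y => |f y| ^ p)
    (hfW : ∑' y, |f y| ^ p ≤ W) {t : ℝ} (ht : 0 < t) :
    volume {k | k ∈ cube d ∧ t < ‖latticeFourier f k‖} ≤
      ENNReal.ofReal (4 * (2 * Real.pi) ^ d * W * (2 * W) ^ (q - 2) * t ^ (-q)) := by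
  have hq1 : 0 < q - 1 := by linarith
  have hp1 : (q - 1) * (1 - p) = -1 := by rw [hp]; field_simp; ring
  have hp2 : (q - 1) * (2 - p) = q - 2 := by linarith
  have hp0 : 1 < p := by rw [hp, lt_div_iff₀ hq1]; linarith
  have hple : p ≤ 2 := by rw [hp, div_le_iff₀ hq1]; linarith
  -- The truncation level is chosen so that the values above it have ℓ¹ norm at most η^{1-p} W =
  -- t/2. Their transform never exceeds t/2, so where the full transform exceeds t the transform of
  -- the rest is at least t/2, and Chebyshev with Parseval applies to it.
  set η := (2 * W / t) ^ (q - 1) with hη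
  have hη0 : 0 < η := by positivity
  have hη1 : η ^ (1 - p) = t / (2 * W) := by
    rw [hη, ← Real.rpow_mul (by positivity), hp1, Real.rpow_neg_one, inv_div]
  have hη2 : η ^ (2 - p) = (2 * W) ^ (q - 2) * t ^ (-(q - 2)) := by
    rw [hη, ← Real.rpow_mul (by positivity), hp2, Real.div_rpow (by positivity) ht.le,
      Real.rpow_neg ht.le, div_eq_mul_inv]
  set f1 : Lattice d → ℝ := fun y => if η < |f y| then f y else 0 with hf1
  set f2 : Lattice d → ℝ := fun y => if η < |f y| then 0 else f y with hf2
  have hf1a : ∀ y, |f1 y| ≤ |f y| := fun y => by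
    simp only [hf1]; split_ifs <;> simp
  have hf2a : ∀ y, |f2 y| ≤ |f y| := fun y => by
    simp only [hf2]; split_ifs <;> simp
  have hs1 : Summable f1 := Summable.of_norm_bounded hf.abs hf1a
  have hs2 : Summable f2 := Summable.of_norm_bounded hf.abs hf2a
  have hsplit : ∀ k, latticeFourier f k = latticeFourier f1 k + latticeFourier f2 k := fun k => by
    rw [← latticeFourier_add hs1 hs2]
    congr 1
    ext y; simp only [Pi.add_apply, hf1, hf2]; split_ifs <;> simp
  have hb1 : ∀ k, ‖latticeFourier f1 k‖ ≤ t / 2 := fun k => by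
    refine (norm_latticeFourier_le hs1 k).trans ?_
    have : ∀ y, |f1 y| ≤ η ^ (1 - p) * |f y| ^ p := fun y => by
      simp only [hf1]
      split_ifs with h
      · have hpos : 0 < |f y| := hη0.trans h
        have e : |f y| = |f y| ^ (1 - p) * |f y| ^ p := by
          rw [← Real.rpow_add hpos]; simp
        conv_lhs => rw [e]
        refine mul_le_mul_of_nonneg_right ?_ (by positivity)
        exact Real.rpow_le_rpow_of_nonpos hη0 h.le (by linarith)
      · simp; positivity
    calc ∑' y, |f1 y| ≤ ∑' y, η ^ (1 - p) * |f y| ^ p :=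
          Summable.tsum_le_tsum this hs1.abs (hfp.mul_left _)
      _ = η ^ (1 - p) * ∑' y, |f y| ^ p := tsum_mul_left
      _ ≤ t / (2 * W) * W := by rw [hη1]; gcongr
      _ = t / 2 := by field_simp
  have hb2 : ∑' y, f2 y ^ 2 ≤ η ^ (2 - p) * W := by
    have : ∀ y, f2 y ^ 2 ≤ η ^ (2 - p) * |f y| ^ p := fun y => by
      simp only [hf2]
      split_ifs with h
      · simp; positivity
      · rcases (abs_nonneg (f y)).eq_or_lt with h0 | h0
        · rw [abs_eq_zero.1 h0.symm]; simp; positivity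
        have e : f y ^ 2 = |f y| ^ (2 - p) * |f y| ^ p := by
          rw [← Real.rpow_add h0]; simp
        rw [e]
        refine mul_le_mul_of_nonneg_right ?_ (by positivity)
        exact Real.rpow_le_rpow h0.le (not_lt.1 h) (by linarith)
    have hsum : Summable fun y => f2 y ^ 2 :=
      Summable.of_nonneg_of_le (fun y => by positivity) this (hfp.mul_left _)
    calc ∑' y, f2 y ^ 2 ≤ ∑' y, η ^ (2 - p) * |f y| ^ p :=
          Summable.tsum_le_tsum this hsum (hfp.mul_left _)
      _ = η ^ (2 - p) * ∑' y, |f y| ^ p := tsum_mul_left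
      _ ≤ _ := by gcongr
  have hsub : {k | k ∈ cube d ∧ t < ‖latticeFourier f k‖} ⊆
      {k | (t / 2) ^ 2 ≤ ‖latticeFourier f2 k‖ ^ 2} ∩ cube d := by
    rintro k ⟨hk, hlt⟩
    refine ⟨?_, hk⟩
    have h3 := norm_add_le (latticeFourier f1 k) (latticeFourier f2 k)
    rw [← hsplit] at h3
    have h4 := hb1 k
    have : t / 2 ≤ ‖latticeFourier f2 k‖ := by linarith
    exact pow_le_pow_left₀ (by positivity) this 2
  have hcont : Continuous fun k => ‖latticeFourier f2 k‖ ^ 2 :=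
    (continuous_latticeFourier hs2).norm.pow 2
  have hint : Integrable (fun k => ‖latticeFourier f2 k‖ ^ 2) (volume.restrict (cube d)) :=
    hcont.continuousOn.integrableOn_compact isCompact_cube
  have hcheb := mul_meas_ge_le_integral_of_nonneg
    (Eventually.of_forall fun k => by positivity) hint ((t / 2) ^ 2)
  rw [parseval hs2] at hcheb
  refine (measure_mono hsub).trans ?_
  have hms : MeasurableSet {k | (t / 2) ^ 2 ≤ ‖latticeFourier f2 k‖ ^ 2} :=
    (isClosed_le continuous_const hcont).measurableSet
  rw [← Measure.restrict_apply hms,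
    ← ENNReal.ofReal_toReal (measure_ne_top (volume.restrict (cube d)) _)]
  refine ENNReal.ofReal_le_ofReal ?_
  have e1 : t ^ (-q) = t ^ (-(q - 2)) / t ^ 2 := by
    rw [eq_div_iff (by positivity), ← Real.rpow_natCast t 2, ← Real.rpow_add ht]
    congr 1; push_cast; ring
  rw [e1]
  rw [hη2] at hb2
  change (t / 2) ^ 2 * (volume.restrict (cube d)
    {k | (t / 2) ^ 2 ≤ ‖latticeFourier f2 k‖ ^ 2}).toReal ≤ _ at hcheb
  generalize (volume.restrict (cube d)
    {k | (t / 2) ^ 2 ≤ ‖latticeFourier f2 k‖ ^ 2}).toReal = m at hcheb ⊢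
  calc m = ((t / 2) ^ 2 * m) * (4 / t ^ 2) := by field_simp; ring
    _ ≤ ((2 * Real.pi) ^ d * ((2 * W) ^ (q - 2) * t ^ (-(q - 2)) * W)) * (4 / t ^ 2) := by
        refine mul_le_mul_of_nonneg_right (hcheb.trans ?_) (by positivity)
        exact mul_le_mul_of_nonneg_left hb2 (by positivity)
    _ = _ := by ring

/-- Functions of weak type `q₀` are integrable to any smaller power on sets of finite measure. -/
theorem lintegral_rpow_of_weak {α : Type*} [MeasurableSpace α] {μ : Measure α} {u : α → ℝ}
    (hu : AEMeasurable u μ) (hu0 : ∀ x, 0 ≤ u x) {q q₀ V C : ℝ} (hq : 0 < q) (hqq : q < q₀)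
    (hV : 0 < V) (hC : 0 ≤ C) (hμ : μ Set.univ ≤ ENNReal.ofReal V)
    (hw : ∀ t, 0 < t → μ {x | t < u x} ≤ ENNReal.ofReal (C * t ^ (-q₀))) :
    ∫⁻ x, ENNReal.ofReal (u x ^ q) ∂μ ≤
      ENNReal.ofReal ((1 + q * C / (q₀ - q)) * V ^ (1 - q / q₀)) := by
  have hq0 : 0 < q₀ := hq.trans hqq
  rw [lintegral_rpow_eq_lintegral_meas_lt_mul μ (Eventually.of_forall hu0) hu hq]
  -- The layer-cake integral is split where the trivial bound V equals t^{-q₀}: the total measure is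
  -- used below s, the weak bound above it.
  set s := V ^ (-(1 / q₀)) with hs
  have hs0 : 0 < s := by positivity
  have hunion : Set.Ioi (0 : ℝ) = Set.Ioc 0 s ∪ Set.Ioi s := (Set.Ioc_union_Ioi_eq_Ioi hs0.le).symm
  rw [hunion, lintegral_union measurableSet_Ioi Set.Ioc_disjoint_Ioi_same]
  have h1 : ∫⁻ t in Set.Ioc 0 s, μ {a | t < u a} * ENNReal.ofReal (t ^ (q - 1)) ≤
      ENNReal.ofReal (V * (s ^ q / q)) := by
    calc _ ≤ ∫⁻ t in Set.Ioc 0 s, ENNReal.ofReal (V * t ^ (q - 1)) := by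
          refine setLIntegral_mono' measurableSet_Ioc fun t ht => ?_
          rw [ENNReal.ofReal_mul hV.le]
          gcongr
          exact (measure_mono (Set.subset_univ _)).trans hμ
      _ = ENNReal.ofReal (∫ t in Set.Ioc 0 s, V * t ^ (q - 1)) := by
          rw [ofReal_integral_eq_lintegral_ofReal]
          · refine Integrable.const_mul ?_ _
            have := (intervalIntegral.intervalIntegrable_rpow' (a := 0) (b := s)
              (show -1 < q - 1 by linarith)).1
            exact this
          · refine (ae_restrict_iff' measurableSet_Ioc).2 (Eventually.of_forall fun t ht => ?_)
            have := ht.1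
            positivity
      _ = _ := by
          rw [integral_const_mul, ← intervalIntegral.integral_of_le hs0.le,
            integral_rpow (Or.inl (by linarith))]
          simp [Real.zero_rpow hq.ne']
  have h2 : ∫⁻ t in Set.Ioi s, μ {a | t < u a} * ENNReal.ofReal (t ^ (q - 1)) ≤
      ENNReal.ofReal (C * (s ^ (q - q₀) / (q₀ - q))) := by
    calc _ ≤ ∫⁻ t in Set.Ioi s, ENNReal.ofReal (C * t ^ (q - q₀ - 1)) := by
          refine setLIntegral_mono' measurableSet_Ioi fun t ht => ?_
          have ht0 : 0 < t := hs0.trans ht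
          have e : C * t ^ (q - q₀ - 1) = (C * t ^ (-q₀)) * t ^ (q - 1) := by
            rw [mul_assoc, ← Real.rpow_add ht0]; congr 2; ring
          rw [e, ENNReal.ofReal_mul (by positivity)]
          gcongr
          exact hw t ht0
      _ = ENNReal.ofReal (∫ t in Set.Ioi s, C * t ^ (q - q₀ - 1)) := by
          rw [ofReal_integral_eq_lintegral_ofReal]
          · exact (integrableOn_Ioi_rpow_of_lt (by linarith) hs0).const_mul _
          · refine (ae_restrict_iff' measurableSet_Ioi).2 (Eventually.of_forall fun t ht => ?_)
            have : 0 < t := hs0.trans ht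
            positivity
      _ = _ := by
          rw [integral_const_mul, integral_Ioi_rpow_of_lt (by linarith) hs0]
          congr 2
          have : q - q₀ - 1 + 1 = -(q₀ - q) := by ring
          rw [this, neg_div_neg_eq]
          congr 1; congr 1; ring
  have e1 : V * s ^ q = V ^ (1 - q / q₀) := by
    rw [hs, ← Real.rpow_mul hV.le]
    nth_rw 1 [← Real.rpow_one V]
    rw [← Real.rpow_add hV]; congr 1; ring
  have e2 : s ^ (q - q₀) = V ^ (1 - q / q₀) := by
    rw [hs, ← Real.rpow_mul hV.le]; congr 1; field_simp; ring
  have hqq' : 0 < q₀ - q := by linarith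
  calc _ ≤ ENNReal.ofReal q * (ENNReal.ofReal (V * (s ^ q / q)) +
        ENNReal.ofReal (C * (s ^ (q - q₀) / (q₀ - q)))) := by gcongr
    _ = ENNReal.ofReal (q * (V * (s ^ q / q) + C * (s ^ (q - q₀) / (q₀ - q)))) := by
        rw [← ENNReal.ofReal_add (by positivity) (by positivity), ← ENNReal.ofReal_mul hq.le]
    _ = _ := by
        congr 1
        rw [← e1] at *
        rw [e2]
        field_simp

end HausdorffYoung

/-! ### Scale-invariant norms on dyadic annuli -/

section Annuli

variable {d : ℕ}

/-- A dyadic annulus in the fundamental domain. -/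
def annulus (d : ℕ) (r : ℝ) : Set (Space d) := {k | k ∈ cube d ∧ r < ‖k‖ ∧ ‖k‖ ≤ 2 * r}

theorem measurableSet_annulus (r : ℝ) : MeasurableSet (annulus d r) :=
  measurableSet_cube.inter ((isOpen_lt continuous_const continuous_norm).measurableSet.inter
    (isClosed_le continuous_norm continuous_const).measurableSet)

theorem norm_le_of_mem_cube {k : Space d} (hk : k ∈ cube d) : ‖k‖ ≤ d * Real.pi := by
  refine (norm_space_le_sum k).trans ((Finset.sum_le_sum fun i _ => hk i).trans ?_)
  simp

/-- A constant `≥ 1` such that the annulus of radius `r` has volume at most `annConst d * r ^ d`. -/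
noncomputable def annConst (d : ℕ) : ℝ :=
  2 ^ d * (volume (Metric.ball (0 : Space d) 1)).toReal + 1

theorem one_le_annConst : 1 ≤ annConst d := by
  rw [annConst]
  have : 0 ≤ 2 ^ d * (volume (Metric.ball (0 : Space d) 1)).toReal := by positivity
  linarith

theorem volume_annulus_le {r : ℝ} (hr : 0 < r) :
    volume (annulus d r) ≤ ENNReal.ofReal (annConst d * r ^ d) := by
  have hsub : annulus d r ⊆ Metric.closedBall 0 (2 * r) := fun k hk => by
    simpa using hk.2.2
  refine (measure_mono hsub).trans ?_
  rw [Measure.addHaar_closedBall _ _ (by positivity),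
    ← ENNReal.ofReal_toReal (measure_ball_lt_top (x := (0 : Space d)) (r := 1)).ne,
    ← ENNReal.ofReal_mul (by positivity)]
  refine ENNReal.ofReal_le_ofReal ?_
  rw [finrank_euclideanSpace_fin, annConst, mul_pow]
  have : 0 < r ^ d := by positivity
  nlinarith

/-- The norm in which derivatives of order `n` are measured on the annulus of radius `r`. -/
noncomputable def annNorm (n : ℕ) (r : ℝ) (u : Space d → ℂ) : ENNReal :=
  eLpNorm u ((d : ENNReal) / n) (volume.restrict (annulus d r))

theorem annNorm_mono {n : ℕ} {r : ℝ} {u v : Space d → ℂ}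
    (h : ∀ k ∈ annulus d r, ‖u k‖ ≤ ‖v k‖) : annNorm n r u ≤ annNorm n r v :=
  eLpNorm_mono_ae ((ae_restrict_iff' (measurableSet_annulus r)).2 (Eventually.of_forall h))

/-- The order n = 0 is included: for d > 0 the exponent is then ∞, its `toReal` is 0, and both sides
vanish. -/
theorem toReal_div_inv (n : ℕ) : ((d : ENNReal) / n).toReal⁻¹ = n / d := by
  rw [ENNReal.toReal_div]; simp

theorem annNorm_le_of_bound (hd : 0 < d) {n : ℕ} (hn : n ≤ d) {r B : ℝ} (hr : 0 < r)
    (hB : 0 ≤ B) {u : Space d → ℂ} (h : ∀ k ∈ annulus d r, ‖u k‖ ≤ B) :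
    annNorm n r u ≤ ENNReal.ofReal (annConst d * B * r ^ n) := by
  have h1 := eLpNorm_le_of_ae_bound (p := (d : ENNReal) / n) (μ := volume.restrict (annulus d r))
    ((ae_restrict_iff' (measurableSet_annulus r)).2 (Eventually.of_forall h))
  refine h1.trans ?_
  rw [toReal_div_inv, Measure.restrict_apply_univ]
  have hd' : (0 : ℝ) < d := by exact_mod_cast hd
  have hv := one_le_annConst (d := d)
  have hnd : (n : ℝ) / d ≤ 1 := by
    rw [div_le_one hd']; exact_mod_cast hn
  calc volume (annulus d r) ^ ((n : ℝ) / d) * ENNReal.ofReal B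
      ≤ ENNReal.ofReal (annConst d * r ^ d) ^ ((n : ℝ) / d) * ENNReal.ofReal B := by
        gcongr; exact volume_annulus_le hr
    _ = ENNReal.ofReal ((annConst d * r ^ d) ^ ((n : ℝ) / d) * B) := by
        rw [ENNReal.ofReal_rpow_of_nonneg (by positivity) (by positivity),
          ENNReal.ofReal_mul (by positivity)]
    _ ≤ _ := by
        refine ENNReal.ofReal_le_ofReal ?_
        rw [Real.mul_rpow (by linarith) (by positivity), ← Real.rpow_natCast r d,
          ← Real.rpow_mul hr.le, mul_div_cancel₀ _ hd'.ne', Real.rpow_natCast]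
        -- This is where a volume constant of at least one is convenient: its power n/d ≤ 1 does not
        -- exceed it.
        have : annConst d ^ ((n : ℝ) / d) ≤ annConst d := by
          nth_rw 2 [← Real.rpow_one (annConst d)]
          exact Real.rpow_le_rpow_of_exponent_le hv hnd
        calc annConst d ^ ((n : ℝ) / d) * r ^ n * B ≤ annConst d * r ^ n * B := by gcongr
          _ = _ := by ring

/-- By Hausdorff-Young the transform is of weak type q₀. As d/n < q₀ strictly, it lies in L^{d/n} on
a set of volume of order r^d, with the gain r^{d(n/d - 1/q₀)}. -/
theorem annNorm_fourier_le (hd : 0 < d) {n : ℕ} (hn : 1 ≤ n) {q₀ W : ℝ} (hq₀ : 2 ≤ q₀)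
    (hdn : (d : ℝ) / n < q₀) (hW : 0 < W) :
    ∃ C, 0 ≤ C ∧ ∀ f : Lattice d → ℝ, Summable f →
      Summable (fun y => |f y| ^ (q₀ / (q₀ - 1))) → ∑' y, |f y| ^ (q₀ / (q₀ - 1)) ≤ W →
      ∀ r, 0 < r → annNorm n r (latticeFourier f) ≤ ENNReal.ofReal (C * r ^ ((n : ℝ) - d / q₀)) := by
  obtain ⟨C₁, hC₁⟩ : ∃ C₁, C₁ = 4 * (2 * Real.pi) ^ d * W * (2 * W) ^ (q₀ - 2) := ⟨_, rfl⟩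
  have hC₁0 : 0 ≤ C₁ := by rw [hC₁]; positivity
  have hd' : (0 : ℝ) < d := by exact_mod_cast hd
  have hn' : (0 : ℝ) < n := by exact_mod_cast hn
  set q : ℝ := d / n with hq
  have hq0 : 0 < q := by positivity
  have hqq : 0 < q₀ - q := by linarith
  have hv := one_le_annConst (d := d)
  refine ⟨((1 + q * C₁ / (q₀ - q)) * annConst d ^ (1 - q / q₀)) ^ (1 / q), by positivity,
    fun f hf hfp hfW r hr => ?_⟩
  have hcast : (d : ENNReal) / n = ENNReal.ofReal q := by
    rw [hq, ENNReal.ofReal_div_of_pos hn', ENNReal.ofReal_natCast, ENNReal.ofReal_natCast]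
  have hcont := continuous_latticeFourier hf
  have hweak := lintegral_rpow_of_weak (μ := volume.restrict (annulus d r))
    (u := fun k => ‖latticeFourier f k‖) hcont.norm.aemeasurable (fun _ => norm_nonneg _)
    (q := q) (q₀ := q₀) (V := annConst d * r ^ d) (C := C₁) hq0 hdn (by positivity) hC₁0
    (by rw [Measure.restrict_apply_univ]; exact volume_annulus_le hr)
    (fun t ht => by
      rw [Measure.restrict_apply (isOpen_lt continuous_const hcont.norm).measurableSet]
      rw [hC₁]
      refine (measure_mono ?_).trans (weak_hausdorff_young hq₀ rfl hW hf hfp hfW ht)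
      exact fun k hk => ⟨hk.2.1, hk.1⟩)
  rw [annNorm, hcast, eLpNorm_eq_lintegral_rpow_enorm_toReal (by simpa using hq0)
    ENNReal.ofReal_ne_top, ENNReal.toReal_ofReal hq0.le]
  have e : ∀ k, ‖latticeFourier f k‖ₑ ^ q = ENNReal.ofReal (‖latticeFourier f k‖ ^ q) := fun k => by
    rw [← ENNReal.ofReal_rpow_of_nonneg (norm_nonneg _) hq0.le, ofReal_norm]
  simp_rw [e]
  refine (ENNReal.rpow_le_rpow hweak (by positivity)).trans ?_
  rw [ENNReal.ofReal_rpow_of_nonneg (by positivity) (by positivity)]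
  refine ENNReal.ofReal_le_ofReal (le_of_eq ?_)
  rw [Real.mul_rpow (x := annConst d) (y := r ^ d) (by linarith) (by positivity), ← mul_assoc,
    Real.mul_rpow (y := (r ^ d) ^ (1 - q / q₀)) (by positivity) (by positivity)]
  congr 1
  rw [← Real.rpow_natCast r d, ← Real.rpow_mul hr.le, ← Real.rpow_mul hr.le]
  congr 1
  rw [hq]; field_simp

/-- Pointwise interpolation between `ℓ¹` and `ℓᴾ`. -/
theorem interpolate_le {a b θ P p : ℝ} (ha : 0 ≤ a) (hb : 0 ≤ b) (hθ0 : 0 ≤ θ) (hθ1 : θ ≤ 1)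
    (hP : 0 < P) (hp0 : 0 < p) (hp : p * ((1 - θ) + θ / P) = 1) :
    (a ^ (1 - θ) * b ^ θ) ^ p ≤ a + b ^ P := by
  have h1 : 0 ≤ (1 - θ) * p := mul_nonneg (by linarith) hp0.le
  have h2 : 0 ≤ θ / P * p := by positivity
  have h3 : (1 - θ) * p + θ / P * p = 1 := by linarith
  have h := Real.geom_mean_le_arith_mean2_weighted h1 h2 ha (Real.rpow_nonneg hb P) h3
  have e : (a ^ (1 - θ) * b ^ θ) ^ p = a ^ ((1 - θ) * p) * (b ^ P) ^ (θ / P * p) := by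
    rw [Real.mul_rpow (by positivity) (by positivity), ← Real.rpow_mul ha, ← Real.rpow_mul hb,
      ← Real.rpow_mul hb]
    congr 2; field_simp
  rw [e]
  refine h.trans ?_
  have : 0 ≤ b ^ P := Real.rpow_nonneg hb P
  nlinarith

end Annuli

/-! ### Derivatives of Ĵ and ĥ on annuli -/

section SymbolBounds

variable {d : ℕ}

theorem norm_fourierTower (i : Fin d) (f : Lattice d → ℝ) (n : ℕ) (k : Space d) :
    ‖fourierTower i f n k‖ = ‖latticeFourier (fun y => (y i : ℝ) ^ n * f y) k‖ := by
  rw [fourierTower, norm_mul, norm_pow, norm_neg, Complex.norm_I, one_pow, one_mul]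

theorem annNorm_fourierTower (i : Fin d) (f : Lattice d → ℝ) (n : ℕ) (r : ℝ) :
    annNorm n r (fourierTower i f n) =
      annNorm n r (latticeFourier fun y => (y i : ℝ) ^ n * f y) :=
  le_antisymm (annNorm_mono fun k _ => (norm_fourierTower i f n k).le)
    (annNorm_mono fun k _ => (norm_fourierTower i f n k).ge)

theorem norm_chr_sub_one_le (k : Space d) (y : Lattice d) :
    ‖chr k y - 1‖ ≤ ‖k‖ * ‖toSpace y‖ := by
  have h := Real.norm_exp_I_mul_ofReal_sub_one_le (x := -inner ℝ k (toSpace y))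
  have e : chr k y = Complex.exp (Complex.I * ((-inner ℝ k (toSpace y) : ℝ) : ℂ)) := by
    rw [chr]; congr 1; push_cast; ring
  rw [e]
  refine h.trans ?_
  rw [norm_neg, Real.norm_eq_abs]
  exact abs_real_inner_le_norm _ _

theorem tsum_coord_mul_eq_zero {f : Lattice d → ℝ} (hs : IsSymmetric f) (i : Fin d) :
    ∑' y, (y i : ℝ) * f y = 0 := by
  have h := tsum_comp_neg fun y : Lattice d => (y i : ℝ) * f y
  have : ∀ y : Lattice d, ((-y) i : ℝ) * f (-y) = -((y i : ℝ) * f y) := fun y => by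
    rw [hs.neg]; simp
  simp_rw [this, tsum_neg] at h
  linarith

/-- By symmetry the first moment, hence the first derivative at the origin, vanishes; the increment
from the origin costs one further moment and a factor ‖k‖. -/
theorem norm_fourierTower_one_le {f : Lattice d → ℝ} (hf : HasMoments f) (hs : IsSymmetric f)
    (i : Fin d) (k : Space d) :
    ‖fourierTower i f 1 k‖ ≤ (∑' y, ‖toSpace y‖ ^ 2 * |f y|) * ‖k‖ := by
  have hsum := hf.summable_coord i 1
  have h0 : latticeFourier (fun y => (y i : ℝ) ^ 1 * f y) 0 = 0 := by
    rw [latticeFourier_zero]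
    simp_rw [pow_one]
    rw [tsum_coord_mul_eq_zero hs i]; simp
  rw [norm_fourierTower, ← sub_zero (latticeFourier _ k), ← h0, latticeFourier_eq,
    latticeFourier_eq, ← (summable_mul_chr hsum k).tsum_sub (summable_mul_chr hsum 0), mul_comm]
  refine tsum_of_norm_bounded ((hf 2).hasSum.mul_left ‖k‖) fun y => ?_
  rw [chr_zero_left, ← mul_sub, norm_mul, Complex.norm_real, Real.norm_eq_abs, abs_mul, pow_one]
  calc |(y i : ℝ)| * |f y| * ‖chr k y - 1‖ ≤ ‖toSpace y‖ * |f y| * (‖k‖ * ‖toSpace y‖) := by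
        gcongr
        · exact abs_coord_le y i
        · exact norm_chr_sub_one_le k y
    _ = _ := by ring

theorem norm_fourierTower_le {f : Lattice d → ℝ} (hf : HasMoments f) (i : Fin d) (n : ℕ)
    (k : Space d) : ‖fourierTower i f n k‖ ≤ ∑' y, ‖toSpace y‖ ^ n * |f y| := by
  rw [norm_fourierTower]
  have hs := hf.summable_coord i n
  refine (norm_latticeFourier_le hs k).trans (Summable.tsum_le_tsum (fun y => ?_) hs.abs (hf n))
  rw [abs_mul, abs_pow]
  gcongr
  exact abs_coord_le y i

theorem tsum_sq_moment_le {M ζ : ℝ} (hM : 0 ≤ M) (hζ : 0 < ζ) {f : Lattice d → ℝ}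
    (hf : HasMoments f)
    (hQ : latticeNorm 1 (fun y => ‖toSpace y‖ ^ (2 + ζ) * f y) ≤ ENNReal.ofReal M) :
    ∑' y, ‖toSpace y‖ ^ 2 * |f y| ≤ M := by
  obtain ⟨hs, hb⟩ := lattice_one_bound hM hQ
  refine (Summable.tsum_le_tsum (fun y => ?_) (hf 2) hs).trans hb
  rw [abs_mul, abs_of_nonneg (show 0 ≤ ‖toSpace y‖ ^ (2 + ζ) by positivity)]
  have := norm_toSpace_pow_mono (y := y) (a := 2) (b := 2 + ζ) two_pos (by linarith)
  rw [Real.rpow_two] at this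
  gcongr

/-- `ℓᵖ` bounds of an intermediate moment. -/
theorem intermediate_moment {a b n : ℕ} (han : a ≤ n) (hnb : n ≤ b) (hab : a < b) {P q₀ A B : ℝ}
    (hP : 0 < P) (hq₀ : 1 < q₀)
    (hq : 1 / q₀ = ((n : ℝ) - a) / ((b : ℝ) - a) * (1 - 1 / P)) {f : Lattice d → ℝ}
    (hn0 : 1 ≤ n) (hf : Summable fun y => ‖toSpace y‖ ^ a * |f y|)
    (hfA : ∑' y, ‖toSpace y‖ ^ a * |f y| ≤ A)
    (hg : Summable fun y => |‖toSpace y‖ ^ b * f y| ^ P)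
    (hgB : ∑' y, |‖toSpace y‖ ^ b * f y| ^ P ≤ B) (i : Fin d) :
    Summable (fun y => |(y i : ℝ) ^ n * f y| ^ (q₀ / (q₀ - 1))) ∧
      ∑' y, |(y i : ℝ) ^ n * f y| ^ (q₀ / (q₀ - 1)) ≤ A + B := by
  have hab' : (0 : ℝ) < (b : ℝ) - a := by
    have : (a : ℝ) < b := by exact_mod_cast hab
    linarith
  have han' : (a : ℝ) ≤ n := by exact_mod_cast han
  have hnb' : (n : ℝ) ≤ b := by exact_mod_cast hnb
  -- The weight for which a(1 - θ) + bθ = n.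
  set θ : ℝ := ((n : ℝ) - a) / ((b : ℝ) - a) with hθ
  have hθ0 : 0 ≤ θ := div_nonneg (by linarith) hab'.le
  have hθ1 : θ ≤ 1 := by rw [hθ, div_le_one hab']; linarith
  have hp0 : 0 < q₀ / (q₀ - 1) := div_pos (by linarith) (by linarith)
  have hp : q₀ / (q₀ - 1) * ((1 - θ) + θ / P) = 1 := by
    have e : (1 - θ) + θ / P = 1 - 1 / q₀ := by rw [hq]; ring
    have : q₀ - 1 ≠ 0 := by linarith
    rw [e]; field_simp
  have hle : ∀ y : Lattice d, |(y i : ℝ) ^ n * f y| ^ (q₀ / (q₀ - 1)) ≤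
      ‖toSpace y‖ ^ a * |f y| + |‖toSpace y‖ ^ b * f y| ^ P := fun y => by
    refine le_trans ?_ (interpolate_le (by positivity) (abs_nonneg _) hθ0 hθ1 hP hp0 hp)
    refine Real.rpow_le_rpow (abs_nonneg _) ?_ hp0.le
    rcases eq_or_ne y 0 with rfl | hy
    · have : n ≠ 0 := by omega
      simp [this]; positivity
    have hy1 := one_le_norm_toSpace hy
    have hy0 : 0 < ‖toSpace y‖ := by linarith
    rw [abs_mul, abs_mul, abs_pow, abs_pow, abs_norm,
      Real.mul_rpow (by positivity) (abs_nonneg _), Real.mul_rpow (by positivity) (abs_nonneg _)]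
    have e1 : (‖toSpace y‖ ^ a) ^ (1 - θ) * (‖toSpace y‖ ^ b) ^ θ = ‖toSpace y‖ ^ n := by
      rw [← Real.rpow_natCast, ← Real.rpow_natCast, ← Real.rpow_natCast, ← Real.rpow_mul hy0.le,
        ← Real.rpow_mul hy0.le, ← Real.rpow_add hy0]
      congr 1
      rw [hθ]; field_simp; ring
    have e2 : |f y| ^ (1 - θ) * |f y| ^ θ = |f y| := by
      rcases (abs_nonneg (f y)).eq_or_lt with h0 | h0
      · rw [← h0]
        rcases hθ0.eq_or_lt with h1 | h1
        · rw [← h1]; simp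
        · rw [Real.zero_rpow h1.ne', mul_zero]
      · rw [← Real.rpow_add h0]; simp
    calc |(y i : ℝ)| ^ n * |f y| ≤ ‖toSpace y‖ ^ n * |f y| := by
          gcongr; exact abs_coord_le y i
      _ = _ := by rw [← e1]; nth_rw 1 [← e2]; ring
  have hs : Summable fun y : Lattice d => |(y i : ℝ) ^ n * f y| ^ (q₀ / (q₀ - 1)) :=
    Summable.of_nonneg_of_le (fun y => by positivity) hle (hf.add hg)
  refine ⟨hs, (Summable.tsum_le_tsum hle hs (hf.add hg)).trans ?_⟩
  rw [hf.tsum_add hg]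
  exact add_le_add hfA hgB

variable [NeZero d]

/-- At order one, symmetry makes the derivative O(r) and the norm adds a factor r; at order two the
derivative is bounded and the norm adds r². Orders n ≥ 3 occur only if d ≥ 4: interpolating the
second moment in ℓ¹ with the moment of order d - 1 in ℓ^P, where P = min (d/3) 2, gives 1/q₀ ≤ (n -
2)/d, so that Hausdorff-Young yields a power of r of at least 2. The excess power is bounded because
r ≤ dπ. -/
theorem annNorm_J_le {M K ζ : ℝ} (hM : 0 < M) (hζ : 0 < ζ) {n : ℕ} (hn : 1 ≤ n) (hnd : n < d) :
    ∃ C, 0 ≤ C ∧ ∀ J h : Lattice d → ℝ, HasMoments J → IsSymmetric J → ClassQ M K ζ J h →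
      ∀ (i : Fin d) (r : ℝ), 0 < r → r ≤ d * Real.pi →
        annNorm n r (fourierTower i J n) ≤ ENNReal.ofReal (C * r ^ 2) := by
  have hd := dim_pos d
  have hv := one_le_annConst (d := d)
  rcases Nat.lt_or_ge n 3 with hn3 | hn3
  · refine ⟨annConst d * (2 * M), by positivity, fun J h hJ hs hQ i r hr _ => ?_⟩
    have hb := tsum_sq_moment_le hM.le hζ hJ hQ.Q_moment
    obtain rfl | rfl : n = 1 ∨ n = 2 := by omega
    · refine (annNorm_le_of_bound hd hnd.le hr (B := 2 * M * r) (by positivity)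
        fun k hk => ?_).trans (le_of_eq (by congr 1; ring))
      refine (norm_fourierTower_one_le hJ hs i k).trans ?_
      calc _ ≤ M * (2 * r) := by gcongr; exact hk.2.2
        _ = _ := by ring
    · refine (annNorm_le_of_bound hd hnd.le hr (B := 2 * M) (by positivity)
        fun k hk => ?_).trans (le_of_eq (by congr 1))
      refine (norm_fourierTower_le hJ i 2 k).trans ?_
      linarith
  · have hd4 : 4 ≤ d := by omega
    set P : ℝ := min ((d : ℝ) / 3) 2 with hP
    have hd4' : (4 : ℝ) ≤ d := by exact_mod_cast hd4
    have hn3' : (3 : ℝ) ≤ n := by exact_mod_cast hn3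
    have hnd' : (n : ℝ) + 1 ≤ d := by exact_mod_cast hnd
    have hP1 : 1 < P := lt_min (by linarith) (by norm_num)
    have hP2 : P ≤ 2 := min_le_right _ _
    have hP3 : P ≤ d / 3 := min_le_left _ _
    have hPi : 1 - 1 / P ≤ ((d : ℝ) - 3) / d := by
      have : 3 / (d : ℝ) ≤ 1 / P := by
        rw [div_le_div_iff₀ (by linarith) (by linarith)]
        rw [le_div_iff₀ (by norm_num)] at hP3
        linarith
      rw [sub_div, div_self (by linarith)]
      linarith
    have hPi2 : 1 - 1 / P ≤ 1 / 2 := by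
      have : 1 / 2 ≤ 1 / P := one_div_le_one_div_of_le (by linarith) hP2
      linarith
    have hPi0 : 0 < 1 - 1 / P := by
      have : 1 / P < 1 := by rw [div_lt_one (by linarith)]; exact hP1
      linarith
    set w : ℝ := ((n : ℝ) - (2 : ℕ)) / (((d - 1 : ℕ) : ℝ) - (2 : ℕ)) * (1 - 1 / P) with hw
    have hd1 : ((d - 1 : ℕ) : ℝ) = d - 1 := by
      rw [Nat.cast_sub (by omega)]; simp
    have hfrac0 : 0 < ((n : ℝ) - (2 : ℕ)) / (((d - 1 : ℕ) : ℝ) - (2 : ℕ)) := by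
      rw [hd1]; push_cast
      exact div_pos (by linarith) (by linarith)
    have hfrac1 : ((n : ℝ) - (2 : ℕ)) / (((d - 1 : ℕ) : ℝ) - (2 : ℕ)) ≤ 1 := by
      rw [hd1]; push_cast
      rw [div_le_one (by linarith)]; linarith
    have hw0 : 0 < w := mul_pos hfrac0 hPi0
    have hw2 : w ≤ 1 / 2 := by
      calc w ≤ 1 * (1 / 2) := mul_le_mul hfrac1 hPi2 hPi0.le zero_le_one
        _ = _ := by norm_num
    -- Here P ≤ d/3 enters: 1 - 1/P ≤ (d - 3)/d, and d - 3 cancels the denominator of the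
    -- interpolation weight.
    have hwd : w ≤ ((n : ℝ) - 2) / d := by
      calc w ≤ ((n : ℝ) - (2 : ℕ)) / (((d - 1 : ℕ) : ℝ) - (2 : ℕ)) * (((d : ℝ) - 3) / d) := by
            rw [hw]; gcongr
        _ = _ := by
            rw [hd1]; push_cast
            have : (d : ℝ) - 1 - 2 ≠ 0 := by linarith
            have h3 : (d : ℝ) - 3 ≠ 0 := by linarith
            field_simp
            ring
    have hq2 : 2 ≤ 1 / w := by
      rw [le_div_iff₀ hw0]; linarith
    have hdn : (d : ℝ) / n < 1 / w := by
      rw [lt_div_iff₀ hw0, div_mul_eq_mul_div, div_lt_one (by linarith)]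
      rw [le_div_iff₀ (by linarith)] at hwd
      linarith
    obtain ⟨C, hC0, hC⟩ := annNorm_fourier_le (d := d) hd hn (q₀ := 1 / w) (W := M + M ^ P)
      hq2 hdn (by positivity)
    have hexp : 0 ≤ (n : ℝ) - d / (1 / w) - 2 := by
      rw [div_div_eq_mul_div, div_one]
      rw [le_div_iff₀ (by linarith)] at hwd
      linarith
    refine ⟨C * ((d : ℝ) * Real.pi) ^ ((n : ℝ) - d / (1 / w) - 2), by positivity,
      fun J h hJ hs hQ i r hr hrle => ?_⟩
    have hb := tsum_sq_moment_le hM.le hζ hJ hQ.Q_moment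
    have hhigh := lattice_rpow_bound (by linarith) hM.le (hQ.Q_moment_high hd4)
    obtain ⟨h1, h2⟩ := intermediate_moment (a := 2) (b := d - 1) (n := n) (by omega) (by omega)
      (by omega) (P := P) (q₀ := 1 / w) (by linarith) (by linarith) (by rw [one_div_one_div])
      (by omega) (hJ 2) hb hhigh.1 hhigh.2 i
    rw [annNorm_fourierTower]
    refine (hC _ (hJ.summable_coord i n) h1 h2 r hr).trans (ENNReal.ofReal_le_ofReal ?_)
    rw [mul_assoc]
    gcongr
    calc r ^ ((n : ℝ) - d / (1 / w)) = r ^ ((n : ℝ) - d / (1 / w) - 2) * r ^ 2 := by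
          rw [← Real.rpow_natCast r 2, ← Real.rpow_add hr]; congr 1; push_cast; ring
      _ ≤ _ := by gcongr

theorem pExp_pos {ζ : ℝ} (hζ : 0 < ζ) : 0 < pExp d ζ := by
  rw [pExp]
  split_ifs with h
  · norm_num
  · have hd : 2 ≤ d := by have := dim_pos d; omega
    have hd' : (2 : ℝ) ≤ d := by exact_mod_cast hd
    have : 0 < min ζ 2 := by positivity
    exact div_pos (by linarith) (by linarith)

/-- The `ℓ²` bound on the moment of order `max (d - 1) 2` of the inhomogeneity. -/
theorem sq_moment_h {M K ζ : ℝ} (hM : 0 < M) (hζ : 0 < ζ) {J h : Lattice d → ℝ}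
    (hQ : ClassQ M K ζ J h) :
    Summable (fun y => |‖toSpace y‖ ^ (max (d - 1) 2) * h y| ^ (2 : ℝ)) ∧
      ∑' y, |‖toSpace y‖ ^ (max (d - 1) 2) * h y| ^ (2 : ℝ) ≤ M ^ 2 := by
  rcases Nat.lt_or_ge d 4 with hd | hd
  · have : max (d - 1) 2 = 2 := by omega
    rw [this]
    have := lattice_sq_bound (lt_min (pExp_pos hζ) two_pos) (min_le_right _ _) hM.le
      hQ.g_moment_two
    simpa only [Real.rpow_two, sq_abs] using this
  · have : max (d - 1) 2 = d - 1 := by omega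
    rw [this]
    have := lattice_rpow_bound (p := 2) two_pos hM.le (f := fun y => ‖toSpace y‖ ^ (d - 1) * h y)
      (by simpa using hQ.g_moment_high hd)
    simpa using this

/-- Interpolate h in ℓ¹ with its moment of order D = max (d - 1) 2 in ℓ², so that 1/q₀ = n/(2D). The
inequality d < 2D, valid in every dimension, gives both d/n < q₀ and a nonnegative power of r. -/
theorem annNorm_h_le {M K ζ : ℝ} (hM : 0 < M) (hζ : 0 < ζ) {n : ℕ} (hnd : n < d) :
    ∃ C, 0 ≤ C ∧ ∀ J h : Lattice d → ℝ, HasMoments h → ClassQ M K ζ J h →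
      ∀ (i : Fin d) (r : ℝ), 0 < r → r ≤ d * Real.pi →
        annNorm n r (fourierTower i h n) ≤ ENNReal.ofReal C := by
  have hd := dim_pos d
  have hv := one_le_annConst (d := d)
  rcases Nat.eq_zero_or_pos n with rfl | hn
  · refine ⟨annConst d * M, by positivity, fun J h hh hQ i r hr _ => ?_⟩
    refine (annNorm_le_of_bound hd hnd.le hr (B := M) hM.le fun k _ => ?_).trans
      (le_of_eq (by congr 1; ring))
    refine (norm_fourierTower_le hh i 0 k).trans ?_
    simpa using (lattice_one_bound hM.le hQ.g_norm).2
  · obtain ⟨D, hD⟩ : ∃ D, D = max (d - 1) 2 := ⟨_, rfl⟩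
    have hDn : n ≤ D := by omega
    have hDd : d < 2 * D := by omega
    have hDn' : (n : ℝ) ≤ D := by exact_mod_cast hDn
    have hDd' : (d : ℝ) < 2 * D := by exact_mod_cast hDd
    have hn' : (0 : ℝ) < n := by exact_mod_cast hn
    have hD0 : (0 : ℝ) < D := by linarith
    have hq2 : (2 : ℝ) ≤ 2 * D / n := by
      rw [le_div_iff₀ hn']; linarith
    obtain ⟨C, hC0, hC⟩ := annNorm_fourier_le (d := d) hd hn (q₀ := 2 * D / n) (W := M + M ^ 2)
      hq2 (by gcongr) (by positivity)
    have hexp : 0 ≤ (n : ℝ) - d / (2 * D / n) := by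
      rw [div_div_eq_mul_div, sub_nonneg, div_le_iff₀ (by positivity)]
      nlinarith
    refine ⟨C * ((d : ℝ) * Real.pi) ^ ((n : ℝ) - d / (2 * D / n)), by positivity,
      fun J h hh hQ i r hr hrle => ?_⟩
    obtain ⟨hs2, hb2⟩ := sq_moment_h hM hζ hQ
    rw [← hD] at hs2 hb2
    have hb0 : ∑' y, ‖toSpace y‖ ^ 0 * |h y| ≤ M := by
      simpa using (lattice_one_bound hM.le hQ.g_norm).2
    obtain ⟨h1, h2⟩ := intermediate_moment (a := 0) (b := D) (n := n) (by omega) hDn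
      (by omega) (P := 2) (q₀ := 2 * D / n) two_pos (by linarith)
      (by push_cast; field_simp; norm_num; field_simp) hn (hh 0) hb0 hs2 hb2 i
    rw [annNorm_fourierTower]
    refine (hC _ (hh.summable_coord i n) h1 h2 r hr).trans (ENNReal.ofReal_le_ofReal ?_)
    gcongr

end SymbolBounds

/-! ### Triangle and Hölder inequalities for the annular norms -/

section AnnNorm

variable {d : ℕ}

theorem annNorm_add_le {n : ℕ} (hnd : n ≤ d) (hd : 0 < d) (r : ℝ) {u v : Space d → ℂ}
    (hu : Continuous u) (hv : Continuous v) :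
    annNorm n r (fun k => u k + v k) ≤ annNorm n r u + annNorm n r v := by
  refine eLpNorm_add_le hu.aestronglyMeasurable hv.aestronglyMeasurable ?_
  rcases Nat.eq_zero_or_pos n with rfl | hn
  · have : (d : ENNReal) ≠ 0 := by exact_mod_cast hd.ne'
    simp [ENNReal.div_zero this]
  · rw [ENNReal.le_div_iff_mul_le (Or.inl (by exact_mod_cast hn.ne')) (Or.inl (by simp)), one_mul]
    exact_mod_cast hnd

theorem annNorm_zero (n : ℕ) (r : ℝ) : annNorm n r (fun _ : Space d => (0 : ℂ)) = 0 :=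
  eLpNorm_zero'

theorem annNorm_sum_le {n : ℕ} (hnd : n ≤ d) (hd : 0 < d) (r : ℝ) {ι : Type*} (s : Finset ι)
    {u : ι → Space d → ℂ} (hu : ∀ j ∈ s, Continuous (u j)) :
    annNorm n r (fun k => ∑ j ∈ s, u j k) ≤ ∑ j ∈ s, annNorm n r (u j) := by
  classical
  induction s using Finset.induction_on with
  | empty => simp [annNorm_zero]
  | insert j s hj ih =>
    simp_rw [Finset.sum_insert hj]
    refine (annNorm_add_le hnd hd r (hu j (Finset.mem_insert_self j s))
      (continuous_finsetSum _ fun l hl => hu l (Finset.mem_insert_of_mem hl))).trans ?_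
    gcongr
    exact ih fun l hl => hu l (Finset.mem_insert_of_mem hl)

theorem annNorm_const_mul (n : ℕ) (r : ℝ) (c : ℂ) (u : Space d → ℂ) :
    annNorm n r (fun k => c * u k) = ENNReal.ofReal ‖c‖ * annNorm n r u := by
  rw [ofReal_norm]
  exact eLpNorm_const_smul c u _ _

/-- Hölder's inequality: the reciprocal exponents a/d and b/d add up to n/d, with order zero
standing for L^∞. -/
theorem annNorm_mul_le (hd : 0 < d) {a b n : ℕ} (hab : a + b = n) (r : ℝ) {u v : Space d → ℂ}
    (hu : Continuous u) (hv : Continuous v) :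
    annNorm n r (fun k => u k * v k) ≤ annNorm a r u * annNorm b r v := by
  have hd0 : (d : ENNReal) ≠ 0 := by exact_mod_cast hd.ne'
  have hinv : ∀ m : ℕ, ((d : ENNReal) / m)⁻¹ = m / d := fun m =>
    ENNReal.inv_div (Or.inl (by simp)) (Or.inr hd0)
  have : ENNReal.HolderTriple ((d : ENNReal) / a) ((d : ENNReal) / b) ((d : ENNReal) / n) :=
    ⟨by rw [hinv, hinv, hinv, ENNReal.div_add_div_same, ← hab]; push_cast; rfl⟩
  have h := eLpNorm_smul_le_mul_eLpNorm (𝕜 := ℂ) (p := (d : ENNReal) / a)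
    (q := (d : ENNReal) / b) (r := (d : ENNReal) / n) (μ := volume.restrict (annulus d r))
    (f := v) (φ := u) hv.aestronglyMeasurable hu.aestronglyMeasurable (hpqr := this)
  exact h

end AnnNorm

/-! ### Derivatives of Ŝ through the Ornstein-Zernike equation -/

section Recursion

variable {d : ℕ}

theorem IsTower.add {i : Fin d} {U V : ℕ → Space d → ℂ} (hU : IsTower i U) (hV : IsTower i V) :
    IsTower i fun n k => U n k + V n k where
  cont n := (hU.cont n).add (hV.cont n)
  periodic n k := by rw [hU.periodic, hV.periodic]
  deriv n k := (hU.deriv n k).add (hV.deriv n k)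

theorem mulTower_eq (U V : ℕ → Space d → ℂ) (n : ℕ) (k : Space d) :
    mulTower U V n k = ∑ j ∈ Finset.range n,
      (n.choose (j + 1) : ℂ) * (U (j + 1) k * V (n - (j + 1)) k) + U 0 k * V n k := by
  rw [mulTower, Finset.Nat.sum_antidiagonal_eq_sum_range_succ_mk, Finset.sum_range_succ']
  simp

theorem fourierTower_zero (i : Fin d) (f : Lattice d → ℝ) (k : Space d) :
    fourierTower i f 0 k = latticeFourier f k := by
  simp [fourierTower]

variable [NeZero d] {S h J : Lattice d → ℝ} {M K ζ : ℝ}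

namespace AssumptionJ

theorem fourier_equation (hM : 0 ≤ M) (hΩ : AssumptionOmega S) (hJ : AssumptionJ M K ζ S h J)
    (k : Space d) :
    latticeFourier S k = latticeFourier h k + latticeFourier J k * latticeFourier S k := by
  have := hJ.fourier_equation_tilt hM hΩ.zero_mem k
  simpa only [tilt_zero] using this

theorem tower_equation (hM : 0 ≤ M) (hΩ : AssumptionOmega S) (hJ : AssumptionJ M K ζ S h J)
    (i : Fin d) (n : ℕ) (k : Space d) :
    fourierTower i S n k =
      fourierTower i h n k + mulTower (fourierTower i J) (fourierTower i S) n k := by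
  have hS := isTower_fourier hΩ.hasMoments i
  refine hS.congr_zero ((isTower_fourier (hJ.hasMoments_h hM hΩ) i).add
    ((isTower_fourier (hJ.hasMoments_J hM hΩ) i).mul hS)) (fun k => ?_) n k
  rw [mulTower_zero, fourierTower_zero, fourierTower_zero, fourierTower_zero]
  exact hJ.fourier_equation hM hΩ k

theorem norm_one_sub_ge (hΩ : AssumptionOmega S) (hJ : AssumptionJ M K ζ S h J)
    {k : Space d} (hk : k ∈ cube d) :
    gap J + K * ‖k‖ ^ 2 ≤ ‖1 - latticeFourier J k‖ := by
  refine le_trans ?_ ((le_abs_self _).trans (Complex.abs_re_le_norm _))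
  have h1 := (hJ.mem_class_zero hΩ).infrared k hk
  rw [latticeFourier_zero, Complex.sub_re, Complex.ofReal_re] at h1
  rw [gap, Complex.sub_re, Complex.one_re]
  linarith

end AssumptionJ

/-- In the Leibniz expansion of Ŝ = ĥ + ĴŜ only the term ĴŜ⁽ⁿ⁾ contains the top derivative of Ŝ.
Moved to the left it produces 1 - Ĵ, of modulus at least Kr² on the annulus. By induction every
other term has size r²·r^{-2} = 1, like the derivative of ĥ. The dimension bound n < d is that of
the estimates for J and h. -/
theorem annNorm_S_le (hM : 0 < M) (hK : 0 < K) (hζ : 0 < ζ) {n : ℕ} (hnd : n < d) :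
    ∃ C, 0 ≤ C ∧ ∀ S h J : Lattice d → ℝ, AssumptionOmega S → AssumptionJ M K ζ S h J →
      ∀ (i : Fin d) (r : ℝ), 0 < r → r ≤ d * Real.pi →
        annNorm n r (fourierTower i S n) ≤ ENNReal.ofReal (C / r ^ 2) := by
  induction n using Nat.strong_induction_on with
  | _ n ih =>
  have hd := dim_pos d
  obtain ⟨Ch, hCh0, hCh⟩ := annNorm_h_le (K := K) hM hζ hnd
  have hCJ : ∀ j : ℕ, ∃ C, 0 ≤ C ∧ (j + 1 ≤ n → ∀ J h : Lattice d → ℝ, HasMoments J →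
      IsSymmetric J → ClassQ M K ζ J h →
      ∀ (i : Fin d) (r : ℝ), 0 < r → r ≤ d * Real.pi →
        annNorm (j + 1) r (fourierTower i J (j + 1)) ≤ ENNReal.ofReal (C * r ^ 2)) := fun j => by
    by_cases hj : j + 1 ≤ n
    · obtain ⟨C, hC0, hC⟩ := annNorm_J_le (K := K) hM hζ (n := j + 1) (d := d) (by omega) (by omega)
      exact ⟨C, hC0, fun _ => hC⟩
    · exact ⟨0, le_rfl, fun h => absurd h hj⟩
  choose CJ hCJ0 hCJ using hCJ
  have hCS : ∀ m : ℕ, ∃ C, 0 ≤ C ∧ (m < n → ∀ S h J : Lattice d → ℝ, AssumptionOmega S →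
      AssumptionJ M K ζ S h J → ∀ (i : Fin d) (r : ℝ), 0 < r → r ≤ d * Real.pi →
        annNorm m r (fourierTower i S m) ≤ ENNReal.ofReal (C / r ^ 2)) := fun m => by
    by_cases hm : m < n
    · obtain ⟨C, hC0, hC⟩ := ih m hm (by omega)
      exact ⟨C, hC0, fun _ => hC⟩
    · exact ⟨0, le_rfl, fun h => absurd h hm⟩
  choose CS hCS0 hCS using hCS
  refine ⟨(Ch + ∑ j ∈ Finset.range n, (n.choose (j + 1) : ℝ) * (CJ j * CS (n - (j + 1)))) / K,
    div_nonneg (add_nonneg hCh0 (Finset.sum_nonneg fun j _ =>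
      mul_nonneg (by positivity) (mul_nonneg (hCJ0 _) (hCS0 _)))) hK.le,
    fun S h J hΩ hJ i r hr hrle => ?_⟩
  have tS := isTower_fourier hΩ.hasMoments i
  have tJ := isTower_fourier (hJ.hasMoments_J hM.le hΩ) i
  have th := isTower_fourier (hJ.hasMoments_h hM.le hΩ) i
  have hQ := hJ.mem_class_zero hΩ
  -- The right side after the term carrying all n derivatives on Ŝ has been moved to the left.
  set R : Space d → ℂ := fun k => fourierTower i h n k + ∑ j ∈ Finset.range n,
      (n.choose (j + 1) : ℂ) * (fourierTower i J (j + 1) k * fourierTower i S (n - (j + 1)) k)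
    with hR
  have hRS : ∀ k, (1 - latticeFourier J k) * fourierTower i S n k = R k := fun k => by
    have h1 := hJ.tower_equation hM.le hΩ i n k
    rw [mulTower_eq, fourierTower_zero] at h1
    rw [hR]
    linear_combination h1
  have hterm : ∀ j ∈ Finset.range n, annNorm n r (fun k => (n.choose (j + 1) : ℂ) *
      (fourierTower i J (j + 1) k * fourierTower i S (n - (j + 1)) k)) ≤
      ENNReal.ofReal ((n.choose (j + 1) : ℝ) * (CJ j * CS (n - (j + 1)))) := by
    intro j hj
    have hjn : j + 1 ≤ n := Finset.mem_range.1 hj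
    rw [annNorm_const_mul, ENNReal.ofReal_mul (by positivity), Complex.norm_natCast]
    gcongr
    refine (annNorm_mul_le hd (a := j + 1) (b := n - (j + 1)) (by omega) r (tJ.cont _)
      (tS.cont _)).trans ?_
    refine (mul_le_mul' (hCJ j hjn J h (hJ.hasMoments_J hM.le hΩ) hJ.symmetric_J hQ i r hr hrle)
      (hCS _ (by omega) S h J hΩ hJ i r hr hrle)).trans (le_of_eq ?_)
    rw [← ENNReal.ofReal_mul (mul_nonneg (hCJ0 _) (by positivity))]
    congr 1
    field_simp
  have hRb : annNorm n r R ≤ ENNReal.ofReal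
      (Ch + ∑ j ∈ Finset.range n, (n.choose (j + 1) : ℝ) * (CJ j * CS (n - (j + 1)))) := by
    have hc : ∀ j ∈ Finset.range n, Continuous fun k => (n.choose (j + 1) : ℂ) *
        (fourierTower i J (j + 1) k * fourierTower i S (n - (j + 1)) k) := fun j _ =>
      continuous_const.mul ((tJ.cont _).mul (tS.cont _))
    refine (annNorm_add_le hnd.le hd r (th.cont n) (continuous_finsetSum _ hc)).trans ?_
    rw [ENNReal.ofReal_add hCh0 (Finset.sum_nonneg fun j _ =>
      mul_nonneg (by positivity) (mul_nonneg (hCJ0 _) (hCS0 _))),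
      ENNReal.ofReal_sum_of_nonneg fun j _ =>
        mul_nonneg (by positivity) (mul_nonneg (hCJ0 _) (hCS0 _))]
    gcongr
    · exact hCh J h (hJ.hasMoments_h hM.le hΩ) hQ i r hr hrle
    · exact (annNorm_sum_le hnd.le hd r _ hc).trans (Finset.sum_le_sum hterm)
  have hcmp : annNorm n r (fourierTower i S n) ≤
      annNorm n r (fun k => (((K * r ^ 2)⁻¹ : ℝ) : ℂ) * R k) := by
    refine annNorm_mono fun k hk => ?_
    rw [← hRS k, norm_mul, norm_mul, Complex.norm_real, Real.norm_of_nonneg (by positivity),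
      ← mul_assoc]
    refine le_mul_of_one_le_left (norm_nonneg _) ?_
    rw [inv_mul_eq_div, le_div_iff₀ (by positivity), one_mul]
    refine le_trans ?_ (hJ.norm_one_sub_ge hΩ hk.1)
    have h1 := hJ.gap_pos hM.le hΩ
    have h2 : r ^ 2 ≤ ‖k‖ ^ 2 := pow_le_pow_left₀ hr.le hk.2.1.le 2
    nlinarith
  refine hcmp.trans ?_
  rw [annNorm_const_mul, Complex.norm_real, Real.norm_of_nonneg (by positivity)]
  refine (mul_le_mul' le_rfl hRb).trans (le_of_eq ?_)
  rw [← ENNReal.ofReal_mul (by positivity)]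
  congr 1
  field_simp

end Recursion

/-! ### The periodic heat-kernel cutoff and its derivatives -/

section Cutoff

/-- One factor of the lattice heat kernel in Fourier space. -/
noncomputable def heatFactor (T t : ℝ) : ℝ := Real.exp (-(T * (1 - Real.cos t)))

theorem contDiff_heatFactor (T : ℝ) (n : WithTop ℕ∞) : ContDiff ℝ n (heatFactor T) := by
  unfold heatFactor; fun_prop

theorem heatFactor_pos (T t : ℝ) : 0 < heatFactor T t := Real.exp_pos _

theorem deriv_heatFactor (T : ℝ) :
    deriv (heatFactor T) = fun t => (-T * Real.sin t) * heatFactor T t := by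
  ext t
  have h1 : HasDerivAt (fun t => -(T * (1 - Real.cos t))) (-(T * Real.sin t)) t := by
    have := (((Real.hasDerivAt_cos t).const_sub 1).const_mul T).fun_neg
    simpa using this
  rw [show heatFactor T = fun t => Real.exp (-(T * (1 - Real.cos t))) from rfl, h1.exp.deriv]
  ring

/-- Apply Leibniz to G' = -T sin(t) G. The undifferentiated sine is at most κ and its derivatives
are at most 1 ≤ ρ(ρ/κ)^j, so that every term scales like a power of 1/κ. The separate factor Tκ²,
produced by the first derivative, is what makes 1 - heat small at low frequency. -/
theorem abs_iteratedDeriv_heatFactor_succ (T : ℝ) (hT : 0 < T) (n : ℕ) {ρ : ℝ} (hρ : 1 ≤ ρ)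
    {C : ℕ → ℝ} {κ t : ℝ} (hκ : 0 < κ) (hκρ : κ ≤ ρ) (ht : |t| ≤ κ)
    (hC : ∀ m ≤ n, 0 ≤ C m ∧ |iteratedDeriv m (heatFactor T) t| ≤
      C m * (κ ^ m)⁻¹ * (1 + T * κ ^ 2) ^ m * heatFactor T t) :
    |iteratedDeriv (n + 1) (heatFactor T) t| ≤
      (∑ j ∈ Finset.range (n + 1), (n.choose j : ℝ) * ρ ^ j * C (n - j)) * (κ ^ (n + 1))⁻¹ *
        (T * κ ^ 2 * (1 + T * κ ^ 2) ^ n) * heatFactor T t := by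
  have hG := heatFactor_pos T t
  rw [iteratedDeriv_succ', deriv_heatFactor,
    iteratedDeriv_fun_mul (by fun_prop) (contDiff_heatFactor T n).contDiffAt, Finset.sum_mul,
    Finset.sum_mul, Finset.sum_mul]
  refine (Finset.abs_sum_le_sum_abs _ _).trans (Finset.sum_le_sum fun j hj => ?_)
  have hjn : j ≤ n := by simpa [Nat.lt_succ_iff] using hj
  obtain ⟨hC0, hCb⟩ := hC (n - j) (by omega)
  have hsin : |iteratedDeriv j (fun t => -T * Real.sin t) t| ≤ T * (ρ ^ j * (κ * (κ ^ j)⁻¹)) := by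
    rw [iteratedDeriv_const_mul_field, abs_mul, abs_neg, abs_of_pos hT]
    refine mul_le_mul_of_nonneg_left ?_ hT.le
    rcases j with _ | j
    · simp only [iteratedDeriv_zero, pow_zero, one_mul, inv_one, mul_one]
      exact (Real.abs_sin_le_abs).trans ht
    · refine (Real.abs_iteratedDeriv_sin_le_one (j + 1) t).trans ?_
      have : ρ ^ (j + 1) * (κ * (κ ^ (j + 1))⁻¹) = ρ * (ρ ^ j / κ ^ j) := by
        field_simp; ring
      rw [this]
      have h1 : 1 ≤ ρ ^ j / κ ^ j := by
        rw [one_le_div (by positivity)]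
        exact pow_le_pow_left₀ hκ.le hκρ j
      nlinarith
  have hP : 1 ≤ 1 + T * κ ^ 2 := by have : 0 < T * κ ^ 2 := by positivity
                                    linarith
  rw [abs_mul, abs_mul, Nat.abs_cast]
  calc (n.choose j : ℝ) * |iteratedDeriv j (fun t => -T * Real.sin t) t| *
        |iteratedDeriv (n - j) (heatFactor T) t|
      ≤ (n.choose j : ℝ) * (T * (ρ ^ j * (κ * (κ ^ j)⁻¹))) *
        (C (n - j) * (κ ^ (n - j))⁻¹ * (1 + T * κ ^ 2) ^ n * heatFactor T t) := by
        gcongr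
        refine hCb.trans ?_
        gcongr
        omega
    _ = _ := by
        have : κ ^ n = κ ^ j * κ ^ (n - j) := by rw [← pow_add]; congr 1; omega
        rw [pow_succ κ n, this]
        field_simp

theorem abs_iteratedDeriv_heatFactor {ρ : ℝ} (hρ : 1 ≤ ρ) (n : ℕ) :
    ∃ C, 0 ≤ C ∧ ∀ T κ t : ℝ, 0 < T → 0 < κ → κ ≤ ρ → |t| ≤ κ →
      |iteratedDeriv n (heatFactor T) t| ≤
        C * (κ ^ n)⁻¹ * (1 + T * κ ^ 2) ^ n * heatFactor T t := by
  induction n using Nat.strong_induction_on with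
  | _ n ih =>
  rcases n with _ | n
  · refine ⟨1, zero_le_one, fun T κ t _ _ _ _ => ?_⟩
    simp [abs_of_pos (heatFactor_pos T t)]
  · have h : ∀ m : ℕ, ∃ C, 0 ≤ C ∧ (m ≤ n → ∀ T κ t : ℝ, 0 < T → 0 < κ → κ ≤ ρ → |t| ≤ κ →
        |iteratedDeriv m (heatFactor T) t| ≤
          C * (κ ^ m)⁻¹ * (1 + T * κ ^ 2) ^ m * heatFactor T t) := fun m => by
      by_cases hm : m ≤ n
      · obtain ⟨C, h0, h1⟩ := ih m (by omega)
        exact ⟨C, h0, fun _ => h1⟩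
      · exact ⟨0, le_rfl, fun h => absurd h hm⟩
    choose C hC0 hC using h
    have hnn : 0 ≤ ∑ j ∈ Finset.range (n + 1), (n.choose j : ℝ) * ρ ^ j * C (n - j) :=
      Finset.sum_nonneg fun j _ => mul_nonneg (by positivity) (hC0 _)
    refine ⟨_, hnn, fun T κ t hT hκ hκρ ht => ?_⟩
    refine (abs_iteratedDeriv_heatFactor_succ T hT n hρ (C := C) hκ hκρ ht fun m hm =>
      ⟨hC0 m, hC m hm T κ t hT hκ hκρ ht⟩).trans ?_
    have hG := heatFactor_pos T t
    gcongr
    rw [pow_succ (1 + T * κ ^ 2) n, mul_comm (T * κ ^ 2)]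
    have : 0 < T * κ ^ 2 := by positivity
    gcongr
    linarith

theorem abs_iteratedDeriv_heatFactor' {ρ : ℝ} (hρ : 1 ≤ ρ) (n : ℕ) :
    ∃ C, 0 ≤ C ∧ ∀ T κ t : ℝ, 0 < T → 0 < κ → κ ≤ ρ → |t| ≤ κ →
      |iteratedDeriv (n + 1) (heatFactor T) t| ≤
        C * (κ ^ (n + 1))⁻¹ * (T * κ ^ 2 * (1 + T * κ ^ 2) ^ n) * heatFactor T t := by
  choose C hC0 hC using fun m => abs_iteratedDeriv_heatFactor hρ m
  exact ⟨_, Finset.sum_nonneg fun j _ => mul_nonneg (by positivity) (hC0 _),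
    fun T κ t hT hκ hκρ ht => abs_iteratedDeriv_heatFactor_succ T hT n hρ (C := C) hκ hκρ ht
      fun m _ => ⟨hC0 m, hC m T κ t hT hκ hκρ ht⟩⟩

variable {d : ℕ}

/-- The heat kernel cutoff `exp(-T ∑ⱼ (1 - cos kⱼ))`. -/
noncomputable def heat (T : ℝ) (k : Space d) : ℝ := ∏ j, heatFactor T (k j)

/-- The derivatives of the heat kernel cutoff in direction `i`. -/
noncomputable def heatTower (T : ℝ) (i : Fin d) (n : ℕ) (k : Space d) : ℂ :=
  (((∏ j ∈ Finset.univ.erase i, heatFactor T (k j)) *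
    iteratedDeriv n (heatFactor T) (k i) : ℝ) : ℂ)

theorem heatTower_zero (T : ℝ) (i : Fin d) (k : Space d) : heatTower T i 0 k = heat T k := by
  rw [heatTower, heat, iteratedDeriv_zero, mul_comm,
    Finset.mul_prod_erase _ (fun j => heatFactor T (k j)) (Finset.mem_univ i)]

theorem add_smul_unitVec_self (k : Space d) (t : ℝ) (i : Fin d) :
    (k + t • unitVec i) i = k i + t := by simp [unitVec]

theorem add_smul_unitVec_of_ne (k : Space d) (t : ℝ) {i j : Fin d} (hj : j ≠ i) :
    (k + t • unitVec i) j = k j := by simp [unitVec, hj]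

theorem isTower_heat (T : ℝ) (i : Fin d) : IsTower i (heatTower T i) where
  cont n := by
    unfold heatTower
    refine Complex.continuous_ofReal.comp (Continuous.mul ?_ ?_)
    · refine continuous_finsetProd _ fun j _ => ?_
      exact (contDiff_heatFactor T 0).continuous.comp (by fun_prop)
    · exact ((contDiff_heatFactor T n).continuous_iteratedDeriv n le_rfl).comp (by fun_prop)
  periodic n k := by
    have hper : ∀ t, iteratedDeriv n (heatFactor T) (t + 2 * Real.pi) =
        iteratedDeriv n (heatFactor T) t := fun t => by
      have h := congrFun (iteratedDeriv_comp_add_const n (heatFactor T) (2 * Real.pi)) t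
      rw [← h]
      congr 1
      ext s
      simp [heatFactor]
    rw [heatTower, heatTower, add_smul_unitVec_self, hper]
    congr 2
    exact Finset.prod_congr rfl fun j hj => by
      rw [add_smul_unitVec_of_ne _ _ (Finset.ne_of_mem_erase hj)]
  deriv n k := by
    have h1 : HasDerivAt (fun t : ℝ => iteratedDeriv n (heatFactor T) (k i + t))
        (iteratedDeriv (n + 1) (heatFactor T) (k i)) 0 := by
      have h2 : DifferentiableAt ℝ (iteratedDeriv n (heatFactor T)) (k i) :=
        ((contDiff_heatFactor T (n + 1)).differentiable_iteratedDeriv n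
          (by exact_mod_cast Nat.lt_succ_self n)).differentiableAt
      have h3 := h2.hasDerivAt
      rw [← iteratedDeriv_succ] at h3
      have h4 : HasDerivAt (iteratedDeriv n (heatFactor T))
          (iteratedDeriv (n + 1) (heatFactor T) (k i)) (k i + 0) := by rwa [add_zero]
      exact h4.comp_const_add (k i) 0
    have h2 := (h1.const_mul (∏ j ∈ Finset.univ.erase i, heatFactor T (k j))).ofReal_comp
    refine h2.congr_of_eventuallyEq (Eventually.of_forall fun t => ?_)
    simp only [heatTower]
    rw [add_smul_unitVec_self]
    congr 2
    exact Finset.prod_congr rfl fun j hj => by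
      rw [add_smul_unitVec_of_ne _ _ (Finset.ne_of_mem_erase hj)]

theorem heat_pos (T : ℝ) (k : Space d) : 0 < heat T k :=
  Finset.prod_pos fun j _ => heatFactor_pos T (k j)

theorem heat_eq (T : ℝ) (k : Space d) : heat T k = Real.exp (-(T * ∑ j, (1 - Real.cos (k j)))) := by
  rw [heat, Finset.mul_sum, ← Finset.sum_neg_distrib, Real.exp_sum]
  rfl

theorem heat_le {T : ℝ} (hT : 0 ≤ T) {k : Space d} (hk : k ∈ cube d) :
    heat T k ≤ Real.exp (-(2 / Real.pi ^ 2 * (T * ‖k‖ ^ 2))) := by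
  rw [heat_eq]
  refine Real.exp_le_exp.2 (neg_le_neg ?_)
  rw [norm_sq_space]
  have : 2 / Real.pi ^ 2 * (T * ∑ j, k j * k j) = T * ∑ j, 2 / Real.pi ^ 2 * k j ^ 2 := by
    rw [← Finset.mul_sum]; simp_rw [sq]; ring
  rw [this]
  refine mul_le_mul_of_nonneg_left (Finset.sum_le_sum fun j _ => ?_) hT
  linarith [Real.cos_le_one_sub_mul_cos_sq (hk j)]

/-- With P = T‖k‖², the left side is at most min(1, P), which is at most 2P/(1 + P). -/
theorem one_sub_heat_le {T : ℝ} (hT : 0 ≤ T) (k : Space d) :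
    1 - heat T k ≤ 2 * (T * ‖k‖ ^ 2 / (1 + T * ‖k‖ ^ 2)) := by
  have hP : 0 ≤ T * ‖k‖ ^ 2 := by positivity
  have h1 : 1 - heat T k ≤ T * ‖k‖ ^ 2 := by
    have h2 := Real.add_one_le_exp (-(T * ∑ j, (1 - Real.cos (k j))))
    rw [← heat_eq] at h2
    have h3 : T * ∑ j, (1 - Real.cos (k j)) ≤ T * ‖k‖ ^ 2 := by
      rw [norm_sq_space]
      refine mul_le_mul_of_nonneg_left (Finset.sum_le_sum fun j _ => ?_) hT
      have := Real.one_sub_sq_div_two_le_cos (x := k j)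
      nlinarith [mul_self_nonneg (k j)]
    linarith
  have h2 := heat_pos T k
  have hpos : 0 < 1 + T * ‖k‖ ^ 2 := by linarith
  rw [← mul_div_assoc, le_div_iff₀ hpos]
  rcases le_total (T * ‖k‖ ^ 2) 1 with h | h
  · rcases le_total (1 - heat T k) 0 with h0 | h0 <;> nlinarith
  · nlinarith

theorem pow_mul_exp_le (n : ℕ) {c : ℝ} (hc : 0 < c) :
    ∃ C, 0 ≤ C ∧ ∀ P : ℝ, 0 ≤ P → (1 + P) ^ n * Real.exp (-(c * P)) ≤ C := by
  refine ⟨n.factorial / c ^ n * Real.exp c, by positivity, fun P hP => ?_⟩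
  have h := Real.pow_div_factorial_le_exp (c * (1 + P)) (by positivity) n
  rw [mul_pow, div_le_iff₀ (by positivity)] at h
  have h2 : Real.exp (c * (1 + P)) = Real.exp c * Real.exp (c * P) := by
    rw [← Real.exp_add]; ring_nf
  rw [Real.exp_neg, ← div_eq_mul_inv, div_le_iff₀ (Real.exp_pos _), div_mul_eq_mul_div,
    div_mul_eq_mul_div, le_div_iff₀ (by positivity)]
  rw [h2] at h
  linarith

/-- The tower of the complementary cutoff `1 - heat`. -/
noncomputable def coheatTower (T : ℝ) (i : Fin d) (n : ℕ) (k : Space d) : ℂ :=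
  (if n = 0 then 1 else 0) - heatTower T i n k

theorem isTower_coheat (T : ℝ) (i : Fin d) : IsTower i (coheatTower T i) where
  cont n := continuous_const.sub ((isTower_heat T i).cont n)
  periodic n k := by rw [coheatTower, coheatTower, (isTower_heat T i).periodic]
  deriv n k := by
    have := ((isTower_heat T i).deriv n k).const_sub (if n = 0 then 1 else 0)
    simpa [coheatTower] using this

/-- For positive order the Gaussian decay of the cutoff absorbs the powers of 1 + T‖k‖² produced by
differentiation, with one power to spare; that spare power supplies the denominator 1 + T‖k‖². The
scale κ of the one-variable bounds is taken to be ‖k‖. -/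
theorem norm_coheatTower_le (hd : 0 < d) (n : ℕ) :
    ∃ C, 0 ≤ C ∧ ∀ (i : Fin d) (T : ℝ), 0 < T → ∀ k ∈ cube d, k ≠ 0 →
      ‖coheatTower T i n k‖ ≤ C * (‖k‖ ^ n)⁻¹ * (T * ‖k‖ ^ 2 / (1 + T * ‖k‖ ^ 2)) := by
  rcases n with _ | n
  · refine ⟨2, by norm_num, fun i T hT k _ _ => ?_⟩
    have h1 : heat T k ≤ 1 := by
      rw [heat_eq]
      refine Real.exp_le_one_iff.2 (neg_nonpos.2 (mul_nonneg hT.le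
        (Finset.sum_nonneg fun j _ => ?_)))
      linarith [Real.cos_le_one (k j)]
    have e : coheatTower T i 0 k = ((1 - heat T k : ℝ) : ℂ) := by
      simp [coheatTower, heatTower_zero]
    rw [e, Complex.norm_real, Real.norm_of_nonneg (by linarith), pow_zero, inv_one, mul_one]
    exact one_sub_heat_le hT.le k
  · have hd1 : (1 : ℝ) ≤ d := by exact_mod_cast hd
    have hρ : 1 ≤ (d : ℝ) * Real.pi := by nlinarith [Real.pi_gt_three]
    obtain ⟨C, hC0, hC⟩ := abs_iteratedDeriv_heatFactor' hρ n
    obtain ⟨C', hC'0, hC'⟩ := pow_mul_exp_le (n + 1) (c := 2 / Real.pi ^ 2) (by positivity)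
    refine ⟨C * C', by positivity, fun i T hT k hk hk0 => ?_⟩
    have hκ : 0 < ‖k‖ := norm_pos_iff.2 hk0
    have hP : 0 < T * ‖k‖ ^ 2 := by positivity
    have h1 := hC T ‖k‖ (k i) hT hκ (norm_le_of_mem_cube hk) (PiLp.norm_apply_le k i)
    have h2 := hC' (T * ‖k‖ ^ 2) hP.le
    have h3 := heat_le hT.le hk
    have hprod : 0 ≤ ∏ j ∈ Finset.univ.erase i, heatFactor T (k j) :=
      Finset.prod_nonneg fun j _ => (heatFactor_pos T _).le
    have e : ‖coheatTower T i (n + 1) k‖ = (∏ j ∈ Finset.univ.erase i, heatFactor T (k j)) *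
        |iteratedDeriv (n + 1) (heatFactor T) (k i)| := by
      rw [coheatTower, if_neg (Nat.succ_ne_zero n), zero_sub, norm_neg, heatTower,
        Complex.norm_real, Real.norm_eq_abs, abs_mul, abs_of_nonneg hprod]
    rw [e]
    have e2 : heat T k = (∏ j ∈ Finset.univ.erase i, heatFactor T (k j)) * heatFactor T (k i) := by
      rw [heat, mul_comm, Finset.mul_prod_erase _ (fun j => heatFactor T (k j)) (Finset.mem_univ i)]
    have e3 : (1 + T * ‖k‖ ^ 2) ^ n * heat T k ≤ C' / (1 + T * ‖k‖ ^ 2) := by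
      rw [le_div_iff₀ (by positivity)]
      refine le_trans ?_ h2
      rw [pow_succ (1 + T * ‖k‖ ^ 2) n]
      calc (1 + T * ‖k‖ ^ 2) ^ n * heat T k * (1 + T * ‖k‖ ^ 2)
          = (1 + T * ‖k‖ ^ 2) ^ n * (1 + T * ‖k‖ ^ 2) * heat T k := by ring
        _ ≤ _ := by gcongr
    calc (∏ j ∈ Finset.univ.erase i, heatFactor T (k j)) *
          |iteratedDeriv (n + 1) (heatFactor T) (k i)|
        ≤ (∏ j ∈ Finset.univ.erase i, heatFactor T (k j)) * (C * (‖k‖ ^ (n + 1))⁻¹ *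
          (T * ‖k‖ ^ 2 * (1 + T * ‖k‖ ^ 2) ^ n) * heatFactor T (k i)) := by gcongr
      _ = C * (‖k‖ ^ (n + 1))⁻¹ * (T * ‖k‖ ^ 2) * ((1 + T * ‖k‖ ^ 2) ^ n * heat T k) := by
          rw [e2]; ring
      _ ≤ C * (‖k‖ ^ (n + 1))⁻¹ * (T * ‖k‖ ^ 2) * (C' / (1 + T * ‖k‖ ^ 2)) := by gcongr
      _ = _ := by ring

theorem annNorm_coheat_le (hd : 0 < d) {n : ℕ} (hn : n ≤ d) :
    ∃ C, 0 ≤ C ∧ ∀ (i : Fin d) (T r : ℝ), 0 < T → 0 < r →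
      annNorm n r (coheatTower T i n) ≤ ENNReal.ofReal (C * (T * r ^ 2 / (1 + T * r ^ 2))) := by
  obtain ⟨C, hC0, hC⟩ := norm_coheatTower_le hd n
  have hv := one_le_annConst (d := d)
  refine ⟨annConst d * (C * 4), by positivity, fun i T r hT hr => ?_⟩
  refine (annNorm_le_of_bound hd hn hr
    (B := C * (r ^ n)⁻¹ * (4 * (T * r ^ 2 / (1 + T * r ^ 2)))) (by positivity) fun k hk => ?_).trans
    (le_of_eq (by congr 1; field_simp))
  have hk0 : k ≠ 0 := by
    rintro rfl
    have := hk.2.1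
    rw [norm_zero] at this; linarith
  have hκ : 0 < ‖k‖ := norm_pos_iff.2 hk0
  refine (hC i T hT k hk.1 hk0).trans ?_
  have h1 : r ^ n ≤ ‖k‖ ^ n := pow_le_pow_left₀ hr.le hk.2.1.le n
  have h2 : r ^ 2 ≤ ‖k‖ ^ 2 := pow_le_pow_left₀ hr.le hk.2.1.le 2
  have h3 : ‖k‖ ^ 2 ≤ 4 * r ^ 2 := by
    calc ‖k‖ ^ 2 ≤ (2 * r) ^ 2 := pow_le_pow_left₀ hκ.le hk.2.2 2
      _ = _ := by ring
  gcongr ?_ * ?_ * ?_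
  · exact inv_anti₀ (by positivity) h1
  · rw [← mul_div_assoc]
    gcongr ?_ / ?_
    · nlinarith
    · nlinarith

end Cutoff

/-! ### The high-frequency contribution -/

section Tail

variable {d : ℕ}

/-- Each term is at most six times a difference f(u) - f(u/2) with f(u) = u/(1 + u), so the sum
telescopes and f ≤ 1 bounds it. -/
theorem sum_dyadic_le {y : ℝ} (hy : 0 < y) (n : ℕ) :
    ∑ m ∈ Finset.range n, (y / 2 ^ m) / (1 + (y / 2 ^ m) ^ 2) ≤ 6 := by
  have key : ∀ u : ℝ, 0 < u → u / (1 + u ^ 2) ≤ 6 * (u / (1 + u) - u / 2 / (1 + u / 2)) := by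
    intro u hu
    have e : 6 * (u / (1 + u) - u / 2 / (1 + u / 2)) = 6 * u / ((1 + u) * (2 + u)) := by
      field_simp; ring
    rw [e, div_le_div_iff₀ (by positivity) (by positivity)]
    nlinarith [sq_nonneg (u - 1), mul_pos hu hu]
  have h : ∀ n : ℕ, ∑ m ∈ Finset.range n, (y / 2 ^ m) / (1 + (y / 2 ^ m) ^ 2) ≤
      6 * (y / (1 + y) - y / 2 ^ n / (1 + y / 2 ^ n)) := by
    intro n
    induction n with
    | zero => simp
    | succ n ih =>
      rw [Finset.sum_range_succ]
      have h2 := key (y / 2 ^ n) (by positivity)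
      have e : y / 2 ^ n / 2 = y / 2 ^ (n + 1) := by rw [pow_succ, div_div]
      rw [e] at h2
      linarith
  have h1 : y / (1 + y) ≤ 1 := by rw [div_le_one (by positivity)]; linarith
  have h2 : 0 ≤ y / 2 ^ n / (1 + y / 2 ^ n) := by positivity
  linarith [h n]

theorem cube_subset_iUnion (hd : 0 < d) :
    cube d ⊆ {0} ∪ ⋃ m : ℕ, annulus d (d * Real.pi / 2 / 2 ^ m) := by
  intro k hk
  rcases eq_or_ne k 0 with h0 | h0
  · exact Or.inl h0
  have hρ : 0 < (d : ℝ) * Real.pi := by positivity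
  obtain ⟨m, hm1, hm2⟩ := exists_nat_pow_near_of_lt_one (x := ‖k‖ / (d * Real.pi))
    (y := (1 / 2 : ℝ)) (div_pos (norm_pos_iff.2 h0) hρ)
    ((div_le_one hρ).2 (norm_le_of_mem_cube hk)) (by norm_num) (by norm_num)
  refine Or.inr (Set.mem_iUnion.2 ⟨m, hk, ?_, ?_⟩)
  · rw [lt_div_iff₀ hρ] at hm1
    refine lt_of_eq_of_lt ?_ hm1
    rw [pow_succ, one_div, inv_pow]; field_simp
  · rw [div_le_iff₀ hρ] at hm2
    refine hm2.trans (le_of_eq ?_)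
    rw [one_div, inv_pow]; field_simp

/-- From bounds on dyadic annuli to a bound on the fundamental domain. -/
theorem lintegral_cube_le (hd : 0 < d) {C : ℝ} (hC : 0 ≤ C) {T : ℝ} (hT : 0 < T)
    {u : Space d → ℂ}
    (h : ∀ r, 0 < r → r ≤ d * Real.pi →
      annNorm d r u ≤ ENNReal.ofReal (C * (T * r / (1 + T * r ^ 2)))) :
    ∫⁻ k in cube d, ‖u k‖ₑ ≤ ENNReal.ofReal (6 * C * √T) := by
  have hd0 : (d : ENNReal) ≠ 0 := by exact_mod_cast hd.ne'
  have hρ : 0 < (d : ℝ) * Real.pi := by positivity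
  have : Nonempty (Fin d) := ⟨⟨0, hd⟩⟩
  have hann : ∀ r, annNorm d r u = ∫⁻ k in annulus d r, ‖u k‖ₑ := fun r => by
    rw [annNorm, ENNReal.div_self hd0 (by simp), eLpNorm_one_eq_lintegral_enorm]
  calc ∫⁻ k in cube d, ‖u k‖ₑ
      ≤ ∫⁻ k in {0} ∪ ⋃ m : ℕ, annulus d (d * Real.pi / 2 / 2 ^ m), ‖u k‖ₑ :=
        lintegral_mono_set (cube_subset_iUnion hd)
    _ ≤ (∫⁻ k in ({0} : Set (Space d)), ‖u k‖ₑ) +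
        ∫⁻ k in ⋃ m : ℕ, annulus d (d * Real.pi / 2 / 2 ^ m), ‖u k‖ₑ := lintegral_union_le _ _ _
    _ = ∫⁻ k in ⋃ m : ℕ, annulus d (d * Real.pi / 2 / 2 ^ m), ‖u k‖ₑ := by
        rw [setLIntegral_measure_zero _ _ (measure_singleton 0), zero_add]
    _ ≤ ∑' m : ℕ, ∫⁻ k in annulus d (d * Real.pi / 2 / 2 ^ m), ‖u k‖ₑ := lintegral_iUnion_le _ _
    _ ≤ ENNReal.ofReal (6 * C * √T) := by
        refine ENNReal.tsum_le_of_sum_range_le fun n => ?_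
        have hT2 : √T ^ 2 = T := Real.sq_sqrt hT.le
        have hT0 : 0 < √T := Real.sqrt_pos.2 hT
        -- With u = √T r, the bound Tr/(1 + Tr²) equals √T · u/(1 + u²), the summand of
        -- `sum_dyadic_le`.
        have hterm : ∀ m : ℕ, ∫⁻ k in annulus d (d * Real.pi / 2 / 2 ^ m), ‖u k‖ₑ ≤
            ENNReal.ofReal (C * √T * ((√T * (d * Real.pi / 2)) / 2 ^ m /
              (1 + ((√T * (d * Real.pi / 2)) / 2 ^ m) ^ 2))) := fun m => by
          rw [← hann]
          refine (h _ (by positivity) ?_).trans (le_of_eq ?_)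
          · rw [div_div]
            refine div_le_self hρ.le ?_
            have : (1 : ℝ) ≤ 2 ^ m := one_le_pow₀ (by norm_num)
            linarith
          · congr 1
            rw [mul_assoc]
            congr 1
            have e : (√T * (d * Real.pi / 2)) / 2 ^ m = √T * (d * Real.pi / 2 / 2 ^ m) := by ring
            have e2 : ∀ a D : ℝ, √T * (√T * a / D) = √T ^ 2 * a / D := fun a D => by ring
            rw [e, mul_pow, e2, hT2]
        refine (Finset.sum_le_sum fun m _ => hterm m).trans ?_
        rw [← ENNReal.ofReal_sum_of_nonneg fun m _ => by positivity, ← Finset.mul_sum]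
        refine ENNReal.ofReal_le_ofReal ?_
        have := sum_dyadic_le (y := √T * (d * Real.pi / 2)) (by positivity) n
        calc _ ≤ C * √T * 6 := by gcongr
          _ = _ := by ring

theorem annNorm_mulTower_le {d : ℕ} (hd : 0 < d) {n : ℕ} (hn : n ≤ d) (r : ℝ)
    {U V : ℕ → Space d → ℂ} (hU : ∀ m, Continuous (U m)) (hV : ∀ m, Continuous (V m))
    {a b : ℕ → ℝ} {α β γ : ℝ} (ha : ∀ m, 0 ≤ a m) (hb : ∀ m, 0 ≤ b m) (hα : 0 ≤ α) (hγ : 0 ≤ γ)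
    (hαβ : α * β = γ)
    (hUa : ∀ m ≤ n, annNorm m r (U m) ≤ ENNReal.ofReal (a m * α))
    (hVb : ∀ m ≤ n, annNorm m r (V m) ≤ ENNReal.ofReal (b m * β)) :
    annNorm n r (mulTower U V n) ≤ ENNReal.ofReal ((∑ p ∈ Finset.HasAntidiagonal.antidiagonal n,
      (n.choose p.1 : ℝ) * (a p.1 * b p.2)) * γ) := by
  have hsum := annNorm_sum_le hn hd r (Finset.HasAntidiagonal.antidiagonal n)
    (u := fun p k => (n.choose p.1 : ℂ) * (U p.1 k * V p.2 k))
    fun p _ => continuous_const.mul ((hU _).mul (hV _))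
  have e : mulTower U V n = fun k => ∑ p ∈ Finset.HasAntidiagonal.antidiagonal n,
      (n.choose p.1 : ℂ) * (U p.1 k * V p.2 k) := rfl
  rw [e]
  refine hsum.trans ?_
  rw [Finset.sum_mul, ENNReal.ofReal_sum_of_nonneg fun p _ =>
    mul_nonneg (mul_nonneg (by positivity) (mul_nonneg (ha _) (hb _))) hγ]
  refine Finset.sum_le_sum fun p hp => ?_
  have hp' : p.1 + p.2 = n := Finset.HasAntidiagonal.mem_antidiagonal.1 hp
  rw [annNorm_const_mul, Complex.norm_natCast, mul_assoc ((n.choose p.1 : ℕ) : ℝ),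
    ENNReal.ofReal_mul (by positivity)]
  refine mul_le_mul_right ?_ _
  refine (annNorm_mul_le hd hp' r (hU _) (hV _)).trans ?_
  refine (mul_le_mul' (hUa p.1 (by omega)) (hVb p.2 (by omega))).trans (le_of_eq ?_)
  rw [← ENNReal.ofReal_mul (mul_nonneg (ha _) hα), ← hαβ]
  congr 1
  ring

variable [NeZero d] {M K ζ : ℝ}

theorem lintegral_coheat_mul_S_le (hM : 0 < M) (hK : 0 < K) (hζ : 0 < ζ) :
    ∃ C, 0 ≤ C ∧ ∀ S h J : Lattice d → ℝ, AssumptionOmega S → AssumptionJ M K ζ S h J →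
      ∀ (i : Fin d) (T : ℝ), 0 < T →
        ∫⁻ k in cube d, ‖mulTower (coheatTower T i) (fourierTower i S) (d - 1) k‖ₑ ≤
          ENNReal.ofReal (C * √T) := by
  have hd := dim_pos d
  have hv := one_le_annConst (d := d)
  have hS : ∀ m : ℕ, ∃ C, 0 ≤ C ∧ (m < d → ∀ S h J : Lattice d → ℝ, AssumptionOmega S →
      AssumptionJ M K ζ S h J → ∀ (i : Fin d) (r : ℝ), 0 < r → r ≤ d * Real.pi →
        annNorm m r (fourierTower i S m) ≤ ENNReal.ofReal (C / r ^ 2)) := fun m => by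
    by_cases hm : m < d
    · obtain ⟨C, hC0, hC⟩ := annNorm_S_le (d := d) hM hK hζ hm
      exact ⟨C, hC0, fun _ => hC⟩
    · exact ⟨0, le_rfl, fun h => absurd h hm⟩
  choose CS hCS0 hCS using hS
  have hE : ∀ m : ℕ, ∃ C, 0 ≤ C ∧ (m ≤ d → ∀ (i : Fin d) (T r : ℝ), 0 < T → 0 < r →
      annNorm m r (coheatTower T i m) ≤
        ENNReal.ofReal (C * (T * r ^ 2 / (1 + T * r ^ 2)))) := fun m => by
    by_cases hm : m ≤ d
    · obtain ⟨C, hC0, hC⟩ := annNorm_coheat_le (d := d) hd hm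
      exact ⟨C, hC0, fun _ => hC⟩
    · exact ⟨0, le_rfl, fun h => absurd h hm⟩
  choose CE hCE0 hCE using hE
  obtain ⟨B, hB⟩ : ∃ B : ℝ, B = ∑ p ∈ Finset.HasAntidiagonal.antidiagonal (d - 1),
    ((d - 1).choose p.1 : ℝ) * (CE p.1 * CS p.2) := ⟨_, rfl⟩
  have hB0 : 0 ≤ B := hB ▸ Finset.sum_nonneg fun p _ =>
    mul_nonneg (by positivity) (mul_nonneg (hCE0 _) (hCS0 _))
  refine ⟨6 * (annConst d * B), by positivity, fun S h J hΩ hJ i T hT => ?_⟩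
  have tS := isTower_fourier hΩ.hasMoments i
  have tE := isTower_coheat T i
  refine lintegral_cube_le hd (by positivity) hT fun r hr hrle => ?_
  -- The constant one is treated as a factor of order one: it raises the product from L^{d/(d-1)} to
  -- L¹ on the annulus at the price of a factor r.
  have hone : annNorm 1 r (fun _ : Space d => (1 : ℂ)) ≤ ENNReal.ofReal (annConst d * r) := by
    refine (annNorm_le_of_bound hd hd hr zero_le_one fun k _ => by simp).trans
      (le_of_eq (by congr 1; ring))
  have hV : annNorm (d - 1) r (mulTower (coheatTower T i) (fourierTower i S) (d - 1)) ≤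
      ENNReal.ofReal (B * (T / (1 + T * r ^ 2))) := by
    rw [hB]
    refine annNorm_mulTower_le hd (Nat.sub_le d 1) r tE.cont tS.cont (α := T * r ^ 2 / (1 + T * r ^ 2))
      (β := 1 / r ^ 2) hCE0 hCS0 (by positivity) (by positivity) (by field_simp)
      (fun m hm => hCE m (by omega) i T r hT hr) fun m hm => ?_
    rw [mul_one_div]
    exact hCS m (by omega) S h J hΩ hJ i r hr hrle
  have h1 := annNorm_mul_le hd (a := 1) (b := d - 1) (n := d) (by omega) r
    (continuous_const (y := (1 : ℂ))) ((tE.mul tS).cont (d - 1))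
  simp only [one_mul] at h1
  refine h1.trans ((mul_le_mul' hone hV).trans (le_of_eq ?_))
  rw [← ENNReal.ofReal_mul (by positivity)]
  congr 1
  ring

/-- The contribution of large frequencies is small. -/
theorem tail_bound (hM : 0 < M) (hK : 0 < K) (hζ : 0 < ζ) :
    ∃ C, 0 ≤ C ∧ ∀ S h J : Lattice d → ℝ, AssumptionOmega S → AssumptionJ M K ζ S h J →
      ∀ (x : Lattice d) (T : ℝ), 0 < T → x ≠ 0 →
        ‖∫ k in cube d, ((1 - heat T k : ℝ) : ℂ) * latticeFourier S k * chr k (-x)‖ ≤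
          C * √T / ‖toSpace x‖ ^ (d - 1) := by
  obtain ⟨C, hC0, hC⟩ := lintegral_coheat_mul_S_le (d := d) hM hK hζ
  have hd := dim_pos d
  have hd' : (0 : ℝ) < d := by exact_mod_cast hd
  refine ⟨d ^ (d - 1) * C, by positivity, fun S h J hΩ hJ x T hT hx => ?_⟩
  have hx0 : 0 < ‖toSpace x‖ := lt_of_lt_of_le one_pos (one_le_norm_toSpace hx)
  have : Nonempty (Fin d) := ⟨⟨0, hd⟩⟩
  -- The largest coordinate satisfies |x| ≤ d|x_i|, so derivatives in this one direction suffice to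
  -- gain |x|^{-(d-1)}.
  obtain ⟨i, hi⟩ := Finite.exists_max (fun i => |(x i : ℝ)|)
  have h1 : ‖toSpace x‖ ≤ d * |(x i : ℝ)| := by
    refine (norm_toSpace_le_sum x).trans ((Finset.sum_le_sum fun j _ => hi j).trans ?_)
    simp
  have tS := isTower_fourier hΩ.hasMoments i
  have tV := (isTower_coheat T i).mul tS
  have hibp := tV.integral_mul_chr x (d - 1)
  have e0 : ∀ k, mulTower (coheatTower T i) (fourierTower i S) 0 k =
      ((1 - heat T k : ℝ) : ℂ) * latticeFourier S k := fun k => by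
    rw [mulTower_zero, fourierTower_zero, coheatTower, heatTower_zero]; simp
  simp_rw [e0] at hibp
  set I := ∫ k in cube d, ((1 - heat T k : ℝ) : ℂ) * latticeFourier S k * chr k (-x) with hI
  have hnorm : |(x i : ℝ)| ^ (d - 1) * ‖I‖ ≤ C * √T := by
    have h2 : ‖∫ k in cube d, mulTower (coheatTower T i) (fourierTower i S) (d - 1) k *
        chr k (-x)‖ = |(x i : ℝ)| ^ (d - 1) * ‖I‖ := by
      rw [hibp, norm_mul, norm_pow, norm_neg, norm_mul, Complex.norm_I, one_mul]
      congr 2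
      rw [← Complex.ofReal_intCast, Complex.norm_real, Real.norm_eq_abs]
    rw [← h2]
    have h3 : ‖∫ k in cube d, mulTower (coheatTower T i) (fourierTower i S) (d - 1) k *
        chr k (-x)‖ₑ ≤ ENNReal.ofReal (C * √T) := by
      refine (enorm_integral_le_lintegral_enorm _).trans
        (le_trans (le_of_eq ?_) (hC S h J hΩ hJ i T hT))
      refine lintegral_congr fun k => ?_
      rw [enorm_mul, ← ofReal_norm (chr k (-x)), norm_chr]; simp
    rw [← ofReal_norm] at h3
    exact (ENNReal.ofReal_le_ofReal_iff (by positivity)).1 h3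
  rw [le_div_iff₀ (by positivity)]
  calc ‖I‖ * ‖toSpace x‖ ^ (d - 1) ≤ ‖I‖ * (d * |(x i : ℝ)|) ^ (d - 1) := by gcongr
    _ = d ^ (d - 1) * (|(x i : ℝ)| ^ (d - 1) * ‖I‖) := by rw [mul_pow]; ring
    _ ≤ d ^ (d - 1) * (C * √T) := by gcongr
    _ = _ := by ring

end Tail

/-! ### The continuum Green function and its Fourier representation -/

section Continuum

variable {d : ℕ} {s : ℝ}

/-- The heat kernel average `∫₀^∞ p_{t + τ}(x) exp(-t s² / 2) dt` at `|x| = 1`. -/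
noncomputable def smoothGreen (d : ℕ) (s τ : ℝ) : ℝ :=
  ∫ t in Set.Ioi (0 : ℝ),
    1 / (2 * Real.pi * (t + τ)) ^ ((d : ℝ) / 2) * Real.exp (-(1 / (2 * (t + τ)))) *
      Real.exp (-(1 / 2) * t * s ^ 2)

theorem massiveGreen_eq {x : Space d} (hx : ‖x‖ = 1) :
    massiveGreen s x = smoothGreen d s 0 := by
  simp [massiveGreen, smoothGreen, hx]

/-- Convergence at large times comes from the exponential if s > 0, and from the power -d/2 < -1 if
s = 0, which forces d > 2. -/
theorem integrableOn_decay (hs : 0 ≤ s) (hs' : d ≤ 2 → 0 < s) {c : ℝ} (hc : 0 < c) :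
    IntegrableOn (fun t : ℝ => (t + c) ^ (-((d : ℝ) / 2)) * Real.exp (-(1 / 2) * t * s ^ 2))
      (Set.Ioi 0) := by
  have hcont : ContinuousOn
      (fun t : ℝ => (t + c) ^ (-((d : ℝ) / 2)) * Real.exp (-(1 / 2) * t * s ^ 2)) (Set.Ioi 0) := by
    refine ContinuousOn.mul (ContinuousOn.rpow_const (by fun_prop) fun t ht => Or.inl ?_)
      (by fun_prop)
    have : (0 : ℝ) < t := ht
    positivity
  have hmeas := hcont.aestronglyMeasurable (μ := volume) measurableSet_Ioi
  rcases hs.eq_or_lt with h0 | h0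
  · have hd : 2 < d := by
      by_contra h
      exact absurd (hs' (by omega)) (by simp [← h0])
    have hd' : (2 : ℝ) < d := by exact_mod_cast hd
    have := integrableOn_add_rpow_Ioi_of_lt (a := -((d : ℝ) / 2)) (c := 0) (m := c)
      (by linarith) (by linarith)
    simpa [← h0] using this
  · have h1 : IntegrableOn (fun t : ℝ => c ^ (-((d : ℝ) / 2)) * Real.exp (-(1 / 2 * s ^ 2) * t))
        (Set.Ioi 0) := (exp_neg_integrableOn_Ioi 0 (by positivity)).const_mul _
    refine Integrable.mono' h1 hmeas ((ae_restrict_iff' measurableSet_Ioi).2 (ae_of_all _ ?_))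
    intro t ht
    have ht0 : (0 : ℝ) < t := ht
    rw [Real.norm_of_nonneg (by positivity)]
    have e : -(1 / 2) * t * s ^ 2 = -(1 / 2 * s ^ 2) * t := by ring
    rw [e]
    refine mul_le_mul_of_nonneg_right ?_ (Real.exp_nonneg _)
    exact Real.rpow_le_rpow_of_nonpos hc (by linarith) (neg_nonpos.2 (by positivity))

/-- The Gaussian factor removes the singularity at u = 0: 1 + u ≤ 1 + du ≤ du e^{1/(du)} by e^y ≥ 1
+ y, and the power d/2 turns the exponential into e^{1/(2u)}. The bound is uniform in the shift τ,
which allows τ → 0. -/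
theorem heatKernel_le (hd : 0 < d) {u : ℝ} (hu : 0 < u) :
    1 / (2 * Real.pi * u) ^ ((d : ℝ) / 2) * Real.exp (-(1 / (2 * u))) ≤
      (d : ℝ) ^ ((d : ℝ) / 2) * (u + 1) ^ (-((d : ℝ) / 2)) := by
  have hd' : (1 : ℝ) ≤ d := by exact_mod_cast hd
  have hd0 : (0 : ℝ) < d := by linarith
  have hp : (0 : ℝ) ≤ (d : ℝ) / 2 := by positivity
  have h1 : (1 + u) ^ ((d : ℝ) / 2) ≤
      (d : ℝ) ^ ((d : ℝ) / 2) * u ^ ((d : ℝ) / 2) * Real.exp (1 / (2 * u)) := by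
    have e : Real.exp (1 / (2 * u)) = (Real.exp (1 / (d * u))) ^ ((d : ℝ) / 2) := by
      rw [← Real.exp_mul]; congr 1; field_simp
    rw [e, ← Real.mul_rpow hd0.le hu.le, ← Real.mul_rpow (by positivity) (by positivity)]
    refine Real.rpow_le_rpow (by positivity) ?_ hp
    have h2 := Real.add_one_le_exp (1 / (d * u))
    calc 1 + u ≤ 1 + d * u := by nlinarith
      _ = d * u * (1 / (d * u) + 1) := by field_simp
      _ ≤ _ := by gcongr
  have h3 : u ^ ((d : ℝ) / 2) ≤ (2 * Real.pi * u) ^ ((d : ℝ) / 2) := by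
    refine Real.rpow_le_rpow hu.le ?_ hp
    have := Real.pi_gt_three
    nlinarith
  have hu0 : 0 < u ^ ((d : ℝ) / 2) := by positivity
  rw [Real.rpow_neg (by positivity), Real.exp_neg, ← div_eq_mul_inv, ← div_eq_mul_inv, div_div,
    div_le_div_iff₀ (by positivity) (by positivity), one_mul, add_comm u 1]
  calc (1 + u) ^ ((d : ℝ) / 2) ≤ _ := h1
    _ = (d : ℝ) ^ ((d : ℝ) / 2) * (u ^ ((d : ℝ) / 2) * Real.exp (1 / (2 * u))) := by ring
    _ ≤ _ := by gcongr

theorem continuousOn_heatKernel {τ : ℝ} (hτ : 0 ≤ τ) : ContinuousOn (fun t : ℝ =>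
    1 / (2 * Real.pi * (t + τ)) ^ ((d : ℝ) / 2) * Real.exp (-(1 / (2 * (t + τ)))) *
      Real.exp (-(1 / 2) * t * s ^ 2)) (Set.Ioi 0) := by
  have hpos : ∀ t ∈ Set.Ioi (0 : ℝ), 0 < t + τ := fun t ht => by
    have : (0 : ℝ) < t := ht
    linarith
  refine ContinuousOn.mul (ContinuousOn.mul (ContinuousOn.div continuousOn_const
    (ContinuousOn.rpow_const (by fun_prop) fun t ht => Or.inl ?_) fun t ht => ?_)
    (ContinuousOn.rexp (ContinuousOn.neg (ContinuousOn.div continuousOn_const (by fun_prop)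
    fun t ht => ?_)))) (by fun_prop)
  · have := hpos t ht; positivity
  · have := hpos t ht; positivity
  · have := hpos t ht; positivity

theorem norm_heatKernel_le (hd : 0 < d) {τ t : ℝ} (hτ : 0 ≤ τ) (ht : 0 < t) :
    ‖1 / (2 * Real.pi * (t + τ)) ^ ((d : ℝ) / 2) * Real.exp (-(1 / (2 * (t + τ)))) *
      Real.exp (-(1 / 2) * t * s ^ 2)‖ ≤ (d : ℝ) ^ ((d : ℝ) / 2) *
        ((t + 1) ^ (-((d : ℝ) / 2)) * Real.exp (-(1 / 2) * t * s ^ 2)) := by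
  have h0 : 0 < t + τ := by linarith
  rw [Real.norm_of_nonneg (by positivity), ← mul_assoc]
  refine mul_le_mul_of_nonneg_right ((heatKernel_le hd h0).trans ?_) (Real.exp_nonneg _)
  refine mul_le_mul_of_nonneg_left ?_ (by positivity)
  exact Real.rpow_le_rpow_of_nonpos (by positivity) (by linarith) (neg_nonpos.2 (by positivity))

theorem tendsto_smoothGreen (hd : 0 < d) (hs : 0 ≤ s) (hs' : d ≤ 2 → 0 < s) :
    Tendsto (fun τ => smoothGreen d s τ) (𝓝[>] 0) (𝓝 (smoothGreen d s 0)) := by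
  refine tendsto_integral_filter_of_dominated_convergence
    (fun t => (d : ℝ) ^ ((d : ℝ) / 2) *
        ((t + 1) ^ (-((d : ℝ) / 2)) * Real.exp (-(1 / 2) * t * s ^ 2))) ?_ ?_
    ((integrableOn_decay hs hs' one_pos).const_mul _) ?_
  · filter_upwards [self_mem_nhdsWithin] with τ hτ
    exact (continuousOn_heatKernel (le_of_lt hτ)).aestronglyMeasurable measurableSet_Ioi
  · filter_upwards [self_mem_nhdsWithin] with τ hτ
    exact (ae_restrict_iff' measurableSet_Ioi).2
      (ae_of_all _ fun t ht => norm_heatKernel_le hd (le_of_lt hτ) ht)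
  · refine (ae_restrict_iff' measurableSet_Ioi).2 (ae_of_all _ fun t ht => ?_)
    have ht0 : (0 : ℝ) < t := ht
    refine tendsto_nhdsWithin_of_tendsto_nhds (ContinuousAt.tendsto ?_)
    refine ContinuousAt.mul (ContinuousAt.mul (ContinuousAt.div continuousAt_const
      (ContinuousAt.rpow_const (by fun_prop) (Or.inl ?_)) ?_)
      (ContinuousAt.rexp (ContinuousAt.neg (ContinuousAt.div continuousAt_const (by fun_prop)
      ?_)))) continuousAt_const
    all_goals rw [add_zero]; positivity

theorem smoothGreen_pos (hd : 0 < d) (hs : 0 ≤ s) (hs' : d ≤ 2 → 0 < s) :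
    0 < smoothGreen d s 0 := by
  have hint : IntegrableOn (fun t : ℝ =>
      1 / (2 * Real.pi * (t + 0)) ^ ((d : ℝ) / 2) * Real.exp (-(1 / (2 * (t + 0)))) *
        Real.exp (-(1 / 2) * t * s ^ 2)) (Set.Ioi 0) :=
    Integrable.mono' ((integrableOn_decay hs hs' one_pos).const_mul _)
      ((continuousOn_heatKernel le_rfl).aestronglyMeasurable measurableSet_Ioi)
      ((ae_restrict_iff' measurableSet_Ioi).2
        (ae_of_all _ fun t ht => norm_heatKernel_le hd le_rfl ht))
  have hpos : ∀ t ∈ Set.Ioi (0 : ℝ), 0 <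
      1 / (2 * Real.pi * (t + 0)) ^ ((d : ℝ) / 2) * Real.exp (-(1 / (2 * (t + 0)))) *
        Real.exp (-(1 / 2) * t * s ^ 2) := fun t ht => by
    have ht0 : (0 : ℝ) < t := ht
    rw [add_zero]; positivity
  refine (setIntegral_pos_iff_support_of_nonneg_ae ((ae_restrict_iff' measurableSet_Ioi).2
    (ae_of_all _ fun t ht => (hpos t ht).le)) hint).2 ?_
  refine lt_of_lt_of_le (b := volume (Set.Ioi (0 : ℝ))) (by simp) (measure_mono fun t ht => ?_)
  exact ⟨(hpos t ht).ne', ht⟩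

/-- The integrand whose two iterated integrals give the Fourier representation. -/
noncomputable def heatWave (s τ : ℝ) (v : Space d) (t : ℝ) (ξ : Space d) : ℂ :=
  ((Real.exp (-(1 / 2) * t * s ^ 2) : ℝ) : ℂ) *
    Complex.exp (-(((t + τ) / 2 : ℝ) : ℂ) * (‖ξ‖ : ℂ) ^ 2 + Complex.I * ((inner ℝ v ξ : ℝ) : ℂ))

theorem norm_heatWave (s τ : ℝ) (v : Space d) (t : ℝ) (ξ : Space d) :
    ‖heatWave s τ v t ξ‖ =
      Real.exp (-(1 / 2) * t * s ^ 2) * Real.exp (-((t + τ) / 2) * ‖ξ‖ ^ 2) := by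
  rw [heatWave, norm_mul, Complex.norm_real, Complex.norm_exp, Real.norm_of_nonneg (by positivity)]
  congr 2
  simp [← Complex.ofReal_pow]

theorem continuous_heatWave (s τ : ℝ) (v : Space d) :
    Continuous (Function.uncurry (heatWave s τ v)) := by
  unfold heatWave Function.uncurry
  fun_prop

/-- The Gaussian integral over ξ leaves a multiple of (t + τ)^{-d/2}; the shift τ > 0 keeps this
integrable near t = 0. -/
theorem integrable_heatWave (hs : 0 ≤ s) (hs' : d ≤ 2 → 0 < s) {τ : ℝ} (hτ : 0 < τ)
    (v : Space d) : Integrable (Function.uncurry (heatWave s τ v))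
      ((volume.restrict (Set.Ioi (0 : ℝ))).prod volume) := by
  refine (integrable_prod_iff (continuous_heatWave s τ v).aestronglyMeasurable).2 ⟨?_, ?_⟩
  · refine (ae_restrict_iff' measurableSet_Ioi).2 (ae_of_all _ fun t ht => ?_)
    have ht0 : (0 : ℝ) < t := ht
    exact (GaussianFourier.integrable_cexp_neg_mul_sq_norm_add (b := (((t + τ) / 2 : ℝ) : ℂ))
      (by rw [Complex.ofReal_re]; positivity) Complex.I v).const_mul
        ((Real.exp (-(1 / 2) * t * s ^ 2) : ℝ) : ℂ)
  · refine IntegrableOn.congr_fun (f := fun t : ℝ => (2 * Real.pi) ^ ((d : ℝ) / 2) *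
      ((t + τ) ^ (-((d : ℝ) / 2)) * Real.exp (-(1 / 2) * t * s ^ 2)))
      ((integrableOn_decay hs hs' hτ).const_mul _) (fun t ht => ?_) measurableSet_Ioi
    have ht0 : (0 : ℝ) < t := ht
    have h0 : 0 < t + τ := by linarith
    simp only [Function.uncurry_apply_pair, norm_heatWave]
    rw [integral_const_mul, GaussianFourier.integral_rexp_neg_mul_sq_norm (by positivity),
      finrank_euclideanSpace_fin]
    have e : Real.pi / ((t + τ) / 2) = 2 * Real.pi * (t + τ)⁻¹ := by field_simp
    rw [e, Real.mul_rpow (x := 2 * Real.pi) (by positivity) (by positivity), Real.inv_rpow h0.le,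
      Real.rpow_neg h0.le]
    ring

theorem integral_heatWave_left {τ : ℝ} (v ξ : Space d) (hξ : ξ ≠ 0) :
    ∫ t in Set.Ioi (0 : ℝ), heatWave s τ v t ξ =
      ((Real.exp (-(τ / 2) * ‖ξ‖ ^ 2) * (2 / (s ^ 2 + ‖ξ‖ ^ 2)) : ℝ) : ℂ) *
        Complex.exp (Complex.I * ((inner ℝ v ξ : ℝ) : ℂ)) := by
  have hξ0 : 0 < ‖ξ‖ := norm_pos_iff.2 hξ
  have e : ∀ t : ℝ, heatWave s τ v t ξ =
      ((Real.exp (-((s ^ 2 + ‖ξ‖ ^ 2) / 2) * t) : ℝ) : ℂ) *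
        (((Real.exp (-(τ / 2) * ‖ξ‖ ^ 2) : ℝ) : ℂ) *
          Complex.exp (Complex.I * ((inner ℝ v ξ : ℝ) : ℂ))) := fun t => by
    rw [heatWave, Complex.ofReal_exp, Complex.ofReal_exp, Complex.ofReal_exp, ← Complex.exp_add,
      ← Complex.exp_add, ← Complex.exp_add]
    congr 1
    push_cast
    ring
  simp_rw [e]
  rw [integral_mul_const, integral_complex_ofReal,
    integral_exp_mul_Ioi (a := -((s ^ 2 + ‖ξ‖ ^ 2) / 2)) (neg_lt_zero.2 (by positivity))]
  have e2 : -Real.exp (-((s ^ 2 + ‖ξ‖ ^ 2) / 2) * 0) / -((s ^ 2 + ‖ξ‖ ^ 2) / 2) =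
      2 / (s ^ 2 + ‖ξ‖ ^ 2) := by
    rw [mul_zero, Real.exp_zero]; field_simp
  rw [e2]
  push_cast
  ring

theorem integral_heatWave_right {τ t : ℝ} (ht : 0 < t + τ) {v : Space d} (hv : ‖v‖ = 1) :
    ∫ ξ, heatWave s τ v t ξ = (2 * (Real.pi : ℂ)) ^ d *
      ((1 / (2 * Real.pi * (t + τ)) ^ ((d : ℝ) / 2) * Real.exp (-(1 / (2 * (t + τ)))) *
        Real.exp (-(1 / 2) * t * s ^ 2) : ℝ) : ℂ) := by
  unfold heatWave
  rw [integral_const_mul, GaussianFourier.integral_cexp_neg_mul_sq_norm_add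
    (by rw [Complex.ofReal_re]; positivity), finrank_euclideanSpace_fin, hv]
  have e1 : ((Real.pi : ℂ) / (((t + τ) / 2 : ℝ) : ℂ)) ^ ((d : ℂ) / 2) =
      (((Real.pi / ((t + τ) / 2)) ^ ((d : ℝ) / 2) : ℝ) : ℂ) := by
    rw [Complex.ofReal_cpow (by positivity)]
    push_cast
    rfl
  have e2 : Complex.exp (Complex.I ^ 2 * ((1 : ℝ) : ℂ) ^ 2 / (4 * (((t + τ) / 2 : ℝ) : ℂ))) =
      ((Real.exp (-(1 / (2 * (t + τ)))) : ℝ) : ℂ) := by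
    rw [Complex.ofReal_exp, Complex.I_sq]
    congr 1
    have : (t : ℂ) + τ ≠ 0 := by exact_mod_cast ht.ne'
    push_cast
    field_simp
    norm_num
  have e3 : (Real.pi / ((t + τ) / 2)) ^ ((d : ℝ) / 2) =
      (2 * Real.pi) ^ d * (1 / (2 * Real.pi * (t + τ)) ^ ((d : ℝ) / 2)) := by
    have h1 : (2 * Real.pi) ^ d = (2 * Real.pi) ^ ((d : ℝ) / 2) * (2 * Real.pi) ^ ((d : ℝ) / 2) := by
      rw [← Real.rpow_add (by positivity), add_halves, Real.rpow_natCast]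
    have h2 : Real.pi / ((t + τ) / 2) = 2 * Real.pi / (t + τ) := by field_simp
    rw [h1, h2, Real.div_rpow (by positivity) ht.le, Real.mul_rpow (by positivity) ht.le]
    have h3 : 0 < (2 * Real.pi) ^ ((d : ℝ) / 2) := by positivity
    have h4 : 0 < (t + τ) ^ ((d : ℝ) / 2) := by positivity
    field_simp
  rw [e1, e2, e3]
  push_cast
  ring

theorem integral_heatWave_left_ae (hd : 0 < d) {τ : ℝ} (v : Space d) :
    (fun ξ => ∫ t in Set.Ioi (0 : ℝ), heatWave s τ v t ξ) =ᵐ[volume] fun ξ =>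
      ((Real.exp (-(τ / 2) * ‖ξ‖ ^ 2) * (2 / (s ^ 2 + ‖ξ‖ ^ 2)) : ℝ) : ℂ) *
        Complex.exp (Complex.I * ((inner ℝ v ξ : ℝ) : ℂ)) := by
  have : Nonempty (Fin d) := ⟨⟨0, hd⟩⟩
  have h0 : ∀ᵐ ξ : Space d, ξ ≠ 0 := by
    simp [ae_iff, measure_singleton]
  filter_upwards [h0] with ξ hξ
  exact integral_heatWave_left v ξ hξ

/-- This comes from Fubini at v = 0: integrating an integrable function of (t, ξ) over t leaves an
integrable function of ξ. It covers s = 0, where the origin is singular. -/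
theorem integrable_resolvent (hd : 0 < d) (hs : 0 ≤ s) (hs' : d ≤ 2 → 0 < s) {τ : ℝ}
    (hτ : 0 < τ) : Integrable fun ξ : Space d =>
      Real.exp (-(τ / 2) * ‖ξ‖ ^ 2) * (2 / (s ^ 2 + ‖ξ‖ ^ 2)) := by
  have h := (integrable_heatWave hs hs' hτ (0 : Space d)).integral_prod_right
  have h2 := (h.congr (integral_heatWave_left_ae hd 0)).re
  refine h2.congr (ae_of_all _ fun ξ => ?_)
  simp only [inner_zero_left, Complex.ofReal_zero, mul_zero, Complex.exp_zero, mul_one]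
  exact Complex.ofReal_re _

/-- Write 2/(s² + ‖ξ‖²) as the time integral of e^{-t(s² + ‖ξ‖²)/2} and exchange the integrals; the
inner Gaussian integral is the heat kernel at time t + τ. -/
theorem integral_resolvent (hd : 0 < d) (hs : 0 ≤ s) (hs' : d ≤ 2 → 0 < s) {τ : ℝ} (hτ : 0 < τ)
    {v : Space d} (hv : ‖v‖ = 1) :
    ∫ ξ : Space d, ((Real.exp (-(τ / 2) * ‖ξ‖ ^ 2) * (2 / (s ^ 2 + ‖ξ‖ ^ 2)) : ℝ) : ℂ) *
        Complex.exp (Complex.I * ((inner ℝ v ξ : ℝ) : ℂ)) =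
      (2 * (Real.pi : ℂ)) ^ d * (smoothGreen d s τ : ℂ) := by
  rw [← integral_congr_ae (integral_heatWave_left_ae hd v),
    ← integral_integral_swap (integrable_heatWave hs hs' hτ v),
    smoothGreen, ← integral_complex_ofReal, ← integral_const_mul]
  refine setIntegral_congr_fun measurableSet_Ioi fun t ht => ?_
  have ht0 : (0 : ℝ) < t := ht
  exact integral_heatWave_right (by linarith) hv

end Continuum

/-! ### Behaviour of ĥ and of the cutoff near the origin -/

section FourierLimits

variable {d : ℕ}

theorem latticeFourier_im {f : Lattice d → ℝ} (hs : IsSymmetric f) (k : Space d) :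
    (latticeFourier f k).im = 0 := by
  refine Complex.conj_eq_iff_im.1 ?_
  rw [conj_latticeFourier, latticeFourier_eq, ← (Equiv.neg (Lattice d)).tsum_eq]
  refine tsum_congr fun y => ?_
  simp [hs.neg]

/-- Both bounds |e^{-iθ} - 1| ≤ |θ| and ≤ 2 combine to 2|θ|^b for 0 < b ≤ 1. Only the moment of
order ζ enters, so the continuity of ĥ at 0 is uniform in z. -/
theorem norm_latticeFourier_sub_zero_le {f : Lattice d → ℝ} {M ζ b : ℝ} (hM : 0 ≤ M)
    (hf : Summable f) (hb : 0 < b) (hb1 : b ≤ 1) (hbζ : b ≤ ζ)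
    (hf2 : latticeNorm 1 (fun y => ‖toSpace y‖ ^ ζ * f y) ≤ ENNReal.ofReal M) (k : Space d) :
    ‖latticeFourier f k - latticeFourier f 0‖ ≤ 2 * M * ‖k‖ ^ b := by
  obtain ⟨hs1, hb2⟩ := lattice_one_bound hM hf2
  rw [latticeFourier_eq, latticeFourier_eq,
    ← (summable_mul_chr hf k).tsum_sub (summable_mul_chr hf 0)]
  refine (tsum_of_norm_bounded (hs1.hasSum.mul_left (2 * ‖k‖ ^ b)) fun y => ?_).trans ?_
  · rw [chr_zero_left, ← mul_sub, norm_mul, Complex.norm_real, Real.norm_eq_abs, abs_mul,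
      abs_of_nonneg (show 0 ≤ ‖toSpace y‖ ^ ζ by positivity)]
    rcases eq_or_ne y 0 with rfl | hy
    · have : chr k (0 : Lattice d) = 1 := by simp [chr]
      rw [this]; simp; positivity
    · have h1 := norm_chr_sub_one_le k y
      have h2 : ‖chr k y - 1‖ ≤ 2 := by
        refine (norm_sub_le _ _).trans ?_
        rw [norm_chr]; norm_num
      have h3 : ‖toSpace y‖ ^ b ≤ ‖toSpace y‖ ^ ζ :=
        Real.rpow_le_rpow_of_exponent_le (one_le_norm_toSpace hy) hbζ
      have h4 : ‖chr k y - 1‖ ≤ 2 * (‖k‖ * ‖toSpace y‖) ^ b := by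
        rcases le_total (‖k‖ * ‖toSpace y‖) 1 with h | h
        · have := Real.rpow_le_rpow_of_exponent_ge' (by positivity) h hb.le hb1
          rw [Real.rpow_one] at this
          have h0 : 0 ≤ (‖k‖ * ‖toSpace y‖) ^ b := by positivity
          linarith
        · have := Real.one_le_rpow h hb.le
          linarith
      rw [Real.mul_rpow (by positivity) (by positivity)] at h4
      calc |f y| * ‖chr k y - 1‖ ≤ |f y| * (2 * (‖k‖ ^ b * ‖toSpace y‖ ^ ζ)) := by
            gcongr
            exact h4.trans (by gcongr)
        _ = _ := by ring
  · have : 0 ≤ ‖k‖ ^ b := by positivity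
    nlinarith

theorem tendsto_sq_mul_one_sub_cos (t : ℝ) :
    Tendsto (fun R : ℝ => R ^ 2 * (1 - Real.cos (R⁻¹ * t))) atTop (𝓝 (t ^ 2 / 2)) := by
  have h0 : Tendsto (fun R : ℝ => 3 * |t| ^ (2 + 1 : ℝ) * R⁻¹) atTop (𝓝 0) := by
    simpa using tendsto_inv_atTop_zero.const_mul (3 * |t| ^ (2 + 1 : ℝ))
  rw [tendsto_iff_norm_sub_tendsto_zero]
  refine squeeze_zero' (Eventually.of_forall fun _ => norm_nonneg _) ?_ h0
  filter_upwards [eventually_gt_atTop 0] with R hR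
  have h := abs_cos_taylor zero_le_one le_rfl (R⁻¹ * t)
  have e : R ^ 2 * (1 - Real.cos (R⁻¹ * t)) - t ^ 2 / 2 =
      R ^ 2 * (1 - Real.cos (R⁻¹ * t) - (R⁻¹ * t) ^ 2 / 2) := by field_simp
  rw [e, Real.norm_eq_abs, abs_mul, abs_of_pos (by positivity : 0 < R ^ 2)]
  have e2 : 3 * |t| ^ (2 + 1 : ℝ) * R⁻¹ = R ^ 2 * (3 * |R⁻¹ * t| ^ (2 + 1 : ℝ)) := by
    rw [abs_mul, abs_of_pos (by positivity : 0 < R⁻¹),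
      Real.mul_rpow (by positivity) (abs_nonneg _)]
    have : R⁻¹ ^ (2 + 1 : ℝ) = (R⁻¹) ^ 3 := by
      rw [← Real.rpow_natCast]; norm_num
    rw [this]
    field_simp
  rw [e2]
  refine mul_le_mul_of_nonneg_left (h.trans ?_) (by positivity)
  have : 0 ≤ |R⁻¹ * t| ^ (2 + 1 : ℝ) := by positivity
  linarith

theorem tendsto_heat (τ : ℝ) (ξ : Space d) :
    Tendsto (fun R : ℝ => heat (τ * R ^ 2) (R⁻¹ • ξ)) atTop
      (𝓝 (Real.exp (-(τ / 2) * ‖ξ‖ ^ 2))) := by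
  have e : ∀ R : ℝ, heat (τ * R ^ 2) (R⁻¹ • ξ) =
      Real.exp (-(τ * ∑ j, R ^ 2 * (1 - Real.cos (R⁻¹ * ξ j)))) := fun R => by
    rw [heat_eq, ← Finset.mul_sum, mul_assoc]
    simp
  simp_rw [e]
  have e2 : -(τ / 2) * ‖ξ‖ ^ 2 = -(τ * ∑ j, ξ j ^ 2 / 2) := by
    rw [norm_sq_space, ← Finset.sum_div]
    simp_rw [sq]; ring
  rw [e2]
  exact (Real.continuous_exp.tendsto _).comp
    ((tendsto_finsetSum _ fun j _ => tendsto_sq_mul_one_sub_cos (ξ j)).const_mul τ).neg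

theorem eventually_inv_smul_mem_cube (ξ : Space d) : ∀ᶠ R : ℝ in atTop, R⁻¹ • ξ ∈ cube d := by
  have h : ∀ i, ∀ᶠ R : ℝ in atTop, |R⁻¹ * ξ i| ≤ Real.pi := fun i => by
    have : Tendsto (fun R : ℝ => |R⁻¹ * ξ i|) atTop (𝓝 0) := by
      simpa using (tendsto_inv_atTop_zero.mul_const (ξ i)).abs
    exact this.eventually_le_const Real.pi_pos
  filter_upwards [eventually_all.2 h] with R hR i
  simpa using hR i

end FourierLimits

/-! ### Scaling limits of the mass, the gap and the denominator -/

section Scaling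

variable {d : ℕ} [NeZero d] {M K ζ s : ℝ} {β : Type*} {L : Filter β}
  {S h J : β → Lattice d → ℝ} {x : β → Lattice d}

theorem tendsto_mass_mul_norm (hM : 0 ≤ M) (hK : 0 < K) (hζ : 0 < ζ)
    (hΩ : ∀ᶠ i in L, AssumptionOmega (S i))
    (hJ : ∀ᶠ i in L, AssumptionJ M K ζ (S i) (h i) (J i))
    (hm : Tendsto (fun i => mass (S i)) L (𝓝 0))
    (hmx : Tendsto (fun i => mass (S i) * massNorm (S i) (toSpace (x i))) L (𝓝 s)) :
    Tendsto (fun i => mass (S i) * ‖toSpace (x i)‖) L (𝓝 s) := by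
  obtain ⟨C, hC⟩ : ∃ C, C = 3 * M * ((d : ℝ) ^ 3 + 1) / K := ⟨_, rfl⟩
  have ha : 0 < min ζ 1 := by positivity
  have hma : Tendsto (fun i => C * mass (S i) ^ min ζ 1) L (𝓝 0) := by
    have := (hm.rpow_const (p := min ζ 1) (Or.inr ha.le)).const_mul C
    rwa [Real.zero_rpow ha.ne', mul_zero] at this
  have hlim : Tendsto (fun i => C * mass (S i) ^ min ζ 1 *
      (2 * (mass (S i) * massNorm (S i) (toSpace (x i))))) L (𝓝 0) := by
    have := hma.mul (hmx.const_mul 2)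
    rwa [zero_mul] at this
  have hdiff : Tendsto (fun i => mass (S i) * massNorm (S i) (toSpace (x i)) -
      mass (S i) * ‖toSpace (x i)‖) L (𝓝 0) := by
    refine squeeze_zero_norm' ?_ hlim
    -- Once the relative error C m^a is at most 1/2, m‖x‖ is at most 2m|x|_S, which converges; this
    -- closes the estimate without prior control of m‖x‖.
    filter_upwards [hΩ, hJ, hma.eventually_le_const (show (0 : ℝ) < 1 / 2 by norm_num)]
      with i hΩi hJi hi
    have hb := hJi.massNorm_bound hM hK hζ hΩi (toSpace (x i))
    have hm0 := hΩi.mass_edge.1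
    rw [← hC, Real.rpow_add hm0, Real.rpow_one] at hb
    have h0 : 0 ≤ C * mass (S i) ^ min ζ 1 := by
      have : 0 ≤ C := by rw [hC]; positivity
      positivity
    have hy : 0 ≤ mass (S i) * ‖toSpace (x i)‖ := by positivity
    have e : C * (mass (S i) * mass (S i) ^ min ζ 1) * ‖toSpace (x i)‖ =
        C * mass (S i) ^ min ζ 1 * (mass (S i) * ‖toSpace (x i)‖) := by ring
    rw [e] at hb
    rw [Real.norm_eq_abs]
    refine hb.trans (mul_le_mul_of_nonneg_left ?_ h0)
    have := (abs_le.1 hb).1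
    nlinarith
  have := hmx.sub hdiff
  simpa using this

/-- The error of order m^{2+a} in the gap, multiplied by ‖x‖², is m^a (m‖x‖)², which vanishes
because m‖x‖ converges. -/
theorem tendsto_gap (hM : 0 ≤ M) (hK : 0 < K) (hζ : 0 < ζ)
    (hΩ : ∀ᶠ i in L, AssumptionOmega (S i))
    (hJ : ∀ᶠ i in L, AssumptionJ M K ζ (S i) (h i) (J i))
    (hm : Tendsto (fun i => mass (S i)) L (𝓝 0))
    (hmx : Tendsto (fun i => mass (S i) * massNorm (S i) (toSpace (x i))) L (𝓝 s)) :
    Tendsto (fun i => ‖toSpace (x i)‖ ^ 2 * (AssumptionJ.gap (J i) / sigmaSq (J i))) L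
      (𝓝 (s ^ 2 / (2 * d))) := by
  have hd : (0 : ℝ) < d := by exact_mod_cast dim_pos d
  have ha : 0 < min ζ 1 := by positivity
  have hy := (tendsto_mass_mul_norm hM hK hζ hΩ hJ hm hmx).pow 2
  have hma : Tendsto (fun i => 3 * M / K * mass (S i) ^ min ζ 1) L (𝓝 0) := by
    have := (hm.rpow_const (p := min ζ 1) (Or.inr ha.le)).const_mul (3 * M / K)
    rwa [Real.zero_rpow ha.ne', mul_zero] at this
  have hlim := hma.mul hy
  rw [zero_mul] at hlim
  have hdiff : Tendsto (fun i => ‖toSpace (x i)‖ ^ 2 *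
      (2 * d * AssumptionJ.gap (J i) / sigmaSq (J i) - mass (S i) ^ 2)) L (𝓝 0) := by
    refine squeeze_zero_norm' ?_ hlim
    filter_upwards [hΩ, hJ] with i hΩi hJi
    have hb := hJi.gap_mass_bound hM hK hζ hΩi
    have hm0 := hΩi.mass_edge.1
    rw [Real.rpow_add hm0, Real.rpow_two] at hb
    rw [Real.norm_eq_abs, abs_mul, abs_of_nonneg (sq_nonneg ‖toSpace (x i)‖)]
    calc _ ≤ ‖toSpace (x i)‖ ^ 2 * _ := mul_le_mul_of_nonneg_left hb (by positivity)
      _ = _ := by ring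
  have h3 := (hdiff.add hy).div_const (2 * d : ℝ)
  rw [zero_add] at h3
  refine h3.congr fun i => ?_
  field_simp
  ring

/-- The normalised rescaled denominator of the two-point function in Fourier space. -/
noncomputable def denom (J : Lattice d → ℝ) (R : ℝ) (ξ : Space d) : ℂ :=
  ((R ^ 2 / sigmaSq J : ℝ) : ℂ) * (1 - latticeFourier J (R⁻¹ • ξ))

theorem tendsto_denom (hM : 0 ≤ M) (hK : 0 < K) (hζ : 0 < ζ)
    (hΩ : ∀ᶠ i in L, AssumptionOmega (S i))
    (hJ : ∀ᶠ i in L, AssumptionJ M K ζ (S i) (h i) (J i))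
    (hm : Tendsto (fun i => mass (S i)) L (𝓝 0))
    (hx : Tendsto (fun i => ‖toSpace (x i)‖) L atTop)
    (hmx : Tendsto (fun i => mass (S i) * massNorm (S i) (toSpace (x i))) L (𝓝 s))
    (ξ : Space d) :
    Tendsto (fun i => denom (J i) ‖toSpace (x i)‖ ξ) L
      (𝓝 (((s ^ 2 + ‖ξ‖ ^ 2) / (2 * d) : ℝ) : ℂ)) := by
  have hd : (0 : ℝ) < d := by exact_mod_cast dim_pos d
  obtain ⟨a, hae⟩ : ∃ a, a = min ζ 1 := ⟨_, rfl⟩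
  have ha : 0 < a := by rw [hae]; positivity
  have hg := tendsto_gap hM hK hζ hΩ hJ hm hmx
  have hR : Tendsto (fun i => 3 * M / (2 * d * K) * ‖ξ‖ ^ (2 + a) * ‖toSpace (x i)‖ ^ (-a)) L
      (𝓝 0) := by
    simpa using ((tendsto_rpow_neg_atTop ha).comp hx).const_mul
      (3 * M / (2 * d * K) * ‖ξ‖ ^ (2 + a))
  have hre : Tendsto (fun i => ‖toSpace (x i)‖ ^ 2 / sigmaSq (J i) *
      (latticeFourier (J i) 0 - latticeFourier (J i) (‖toSpace (x i)‖⁻¹ • ξ)).re) L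
      (𝓝 (‖ξ‖ ^ 2 / (2 * d))) := by
    rw [tendsto_iff_norm_sub_tendsto_zero]
    refine squeeze_zero' (Eventually.of_forall fun _ => norm_nonneg _) ?_ hR
    filter_upwards [hΩ, hJ, hx.eventually_gt_atTop 0] with i hΩi hJi hRi
    have he := fourier_expansion (hJi.hasMoments_J hM hΩi) hJi.symmetric_J (dim_pos d) hM ha.le
      (hae ▸ min_le_right _ _) (hae ▸ min_le_left _ _) (hJi.mem_class_zero hΩi).Q_moment
      (‖toSpace (x i)‖⁻¹ • ξ)
    have hσ := hJi.sigmaSq_lower hM hζ hΩi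
    rw [le_div_iff₀ (by positivity)] at hσ
    have hσ0 : 0 < sigmaSq (J i) := lt_of_lt_of_le (by positivity) hσ
    set R := ‖toSpace (x i)‖ with hRdef
    set D := (latticeFourier (J i) 0 - latticeFourier (J i) (R⁻¹ • ξ)).re
    have e : R ^ 2 / sigmaSq (J i) * D - ‖ξ‖ ^ 2 / (2 * d) =
        R ^ 2 / sigmaSq (J i) * (D - ‖R⁻¹ • ξ‖ ^ 2 * sigmaSq (J i) / (2 * d)) := by
      rw [norm_smul, norm_inv, Real.norm_of_nonneg hRi.le]
      field_simp
    rw [e, Real.norm_eq_abs, abs_mul, abs_of_pos (by positivity : 0 < R ^ 2 / sigmaSq (J i))]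
    have e2 : ‖R⁻¹ • ξ‖ ^ (2 + a) = ‖ξ‖ ^ (2 + a) * R ^ (-a) / R ^ 2 := by
      rw [norm_smul, norm_inv, Real.norm_of_nonneg hRi.le,
        Real.mul_rpow (by positivity) (norm_nonneg _), Real.inv_rpow hRi.le, Real.rpow_neg hRi.le,
        Real.rpow_add hRi, Real.rpow_two]
      field_simp
    rw [e2] at he
    calc _ ≤ R ^ 2 / sigmaSq (J i) * (3 * M * (‖ξ‖ ^ (2 + a) * R ^ (-a) / R ^ 2)) := by gcongr
      _ = 3 * M / sigmaSq (J i) * ‖ξ‖ ^ (2 + a) * R ^ (-a) := by field_simp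
      _ ≤ 3 * M / (2 * d * K) * ‖ξ‖ ^ (2 + a) * R ^ (-a) := by
        gcongr
        linarith
  have hsum := (Complex.continuous_ofReal.tendsto _).comp (hg.add hre)
  rw [← add_div] at hsum
  refine hsum.congr' ?_
  filter_upwards [hJ] with i hJi
  have him := latticeFourier_im hJi.symmetric_J (‖toSpace (x i)‖⁻¹ • ξ)
  have e : latticeFourier (J i) (‖toSpace (x i)‖⁻¹ • ξ) =
      ((latticeFourier (J i) (‖toSpace (x i)‖⁻¹ • ξ)).re : ℂ) :=
    Complex.ext rfl (by simpa using him)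
  rw [denom, e, Function.comp_apply, AssumptionJ.gap, latticeFourier_zero, Complex.sub_re,
    Complex.ofReal_re]
  push_cast
  ring

end Scaling

/-! ### The low-frequency limit and the two-point function -/

section MainTerm

variable {d : ℕ}

/-- The cut-off Fourier transform of the two-point function, on the scale `R`. -/
noncomputable def rescaled (τ : ℝ) (S J : Lattice d → ℝ) (R : ℝ) (ξ : Space d) : ℂ :=
  (cube d).indicator (fun k => ((sigmaSq J / R ^ 2 : ℝ) : ℂ) *
    (((heat (τ * R ^ 2) k : ℝ) : ℂ) * latticeFourier S k)) (R⁻¹ • ξ)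

/-- The continuum limit of the cut-off Fourier transform, for unit `ĥ(0)`. -/
noncomputable def continuumSymbol (d : ℕ) (τ s : ℝ) (ξ : Space d) : ℝ :=
  d * (Real.exp (-(τ / 2) * ‖ξ‖ ^ 2) * (2 / (s ^ 2 + ‖ξ‖ ^ 2)))

theorem continuous_heat (T : ℝ) : Continuous fun k : Space d => heat T k := by
  simp_rw [heat_eq]
  fun_prop

theorem measurable_rescaled {S : Lattice d → ℝ} (hS : Summable S) (τ : ℝ) (J : Lattice d → ℝ)
    (R : ℝ) : Measurable (rescaled τ S J R) := by
  refine Measurable.comp (Measurable.indicator ?_ measurableSet_cube)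
    (continuous_const_smul R⁻¹).measurable
  exact (continuous_const.mul ((Complex.continuous_ofReal.comp (continuous_heat _)).mul
    (continuous_latticeFourier hS))).measurable

theorem chr_inv_smul_neg (x : Lattice d) (ξ : Space d) :
    chr (‖toSpace x‖⁻¹ • ξ) (-x) =
      Complex.exp (Complex.I * ((inner ℝ (direction x) ξ : ℝ) : ℂ)) := by
  rw [chr, direction, toSpace_neg, inner_neg_right, real_inner_smul_left, real_inner_smul_left,
    real_inner_comm]
  congr 1
  push_cast
  ring

theorem norm_direction {x : Lattice d} (hx : 0 < ‖toSpace x‖) : ‖direction x‖ = 1 := by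
  rw [direction, norm_smul, norm_inv, norm_norm, inv_mul_cancel₀ hx.ne']

/-- Substituting k = ξ/R produces R^d against the prefactor σ²/R², which is the normalisation of the
theorem. -/
theorem integral_rescaled (τ : ℝ) (S J : Lattice d → ℝ) (x : Lattice d) :
    ∫ ξ, rescaled τ S J ‖toSpace x‖ ξ *
        Complex.exp (Complex.I * ((inner ℝ (direction x) ξ : ℝ) : ℂ)) =
      ((sigmaSq J * (‖toSpace x‖ ^ d / ‖toSpace x‖ ^ 2) : ℝ) : ℂ) *
        ∫ k in cube d, ((heat (τ * ‖toSpace x‖ ^ 2) k : ℝ) : ℂ) * latticeFourier S k *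
          chr k (-x) := by
  set R := ‖toSpace x‖ with hR
  have e : ∀ ξ, rescaled τ S J R ξ *
      Complex.exp (Complex.I * ((inner ℝ (direction x) ξ : ℝ) : ℂ)) =
      (fun k => (cube d).indicator (fun k => ((sigmaSq J / R ^ 2 : ℝ) : ℂ) *
        (((heat (τ * R ^ 2) k : ℝ) : ℂ) * latticeFourier S k * chr k (-x))) k) (R⁻¹ • ξ) := by
    intro ξ
    simp only [rescaled]
    by_cases hk : R⁻¹ • ξ ∈ cube d
    · rw [Set.indicator_of_mem hk, Set.indicator_of_mem hk, hR, chr_inv_smul_neg]; ring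
    · rw [Set.indicator_of_notMem hk, Set.indicator_of_notMem hk, zero_mul]
  simp_rw [e]
  rw [Measure.integral_comp_inv_smul_of_nonneg volume
    (fun k => (cube d).indicator (fun k => ((sigmaSq J / R ^ 2 : ℝ) : ℂ) *
        (((heat (τ * R ^ 2) k : ℝ) : ℂ) * latticeFourier S k * chr k (-x))) k) (norm_nonneg _),
    integral_indicator measurableSet_cube, integral_const_mul, finrank_euclideanSpace_fin,
    Complex.real_smul, ← mul_assoc]
  congr 1
  push_cast
  ring

variable [NeZero d] {M K ζ s τ : ℝ}

theorem norm_denom_ge (hM : 0 < M) (hK : 0 < K) (hζ : 0 < ζ) {S h J : Lattice d → ℝ}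
    (hΩ : AssumptionOmega S) (hJ : AssumptionJ M K ζ S h J) {R : ℝ} (hR : 0 < R) {ξ : Space d}
    (hξ : R⁻¹ • ξ ∈ cube d) :
    R ^ 2 * (AssumptionJ.gap J / sigmaSq J) + K / M * ‖ξ‖ ^ 2 ≤ ‖denom J R ξ‖ := by
  have hd : (0 : ℝ) < d := by exact_mod_cast dim_pos d
  have hσ := hJ.sigmaSq_lower hM.le hζ hΩ
  rw [le_div_iff₀ (by positivity)] at hσ
  have hσ0 : 0 < sigmaSq J := lt_of_lt_of_le (by positivity) hσ
  have hσM := hJ.sigmaSq_upper hM.le hζ hΩ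
  have hk := hJ.norm_one_sub_ge hΩ hξ
  rw [norm_smul, norm_inv, Real.norm_of_nonneg hR.le] at hk
  rw [denom, norm_mul, Complex.norm_real, Real.norm_of_nonneg (by positivity)]
  calc _ ≤ R ^ 2 * (AssumptionJ.gap J / sigmaSq J) + K / sigmaSq J * ‖ξ‖ ^ 2 := by gcongr
    _ = R ^ 2 / sigmaSq J * (AssumptionJ.gap J + K * (R⁻¹ * ‖ξ‖) ^ 2) := by field_simp
    _ ≤ _ := by gcongr

theorem rescaled_eq (hM : 0 < M) {S h J : Lattice d → ℝ}
    (hΩ : AssumptionOmega S) (hJ : AssumptionJ M K ζ S h J) {R : ℝ} {ξ : Space d}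
    (hξ : R⁻¹ • ξ ∈ cube d) (hD : denom J R ξ ≠ 0) :
    rescaled τ S J R ξ =
      ((heat (τ * R ^ 2) (R⁻¹ • ξ) : ℝ) : ℂ) * latticeFourier h (R⁻¹ • ξ) / denom J R ξ := by
  rw [rescaled, Set.indicator_of_mem hξ, eq_div_iff hD, denom]
  have he := hJ.fourier_equation hM.le hΩ (R⁻¹ • ξ)
  have hRσ : ((R ^ 2 / sigmaSq J : ℝ) : ℂ) ≠ 0 := fun h0 => hD (by rw [denom, h0, zero_mul])
  have h1 : ((sigmaSq J / R ^ 2 : ℝ) : ℂ) * ((R ^ 2 / sigmaSq J : ℝ) : ℂ) = 1 := by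
    have h0 : R ^ 2 / sigmaSq J ≠ 0 := by exact_mod_cast hRσ
    rw [← Complex.ofReal_mul, ← inv_div (R ^ 2), inv_mul_cancel₀ h0, Complex.ofReal_one]
  have h2 : latticeFourier S (R⁻¹ • ξ) * (1 - latticeFourier J (R⁻¹ • ξ)) =
      latticeFourier h (R⁻¹ • ξ) := by linear_combination he
  linear_combination (((heat (τ * R ^ 2) (R⁻¹ • ξ) : ℝ) : ℂ) * latticeFourier S (R⁻¹ • ξ) *
    (1 - latticeFourier J (R⁻¹ • ξ))) * h1 + ((heat (τ * R ^ 2) (R⁻¹ • ξ) : ℝ) : ℂ) * h2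

theorem norm_latticeFourier_h_le (hM : 0 < M) {S h J : Lattice d → ℝ} (hΩ : AssumptionOmega S)
    (hJ : AssumptionJ M K ζ S h J) (k : Space d) : ‖latticeFourier h k‖ ≤ M :=
  (norm_latticeFourier_le hJ.summable_h k).trans
    (lattice_one_bound hM.le (hJ.mem_class_zero hΩ).g_norm).2

variable {β : Type*} {L : Filter β} {S h J : β → Lattice d → ℝ} {x : β → Lattice d}

/-- Since ĥ(0) need not converge, only the difference is shown to vanish: ĥ at ξ/R is close to ĥ(0),
and ĥ(0) is bounded by M. The condition ξ ≠ 0 keeps the limiting denominator nonzero when s = 0. -/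
theorem tendsto_rescaled_sub (hM : 0 < M) (hK : 0 < K) (hζ : 0 < ζ)
    (hΩ : ∀ᶠ i in L, AssumptionOmega (S i))
    (hJ : ∀ᶠ i in L, AssumptionJ M K ζ (S i) (h i) (J i))
    (hm : Tendsto (fun i => mass (S i)) L (𝓝 0))
    (hx : Tendsto (fun i => ‖toSpace (x i)‖) L atTop)
    (hmx : Tendsto (fun i => mass (S i) * massNorm (S i) (toSpace (x i))) L (𝓝 s))
    {ξ : Space d} (hξ : ξ ≠ 0) :
    Tendsto (fun i => rescaled τ (S i) (J i) ‖toSpace (x i)‖ ξ -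
      latticeFourier (h i) 0 * (continuumSymbol d τ s ξ : ℂ)) L (𝓝 0) := by
  have hd : (0 : ℝ) < d := by exact_mod_cast dim_pos d
  have hξ0 : 0 < ‖ξ‖ := norm_pos_iff.2 hξ
  have hden := tendsto_denom hM.le hK hζ hΩ hJ hm hx hmx ξ
  have hD0 : (((s ^ 2 + ‖ξ‖ ^ 2) / (2 * d) : ℝ) : ℂ) ≠ 0 := by
    rw [Complex.ofReal_ne_zero]; positivity
  have hheat : Tendsto (fun i => ((heat (τ * ‖toSpace (x i)‖ ^ 2) (‖toSpace (x i)‖⁻¹ • ξ) : ℝ) : ℂ))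
      L (𝓝 ((Real.exp (-(τ / 2) * ‖ξ‖ ^ 2) : ℝ) : ℂ)) :=
    (Complex.continuous_ofReal.tendsto _).comp ((tendsto_heat τ ξ).comp hx)
  have hq := hheat.div hden hD0
  have e : ((Real.exp (-(τ / 2) * ‖ξ‖ ^ 2) : ℝ) : ℂ) / (((s ^ 2 + ‖ξ‖ ^ 2) / (2 * d) : ℝ) : ℂ) =
      (continuumSymbol d τ s ξ : ℂ) := by
    rw [← Complex.ofReal_div, continuumSymbol]
    congr 1
    field_simp
  rw [e] at hq
  obtain ⟨b, hbe⟩ : ∃ b, b = min ζ 1 := ⟨_, rfl⟩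
  have hb : 0 < b := by rw [hbe]; positivity
  have hh : Tendsto (fun i => 2 * M * (‖toSpace (x i)‖⁻¹ * ‖ξ‖) ^ b) L (𝓝 0) := by
    have h1 : Tendsto (fun i => ‖toSpace (x i)‖⁻¹ * ‖ξ‖) L (𝓝 0) := by
      simpa using (tendsto_inv_atTop_zero.comp hx).mul_const ‖ξ‖
    have := (h1.rpow_const (p := b) (Or.inr hb.le)).const_mul (2 * M)
    rwa [Real.zero_rpow hb.ne', mul_zero] at this
  have hlim := (hh.mul hq.norm).add ((hq.sub_const (continuumSymbol d τ s ξ : ℂ)).norm.const_mul M)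
  rw [zero_mul, sub_self, norm_zero, mul_zero, add_zero] at hlim
  refine squeeze_zero_norm' ?_ hlim
  filter_upwards [hΩ, hJ, hx.eventually (eventually_inv_smul_mem_cube ξ),
    hden.eventually_ne hD0, hx.eventually_gt_atTop 0] with i hΩi hJi hc hDi hRi
  rw [rescaled_eq hM hΩi hJi hc hDi]
  set R := ‖toSpace (x i)‖ with hRdef
  have h1 := norm_latticeFourier_sub_zero_le hM.le hJi.summable_h hb (hbe ▸ min_le_right _ _)
    (hbe ▸ min_le_left _ _) (hJi.mem_class_zero hΩi).g_moment (R⁻¹ • ξ)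
  rw [norm_smul, norm_inv, Real.norm_of_nonneg hRi.le] at h1
  have h2 := norm_latticeFourier_h_le hM hΩi hJi 0
  have e3 : ((heat (τ * R ^ 2) (R⁻¹ • ξ) : ℝ) : ℂ) * latticeFourier (h i) (R⁻¹ • ξ) /
      denom (J i) R ξ - latticeFourier (h i) 0 * (continuumSymbol d τ s ξ : ℂ) =
      (latticeFourier (h i) (R⁻¹ • ξ) - latticeFourier (h i) 0) *
        (((heat (τ * R ^ 2) (R⁻¹ • ξ) : ℝ) : ℂ) / denom (J i) R ξ) +
      latticeFourier (h i) 0 * (((heat (τ * R ^ 2) (R⁻¹ • ξ) : ℝ) : ℂ) / denom (J i) R ξ -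
        (continuumSymbol d τ s ξ : ℂ)) := by ring
  rw [e3]
  refine (norm_add_le _ _).trans ?_
  rw [norm_mul, norm_mul]
  exact add_le_add (mul_le_mul_of_nonneg_right h1 (norm_nonneg _))
    (mul_le_mul_of_nonneg_right h2 (norm_nonneg _))

/-- The constant c makes the lattice denominator dominate c(s² + ‖ξ‖²), and 4τ/π² is the smaller
smoothing parameter left by `heat_le`. The majorant thus has the form made integrable by
`integrable_resolvent`. -/
theorem norm_rescaled_le (hM : 0 < M) (hK : 0 < K) (hζ : 0 < ζ) (hτ : 0 < τ)
    {S h J : Lattice d → ℝ} (hΩ : AssumptionOmega S) (hJ : AssumptionJ M K ζ S h J) {R c : ℝ}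
    (hR : 0 < R) (hc : 0 < c) (hcK : c ≤ K / M)
    (hgap : c * s ^ 2 ≤ R ^ 2 * (AssumptionJ.gap J / sigmaSq J)) {ξ : Space d} (hξ : ξ ≠ 0) :
    ‖rescaled τ S J R ξ‖ ≤ M / (2 * c) *
      (Real.exp (-((4 * τ / Real.pi ^ 2) / 2) * ‖ξ‖ ^ 2) * (2 / (s ^ 2 + ‖ξ‖ ^ 2))) := by
  have hξ0 : 0 < ‖ξ‖ := norm_pos_iff.2 hξ
  by_cases hk : R⁻¹ • ξ ∈ cube d
  · have h1 := norm_denom_ge hM hK hζ hΩ hJ hR hk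
    have h2 : c * (s ^ 2 + ‖ξ‖ ^ 2) ≤ ‖denom J R ξ‖ := by
      have : c * ‖ξ‖ ^ 2 ≤ K / M * ‖ξ‖ ^ 2 := by gcongr
      linarith
    have h3 : 0 < ‖denom J R ξ‖ := lt_of_lt_of_le (by positivity) h2
    rw [rescaled_eq hM hΩ hJ hk (norm_pos_iff.1 h3), norm_div, norm_mul, Complex.norm_real,
      Real.norm_of_nonneg (heat_pos _ _).le]
    have h4 := heat_le (T := τ * R ^ 2) (by positivity) hk
    rw [norm_smul, norm_inv, Real.norm_of_nonneg hR.le] at h4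
    have e : -(2 / Real.pi ^ 2 * (τ * R ^ 2 * (R⁻¹ * ‖ξ‖) ^ 2)) =
        -((4 * τ / Real.pi ^ 2) / 2) * ‖ξ‖ ^ 2 := by
      field_simp; ring
    rw [e] at h4
    calc _ ≤ Real.exp (-((4 * τ / Real.pi ^ 2) / 2) * ‖ξ‖ ^ 2) * M / (c * (s ^ 2 + ‖ξ‖ ^ 2)) := by
          gcongr
          exact norm_latticeFourier_h_le hM hΩ hJ _
      _ = _ := by field_simp
  · rw [rescaled, Set.indicator_of_notMem hk, norm_zero]
    positivity

theorem tendsto_integral_rescaled_sub [L.IsCountablyGenerated] (hM : 0 < M) (hK : 0 < K)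
    (hζ : 0 < ζ) (hs : 0 ≤ s) (hs' : d ≤ 2 → 0 < s) (hτ : 0 < τ)
    (hΩ : ∀ᶠ i in L, AssumptionOmega (S i))
    (hJ : ∀ᶠ i in L, AssumptionJ M K ζ (S i) (h i) (J i))
    (hm : Tendsto (fun i => mass (S i)) L (𝓝 0))
    (hx : Tendsto (fun i => ‖toSpace (x i)‖) L atTop)
    (hmx : Tendsto (fun i => mass (S i) * massNorm (S i) (toSpace (x i))) L (𝓝 s)) :
    Tendsto (fun i => (∫ ξ, rescaled τ (S i) (J i) ‖toSpace (x i)‖ ξ *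
        Complex.exp (Complex.I * ((inner ℝ (direction (x i)) ξ : ℝ) : ℂ))) -
      latticeFourier (h i) 0 * (d * ((2 * (Real.pi : ℂ)) ^ d * (smoothGreen d s τ : ℂ)))) L
      (𝓝 0) := by
  have hd0 := dim_pos d
  have hd : (0 : ℝ) < d := by exact_mod_cast hd0
  have : Nonempty (Fin d) := ⟨⟨0, hd0⟩⟩
  have hne : ∀ᵐ ξ : Space d, ξ ≠ 0 := by simp [ae_iff, measure_singleton]
  -- The value 1/(4d) is strictly below the limiting coefficient 1/(2d) of s² in the rescaled gap,
  -- so the lower bound holds eventually if s > 0. If s = 0, positivity of the gap is enough.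
  obtain ⟨c, hce⟩ : ∃ c, c = min (1 / (4 * (d : ℝ))) (K / M) := ⟨_, rfl⟩
  have hc : 0 < c := by rw [hce]; positivity
  have hgap : ∀ᶠ i in L,
      c * s ^ 2 ≤ ‖toSpace (x i)‖ ^ 2 * (AssumptionJ.gap (J i) / sigmaSq (J i)) := by
    rcases hs.eq_or_lt with h0 | h0
    · filter_upwards [hΩ, hJ] with i hΩi hJi
      have hg := hJi.gap_pos hM.le hΩi
      have hσ := hJi.sigmaSq_lower hM.le hζ hΩi
      rw [le_div_iff₀ (by positivity)] at hσ
      have hσ0 : 0 < sigmaSq (J i) := lt_of_lt_of_le (by positivity) hσ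
      rw [← h0]
      simp only [ne_eq, OfNat.ofNat_ne_zero, not_false_eq_true, zero_pow, mul_zero]
      positivity
    · refine (tendsto_gap hM.le hK hζ hΩ hJ hm hmx).eventually_const_le ?_
      have : c ≤ 1 / (4 * (d : ℝ)) := hce ▸ min_le_left _ _
      calc c * s ^ 2 ≤ 1 / (4 * (d : ℝ)) * s ^ 2 := by gcongr
        _ = s ^ 2 / (4 * d) := by ring
        _ < s ^ 2 / (2 * d) := by gcongr; norm_num
  have hB2 := integrable_resolvent (d := d) hd0 hs hs' hτ
  have hB1 := integrable_resolvent (d := d) hd0 hs hs'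
    (show 0 < 4 * τ / Real.pi ^ 2 by positivity)
  have hbound := (hB1.const_mul (M / (2 * c))).add (hB2.const_mul (M * d))
  have hE : ∀ i ξ, ‖Complex.exp (Complex.I * ((inner ℝ (direction (x i)) ξ : ℝ) : ℂ))‖ = 1 :=
    fun i ξ => by rw [mul_comm, Complex.norm_exp_ofReal_mul_I]
  have hEc : ∀ i, Continuous fun ξ : Space d =>
      Complex.exp (Complex.I * ((inner ℝ (direction (x i)) ξ : ℝ) : ℂ)) := fun i => by fun_prop
  have hsymm : Measurable (continuumSymbol d τ s) := by
    unfold continuumSymbol; fun_prop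
  have hres : ∀ᶠ i in L, ∀ᵐ ξ : Space d, ‖rescaled τ (S i) (J i) ‖toSpace (x i)‖ ξ‖ ≤
      M / (2 * c) * (Real.exp (-((4 * τ / Real.pi ^ 2) / 2) * ‖ξ‖ ^ 2) *
        (2 / (s ^ 2 + ‖ξ‖ ^ 2))) := by
    filter_upwards [hΩ, hJ, hx.eventually_gt_atTop 0, hgap] with i hΩi hJi hRi hgi
    filter_upwards [hne] with ξ hξ
    exact norm_rescaled_le hM hK hζ hτ hΩi hJi hRi hc (hce ▸ min_le_right _ _) hgi hξ
  have key : Tendsto (fun i => ∫ ξ, (rescaled τ (S i) (J i) ‖toSpace (x i)‖ ξ -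
      latticeFourier (h i) 0 * (continuumSymbol d τ s ξ : ℂ)) *
        Complex.exp (Complex.I * ((inner ℝ (direction (x i)) ξ : ℝ) : ℂ))) L
      (𝓝 (∫ _ : Space d, (0 : ℂ))) := by
    refine tendsto_integral_filter_of_dominated_convergence _ ?_ ?_ hbound ?_
    · filter_upwards [hΩ] with i hΩi
      exact (((measurable_rescaled hΩi.hasMoments.summable τ (J i) _).sub
        ((Complex.measurable_ofReal.comp hsymm).const_mul _)).mul
          (hEc i).measurable).aestronglyMeasurable
    · filter_upwards [hΩ, hJ, hres] with i hΩi hJi hi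
      filter_upwards [hi] with ξ hξ
      rw [norm_mul, hE, mul_one]
      refine (norm_sub_le _ _).trans (add_le_add hξ ?_)
      rw [norm_mul, Complex.norm_real, continuumSymbol, Real.norm_of_nonneg (by positivity)]
      exact (mul_le_mul_of_nonneg_right (norm_latticeFourier_h_le hM hΩi hJi 0)
        (by positivity)).trans_eq (mul_assoc _ _ _).symm
    · filter_upwards [hne] with ξ hξ
      refine tendsto_zero_iff_norm_tendsto_zero.2 ?_
      simp_rw [norm_mul, hE, mul_one]
      exact tendsto_zero_iff_norm_tendsto_zero.1
        (tendsto_rescaled_sub hM hK hζ hΩ hJ hm hx hmx hξ)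
  rw [integral_zero] at key
  refine key.congr' ?_
  filter_upwards [hΩ, hres, hx.eventually_gt_atTop 0] with i hΩi hi hRi
  have hI1 : Integrable fun ξ => rescaled τ (S i) (J i) ‖toSpace (x i)‖ ξ *
      Complex.exp (Complex.I * ((inner ℝ (direction (x i)) ξ : ℝ) : ℂ)) := by
    refine Integrable.mono' (hB1.const_mul (M / (2 * c)))
      ((measurable_rescaled hΩi.hasMoments.summable τ (J i) _).mul
        (hEc i).measurable).aestronglyMeasurable ?_
    filter_upwards [hi] with ξ hξ
    rwa [norm_mul, hE, mul_one]
  have hI2 : Integrable fun ξ => ((Real.exp (-(τ / 2) * ‖ξ‖ ^ 2) *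
      (2 / (s ^ 2 + ‖ξ‖ ^ 2)) : ℝ) : ℂ) *
        Complex.exp (Complex.I * ((inner ℝ (direction (x i)) ξ : ℝ) : ℂ)) := by
    refine Integrable.mono' hB2 ((Complex.measurable_ofReal.comp (by fun_prop)).mul
        (hEc i).measurable).aestronglyMeasurable (ae_of_all _ fun ξ => ?_)
    rw [norm_mul, hE, mul_one, Complex.norm_real, Real.norm_of_nonneg (by positivity)]
  have e : ∀ ξ, (rescaled τ (S i) (J i) ‖toSpace (x i)‖ ξ -
      latticeFourier (h i) 0 * (continuumSymbol d τ s ξ : ℂ)) *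
        Complex.exp (Complex.I * ((inner ℝ (direction (x i)) ξ : ℝ) : ℂ)) =
      rescaled τ (S i) (J i) ‖toSpace (x i)‖ ξ *
        Complex.exp (Complex.I * ((inner ℝ (direction (x i)) ξ : ℝ) : ℂ)) -
      latticeFourier (h i) 0 * d * (((Real.exp (-(τ / 2) * ‖ξ‖ ^ 2) *
      (2 / (s ^ 2 + ‖ξ‖ ^ 2)) : ℝ) : ℂ) *
        Complex.exp (Complex.I * ((inner ℝ (direction (x i)) ξ : ℝ) : ℂ))) := fun ξ => by
    rw [continuumSymbol]; push_cast; ring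
  simp_rw [e]
  rw [integral_sub hI1 (hI2.const_mul _), integral_const_mul,
    integral_resolvent hd0 hs hs' hτ (norm_direction hRi)]
  ring

theorem tendsto_twoPoint [L.IsCountablyGenerated] (hM : 0 < M) (hK : 0 < K)
    (hζ : 0 < ζ) (hs : 0 ≤ s) (hs' : d ≤ 2 → 0 < s)
    (hΩ : ∀ᶠ i in L, AssumptionOmega (S i))
    (hJ : ∀ᶠ i in L, AssumptionJ M K ζ (S i) (h i) (J i))
    (hm : Tendsto (fun i => mass (S i)) L (𝓝 0))
    (hx : Tendsto (fun i => ‖toSpace (x i)‖) L atTop)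
    (hmx : Tendsto (fun i => mass (S i) * massNorm (S i) (toSpace (x i))) L (𝓝 s)) :
    Tendsto (fun i => sigmaSq (J i) * (‖toSpace (x i)‖ ^ d / ‖toSpace (x i)‖ ^ 2) * S i (x i) -
      (latticeFourier (h i) 0).re * (d * smoothGreen d s 0)) L (𝓝 0) := by
  have hd0 := dim_pos d
  have hd : (0 : ℝ) < d := by exact_mod_cast hd0
  obtain ⟨C, hC0, hC⟩ := tail_bound (d := d) hM hK hζ
  have herr : Tendsto (fun τ : ℝ => M * C * √τ + M * (d * |smoothGreen d s τ - smoothGreen d s 0|))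
      (𝓝[>] 0) (𝓝 0) := by
    have h1 : Tendsto (fun τ : ℝ => √τ) (𝓝[>] 0) (𝓝 0) := by
      have := (Real.continuous_sqrt.tendsto 0).mono_left (nhdsWithin_le_nhds (s := Set.Ioi 0))
      rwa [Real.sqrt_zero] at this
    have h2 := ((tendsto_smoothGreen hd0 hs hs').sub_const (smoothGreen d s 0)).abs
    simpa using (h1.const_mul (M * C)).add ((h2.const_mul (d : ℝ)).const_mul M)
  rw [Metric.tendsto_nhds]
  intro ε hε
  -- The smoothing parameter is fixed first, from errors that are uniform along the filter; the
  -- limit is taken afterwards at this τ.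
  obtain ⟨τ, hτε, hτ⟩ :=
    ((herr.eventually_lt_const (half_pos hε)).and self_mem_nhdsWithin).exists
  have hτ0 : 0 < τ := hτ
  have hmain := tendsto_integral_rescaled_sub hM hK hζ hs hs' hτ0 hΩ hJ hm hx hmx
  filter_upwards [hΩ, hJ, hx.eventually_gt_atTop 0,
    (tendsto_zero_iff_norm_tendsto_zero.1 hmain).eventually_lt_const (half_pos hε)]
    with i hΩi hJi hRi hi
  have hσM := hJi.sigmaSq_upper hM.le hζ hΩi
  have hσ := hJi.sigmaSq_lower hM.le hζ hΩi
  rw [le_div_iff₀ (by positivity)] at hσ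
  have hσ0 : 0 < sigmaSq (J i) := lt_of_lt_of_le (by positivity) hσ
  have hx0 : x i ≠ 0 := fun h0 => by simp [h0, toSpace_zero] at hRi
  have hSs := hΩi.hasMoments.summable
  set R := ‖toSpace (x i)‖ with hR
  have htail := hC (S i) (h i) (J i) hΩi hJi (x i) (τ * R ^ 2) (by positivity) hx0
  set A := ∫ k in cube d, ((heat (τ * R ^ 2) k : ℝ) : ℂ) * latticeFourier (S i) k * chr k (-(x i))
    with hA
  set B := ∫ k in cube d, ((1 - heat (τ * R ^ 2) k : ℝ) : ℂ) * latticeFourier (S i) k *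
    chr k (-(x i)) with hB
  have hcont : Continuous fun k : Space d => latticeFourier (S i) k * chr k (-(x i)) :=
    (continuous_latticeFourier hSs).mul (continuous_chr _)
  have hsplit : A + B = (2 * (Real.pi : ℂ)) ^ d * (S i (x i) : ℂ) := by
    rw [← fourier_inversion hSs, hA, hB, ← integral_add]
    · refine integral_congr_ae (ae_of_all _ fun k => ?_)
      push_cast; ring
    · simp_rw [mul_assoc]
      exact ((Complex.continuous_ofReal.comp (continuous_heat _)).mul hcont).continuousOn.integrableOn_compact
        isCompact_cube
    · simp_rw [mul_assoc]
      exact ((Complex.continuous_ofReal.comp (continuous_const.sub (continuous_heat _))).mul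
        hcont).continuousOn.integrableOn_compact isCompact_cube
  obtain ⟨P, hP⟩ : ∃ P : ℝ, P = sigmaSq (J i) * (R ^ d / R ^ 2) := ⟨_, rfl⟩
  have hP0 : 0 < P := by rw [hP]; positivity
  rw [integral_rescaled, ← hR, ← hA, ← hP] at hi
  have hBP : ‖(P : ℂ) * B‖ ≤ M * C * √τ := by
    rw [norm_mul, Complex.norm_real, Real.norm_of_nonneg hP0.le]
    calc P * ‖B‖ ≤ P * (C * √(τ * R ^ 2) / R ^ (d - 1)) := by gcongr
      -- The powers of R cancel: √(τR²) = √τ R, and R^d/R² times R/R^{d-1} is 1.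
      _ = sigmaSq (J i) * C * √τ := by
        rw [Real.sqrt_mul hτ0.le, Real.sqrt_sq hRi.le, hP]
        obtain ⟨n, rfl⟩ : ∃ n, d = n + 1 := ⟨d - 1, by omega⟩
        rw [Nat.add_sub_cancel, pow_succ]
        field_simp
      _ ≤ M * C * √τ := by gcongr
  obtain ⟨H, hH⟩ : ∃ H, H = (latticeFourier (h i) 0).re := ⟨_, rfl⟩
  have hHc : latticeFourier (h i) 0 = (H : ℂ) := by rw [hH, latticeFourier_zero, Complex.ofReal_re]
  have hHM : |H| ≤ M := by
    have := norm_latticeFourier_h_le hM hΩi hJi 0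
    rwa [hHc, Complex.norm_real] at this
  rw [hHc] at hi
  have hid : (2 * (Real.pi : ℂ)) ^ d * ((P * S i (x i) - H * (d * smoothGreen d s τ) : ℝ) : ℂ) =
      ((P : ℂ) * A - (H : ℂ) * (d * ((2 * (Real.pi : ℂ)) ^ d * (smoothGreen d s τ : ℂ)))) +
        (P : ℂ) * B := by
    push_cast
    linear_combination (-(P : ℂ)) * hsplit
  -- Both errors are known for the quantity multiplied by (2π)^d, which is at least one and can be
  -- dropped.
  have h1 : |P * S i (x i) - H * (d * smoothGreen d s τ)| < ε / 2 + M * C * √τ := by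
    have h2 : ‖(2 * (Real.pi : ℂ)) ^ d * ((P * S i (x i) - H * (d * smoothGreen d s τ) : ℝ) : ℂ)‖ <
        ε / 2 + M * C * √τ := by
      rw [hid]
      exact lt_of_le_of_lt (norm_add_le _ _) (add_lt_add_of_lt_of_le hi hBP)
    have e : (2 * (Real.pi : ℂ)) ^ d = (((2 * Real.pi) ^ d : ℝ) : ℂ) := by push_cast; rfl
    rw [e, norm_mul, Complex.norm_real, Complex.norm_real, Real.norm_of_nonneg (by positivity),
      Real.norm_eq_abs] at h2
    refine lt_of_le_of_lt (le_mul_of_one_le_left (abs_nonneg _) (one_le_pow₀ ?_)) h2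
    linarith [Real.pi_gt_three]
  rw [← hP, ← hH, dist_zero_right, Real.norm_eq_abs]
  have e : P * S i (x i) - H * (d * smoothGreen d s 0) =
      (P * S i (x i) - H * (d * smoothGreen d s τ)) +
        H * (d * (smoothGreen d s τ - smoothGreen d s 0)) := by ring
  rw [e]
  have h3 : |H * (d * (smoothGreen d s τ - smoothGreen d s 0))| ≤
      M * (d * |smoothGreen d s τ - smoothGreen d s 0|) := by
    rw [abs_mul, abs_mul, abs_of_pos hd]
    gcongr
  calc _ ≤ _ := abs_add_le _ _
    _ < _ := add_lt_add_of_lt_of_le h1 h3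
    _ < ε := by linarith

end MainTerm

end OZ

/-! ### The asymptotic formula along an arbitrary filter -/

theorem theorem2p3 (d : ℕ) [NeZero d] (zc δ M K ζ : ℝ) (hδ : 0 < δ) (hM : 0 < M) (hK : 0 < K)
    (hζ : 0 < ζ)
    (S h J : ℝ → OZ.Lattice d → ℝ)
    (hΩ : ∀ z ∈ Set.Ico (zc - δ) zc, OZ.AssumptionOmega (S z))
    (hJ : ∀ z ∈ Set.Ico (zc - δ) zc, OZ.AssumptionJ M K ζ (S z) (h z) (J z))
    (hm : Tendsto (fun z => OZ.mass (S z)) (𝓝[<] zc) (𝓝 0))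
    {ι : Type*} (l : Filter ι) (z : ι → ℝ) (x : ι → OZ.Lattice d) (s : ℝ)
    (hs : 0 ≤ s) (hs' : d ≤ 2 → 0 < s)
    (hz : Tendsto z l (𝓝[<] zc))
    (hx : Tendsto (fun i => ‖OZ.toSpace (x i)‖) l atTop)
    (hmx : Tendsto (fun i => OZ.mass (S (z i)) * OZ.massNorm (S (z i)) (OZ.toSpace (x i))) l
      (𝓝 s)) :
    ∃ r : ι → ℝ, Tendsto r l (𝓝 0) ∧
      ∀ᶠ i in l, S (z i) (x i) =
        (d : ℝ) / (OZ.sigmaSq (J (z i)) * ‖OZ.toSpace (x i)‖ ^ ((d : ℤ) - 2)) *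
          OZ.massiveGreen s (OZ.direction (x i)) *
            ((OZ.latticeFourier (h (z i)) 0).re + r i) := by
  have hd0 := OZ.dim_pos d
  have hd : (0 : ℝ) < d := by exact_mod_cast hd0
  have hIco : ∀ᶠ z in 𝓝[<] zc, z ∈ Set.Ico (zc - δ) zc := Ico_mem_nhdsLT (by linarith)
  have hG := OZ.smoothGreen_pos (d := d) hd0 hs hs'
  -- a countably generated filter through which the given limit factors
  let φ : ℝ × OZ.Lattice d → ℝ × ℝ × ℝ := fun p => (p.1, ‖OZ.toSpace p.2‖,
    OZ.mass (S p.1) * OZ.massNorm (S p.1) (OZ.toSpace p.2))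
  let L : Filter (ℝ × OZ.Lattice d) := comap φ ((𝓝[<] zc) ×ˢ (atTop ×ˢ 𝓝 s))
  have hφ : Tendsto φ L ((𝓝[<] zc) ×ˢ (atTop ×ˢ 𝓝 s)) := tendsto_comap
  have h1 : Tendsto (fun p : ℝ × OZ.Lattice d => p.1) L (𝓝[<] zc) :=
    (tendsto_fst.comp hφ : Tendsto (Prod.fst ∘ φ) L (𝓝[<] zc))
  have h2 : Tendsto (fun p : ℝ × OZ.Lattice d => ‖OZ.toSpace p.2‖) L atTop :=
    (tendsto_fst.comp (tendsto_snd.comp hφ) : Tendsto (Prod.fst ∘ Prod.snd ∘ φ) L atTop)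
  have h3 : Tendsto (fun p : ℝ × OZ.Lattice d =>
      OZ.mass (S p.1) * OZ.massNorm (S p.1) (OZ.toSpace p.2)) L (𝓝 s) :=
    (tendsto_snd.comp (tendsto_snd.comp hφ) : Tendsto (Prod.snd ∘ Prod.snd ∘ φ) L (𝓝 s))
  -- Dominated convergence requires a countably generated filter, while `l` is arbitrary; the limit
  -- is therefore proved along `L` and pulled back.
  have hzx : Tendsto (fun i => (z i, x i)) l L :=
    tendsto_comap_iff.2 (hz.prodMk (hx.prodMk hmx))
  have hmain := (OZ.tendsto_twoPoint (S := fun p : ℝ × OZ.Lattice d => S p.1)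
    (h := fun p => h p.1) (J := fun p => J p.1) (x := fun p => p.2) hM hK hζ hs hs'
    (h1.eventually (hIco.mono fun z hz => hΩ z hz)) (h1.eventually (hIco.mono fun z hz => hJ z hz))
    (hm.comp h1) h2 h3).comp hzx
  -- The remainder is the vanishing difference divided by d times the Green function, which does not
  -- depend on the index and is positive by `hG`.
  refine ⟨_, by simpa using hmain.div_const (d * OZ.smoothGreen d s 0), ?_⟩
  filter_upwards [hz.eventually hIco, hx.eventually_gt_atTop 0] with i hi hRi
  have hσ := (hJ _ hi).sigmaSq_lower hM.le hζ (hΩ _ hi)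
  rw [le_div_iff₀ (by positivity)] at hσ
  have hσ0 : 0 < OZ.sigmaSq (J (z i)) := lt_of_lt_of_le (by positivity) hσ
  rw [OZ.massiveGreen_eq (OZ.norm_direction hRi), zpow_sub₀ hRi.ne', zpow_natCast, zpow_ofNat]
  field_simp
  ring
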